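/- Let $K$ be a number field with ring of integers $\mathcal{O}_K$, let $E/K$ be an elliptic curve given by a Weierstrass equation $y^2+a_1xy+a_3y=x^3+a_2x^2+a_4x+a_6$ with $a_i\in\mathcal{O}_K$ (not necessarily minimal), and let $\mathbf{P}=(P_1,\dots,P_n)$ be an $n$-tuple of ($\mathbb{Z}$-)linearly independent points of $E(K)$. For $\mathbf v\in\mathbb{Z}^n$ write $\mathbf v\cdot\mathbf P=v_1P_1+\dots+v_nP_n$. Notation. For $P\in E(K)$, $P\ne O$, let $D_P$ be the integral ideal with $x(P)\mathcal{O}_K=A_PD_P^{-2}$, where $A_P,D_P$ are coprime integral ideals, that is, $D_P=\{a\in\mathcal{O}_K: a^2x(P)\in\mathcal{O}_K\}$; put $D_O=(0)$. For a nonzero prime ideal $\mathfrak p$ of $\mathcal{O}_K$ and a nonzero fractional ideal $\mathfrak a$, $d_{\mathfrak p}(\mathfrak a)$ is the exponent of $\mathfrak p$ in $\mathfrak a$, and $d_{\mathfrak p}((0))=\infty$. An elliptic net on a free abelian group $A$ of finite rank with values in an integral domain is a map $W$ with $W(0)=0$ and, for all $p,q,r,s\in A$, $$W(p+q+s)W(p-q)W(r+s)W(r)+W(q+r+s)W(q-r)W(p+s)W(p)+W(r+p+s)W(r-p)W(q+s)W(q)=0.$$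 Let $\Psi_{\mathbf v}=\Psi_{\mathbf v}(\mathbf P)\in K$ $(\mathbf v\in\mathbb{Z}^n)$ be the values of the net polynomials of $E$ at $\mathbf P$: the elliptic net on $\mathbb{Z}^n$ with $\Psi_{m\mathbf e_i}=\psi_m(P_i)$ (the $m$-th division polynomial), $\Psi_{\mathbf e_i+\mathbf e_j}=1$ and $\Psi_{2\mathbf e_i+\mathbf e_j}=2x_i+x_j-\left(\frac{y_j-y_i}{x_j-x_i}\right)^2-a_1\frac{y_j-y_i}{x_j-x_i}+a_2$ for $i\ne j$, where $P_i=(x_i,y_i)$, such that $\Psi_{\mathbf v}=0$ if and only if $\mathbf v\cdot\mathbf P=O$, and $\Psi_{\mathbf v}^2\Psi_{\mathbf u}^2\,(x(\mathbf v\cdot\mathbf P)-x(\mathbf u\cdot\mathbf P))=-\Psi_{\mathbf v+\mathbf u}\Psi_{\mathbf v-\mathbf u}$ whenever $\mathbf v\cdot\mathbf P,\mathbf u\cdot\mathbf P\neq O$. Define $$F_{\mathbf v}(\mathbf P)=\prod_{1\le i\le j\le n}A_{ij}^{v_iv_j},\qquad A_{ii}=D_{P_i},\qquad A_{ij}=D_{P_i+P_j}D_{P_i}^{-1}D_{P_j}^{-1}\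 (i\ne j),\qquad \widehat\Psi_{\mathbf v}(\mathbf P)=F_{\mathbf v}(\mathbf P)\,\Psi_{\mathbf v}(\mathbf P)\,\mathcal{O}_K .$$ A map $G$ from an abelian group to a multiplicatively written commutative group is a quadratic form if $G(x+y+z)G(x)G(y)G(z)=G(x+y)G(x+z)G(y+z)$ and $G(x+y)G(x-y)=G(x)^2G(y)^2$ for all $x,y,z$. Two elliptic nets $W_1,W_2\colon A\to K$ are scale equivalent if $W_1=W_2\cdot G$ for some quadratic form $G\colon A\to K^\times$. Then: 1. $\mathbf v\mapsto F_{\mathbf v}(\mathbf P)$ is a quadratic form on $\mathbb{Z}^n$ with values in the group of nonzero fractional ideals of $K$. 2. Let $\mathfrak p$ be a nonzero prime ideal of $\mathcal{O}_K$ such that $P_i \bmod \mathfrak p$ is non-singular for all $1\le i\le n$. Then $d_{\mathfrak p}(D_{\mathbf v\cdot\mathbf P})=d_{\mathfrak p}(\widehat\Psi_{\mathbf v}(\mathbf P))$ for all $\mathbf v\in\mathbb{Z}^n$. 3. If $P_i\bmod\mathfrak p$ is non-singular for all $1\le i\le n$ and all nonzero primes $\mathfrak p$ of $\mathcal{O}_K$,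 then $D_{\mathbf v\cdot\mathbf P}=\widehat\Psi_{\mathbf v}(\mathbf P)$ for all $\mathbf v\in\mathbb{Z}^n$. 4. Suppose that $K$ has class number $1$. Then the $A_{ij}$ have generators $\alpha_{ij}\in K$, and for every choice of generators $\alpha_{ij}$ of $A_{ij}$ $(i\le j)$ the elements $\prod_{1\le i\le j\le n}\alpha_{ij}^{v_iv_j}\,\Psi_{\mathbf v}(\mathbf P)$ generate the ideals $\widehat\Psi_{\mathbf v}(\mathbf P)$, and they form an elliptic net that is scale equivalent to $\Psi_{\mathbf v}(\mathbf P)$. -/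

import Mathlib

open scoped NumberField nonZeroDivisors

namespace EllNet

/-- An elliptic net: `W 0 = 0` together with Stange's four-variable recurrence. -/
def IsElliptic {A R : Type*} [AddCommGroup A] [CommRing R] (W : A → R) : Prop :=
  W 0 = 0 ∧ ∀ p q r s : A,
    W (p + q + s) * W (p - q) * W (r + s) * W r
      + W (q + r + s) * W (q - r) * W (p + s) * W p
      + W (r + p + s) * W (r - p) * W (q + s) * W q = 0

/-- A quadratic form from an additive group to a commutative monoid written multiplicatively:
the three-variable identity, and the parallelogram law (which excludes a linear part). -/
def IsQuadForm {A M : Type*} [AddCommGroup A] [CommMonoid M] (F : A → M) : Prop :=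
  (∀ x y z : A, F (x + y + z) * F x * F y * F z = F (x + y) * F (x + z) * F (y + z)) ∧
    ∀ x y : A, F (x + y) * F (x - y) = F x ^ 2 * F y ^ 2

/-- Two elliptic nets with values in a field are scale equivalent if they differ by a
quadratic form with values in the multiplicative group. -/
def ScaleEquivalent {A K : Type*} [AddCommGroup A] [Field K] (W₁ W₂ : A → K) : Prop :=
  IsElliptic W₁ ∧ IsElliptic W₂ ∧
    ∃ F : A → Kˣ, IsQuadForm F ∧ ∀ v, W₁ v = W₂ v * (F v : K)

section Curve

variable {K : Type*} [Field K] [DecidableEq K] (E : WeierstrassCurve K) {n : ℕ}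

/-- The linear combination `v · P = v₁ P₁ + ⋯ + vₙ Pₙ`. -/
noncomputable def comb (P : Fin n → E.toAffine.Point) (v : Fin n → ℤ) : E.toAffine.Point :=
  ∑ i, v i • P i

/-- The characterization of the family `v ↦ Ψ_v(P)` of values of the net polynomials of `E` at
`P = (P₁, …, Pₙ)`: it is the elliptic net with the prescribed initial values such that
`x(v · P) = Φ_v(P) / Ψ_v(P)²`. It is used only to single out the family `netPoly`. -/
structure IsNetPoly (P : Fin n → E.toAffine.Point) (Ψ : (Fin n → ℤ) → K) : Prop where
  isElliptic : IsElliptic Ψ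
  /-- `Ψ_{m e_i}` is the `m`-th division polynomial at `P_i`; in particular `Ψ_{e_i} = 1` and
  `Ψ_{2 e_i} = 2 y_i + a₁ x_i + a₃`. -/
  single : ∀ i x y h, P i = .some x y h → ∀ m : ℤ, Ψ (Pi.single i m) = (E.ψ m).evalEval x y
  add_single : ∀ i j, i ≠ j → Ψ (Pi.single i 1 + Pi.single j 1) = 1
  two_add_single : ∀ i j, i ≠ j → ∀ x y h x' y' h',
    P i = .some x y h → P j = .some x' y' h' →
      Ψ (Pi.single i 2 + Pi.single j 1) =
        2 * x + x' - ((y' - y) / (x' - x)) ^ 2 - E.a₁ * ((y' - y) / (x' - x)) + E.a₂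
  /-- `Ψ_v(P)` vanishes exactly when `v · P = O`. -/
  eq_zero_iff : ∀ v, Ψ v = 0 ↔ comb E P v = 0
  /-- `Ψ_v² Ψ_u² (x(v · P) - x(u · P)) = - Ψ_{v+u} Ψ_{v-u}`; with `u = e_i` this says
  `x(v · P) = Φ_v / Ψ_v²` for `Φ_v = Ψ_v² x(P_i) - Ψ_{v + e_i} Ψ_{v - e_i}`. -/
  x_sub_x : ∀ v u x y h x' y' h', comb E P v = .some x y h → comb E P u = .some x' y' h' →
    Ψ v ^ 2 * Ψ u ^ 2 * (x - x') = -(Ψ (v + u) * Ψ (v - u))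

/-- The values `Ψ_v(P)` of the net polynomials at `P`: the family determined by `IsNetPoly`.
That such a family exists, for example for linearly independent points, is a theorem and
is not assumed anywhere. -/
noncomputable def netPoly (P : Fin n → E.toAffine.Point) : (Fin n → ℤ) → K :=
  Classical.epsilon (IsNetPoly E P)

end Curve

section NumberField

variable {K : Type*} [Field K] [NumberField K]

/-- The ideal `D` in `x 𝓞_K = A D⁻²` with `A`, `D` coprime (see `denIdeal_eq`), given directly as
`{a ∈ 𝓞_K | a² x ∈ 𝓞_K}`. -/
def denIdeal (x : K) : Ideal (𝓞 K) where
  carrier := {a | IsIntegral ℤ ((a : K) ^ 2 * x)}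
  zero_mem' := by simpa using isIntegral_zero
  add_mem' := by
    intro a b ha hb
    change IsIntegral ℤ ((a : K) ^ 2 * x) at ha
    change IsIntegral ℤ ((b : K) ^ 2 * x) at hb
    change IsIntegral ℤ (((a + b : 𝓞 K) : K) ^ 2 * x)
    have hab : IsIntegral ℤ ((a : K) * b * x) := by
      refine IsIntegral.of_pow (n := 2) two_pos ?_
      have h : ((a : K) * b * x) ^ 2 = ((a : K) ^ 2 * x) * ((b : K) ^ 2 * x) := by ring
      rw [h]
      exact ha.mul hb
    have h : ((a + b : 𝓞 K) : K) ^ 2 * x =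
        (a : K) ^ 2 * x + (b : K) ^ 2 * x + ((a : K) * b * x + (a : K) * b * x) := by
      push_cast
      ring
    rw [h]
    exact (ha.add hb).add (hab.add hab)
  smul_mem' := by
    intro c a ha
    change IsIntegral ℤ ((a : K) ^ 2 * x) at ha
    change IsIntegral ℤ (((c * a : 𝓞 K) : K) ^ 2 * x)
    have h : ((c * a : 𝓞 K) : K) ^ 2 * x = (c : K) ^ 2 * ((a : K) ^ 2 * x) := by
      push_cast
      ring
    rw [h]
    exact (c.isIntegral_coe.pow 2).mul ha

/-- If `x 𝓞_K = A D⁻²` with coprime ideals `A` and `D`, then `denIdeal x = D`. -/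
theorem denIdeal_eq (x : K) (A D : Ideal (𝓞 K)) (hAD : IsCoprime A D)
    (h : FractionalIdeal.spanSingleton (𝓞 K)⁰ x * (D : FractionalIdeal (𝓞 K)⁰ K) ^ 2 =
      (A : FractionalIdeal (𝓞 K)⁰ K)) :
    denIdeal x = D := by
  have key : ∀ d ∈ D ^ 2, ∃ c ∈ A, (c : K) = x * (d : K) := by
    intro d hd
    have h1 : x * (d : K) ∈ (A : FractionalIdeal (𝓞 K)⁰ K) := by
      rw [← h, ← FractionalIdeal.coeIdeal_pow]
      exact FractionalIdeal.mul_mem_mul (FractionalIdeal.mem_spanSingleton_self _ x)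
        ((FractionalIdeal.mem_coeIdeal _).2 ⟨d, hd, rfl⟩)
    obtain ⟨c, hc, hcx⟩ := (FractionalIdeal.mem_coeIdeal _).1 h1
    exact ⟨c, hc, hcx⟩
  ext a
  constructor
  · intro ha
    obtain ⟨t, ht⟩ : ∃ t : 𝓞 K, (t : K) = (a : K) ^ 2 * x := ⟨⟨_, ha⟩, rfl⟩
    have hA : Ideal.span {a ^ 2} * A ≤ D ^ 2 := by
      have h2 : ((Ideal.span {a ^ 2} * A : Ideal (𝓞 K)) : FractionalIdeal (𝓞 K)⁰ K) ≤
          ((D ^ 2 : Ideal (𝓞 K)) : FractionalIdeal (𝓞 K)⁰ K) := by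
        have h3 : ((Ideal.span {a ^ 2} * A : Ideal (𝓞 K)) : FractionalIdeal (𝓞 K)⁰ K) =
            ((Ideal.span {t} * D ^ 2 : Ideal (𝓞 K)) : FractionalIdeal (𝓞 K)⁰ K) := by
          rw [FractionalIdeal.coeIdeal_mul, FractionalIdeal.coeIdeal_mul, ← h,
            FractionalIdeal.coeIdeal_pow, FractionalIdeal.coeIdeal_span_singleton,
            FractionalIdeal.coeIdeal_span_singleton, ← mul_assoc,
            FractionalIdeal.spanSingleton_mul_spanSingleton]
          congr 2
          rw [map_pow]
          exact ht.symm
        rw [h3]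
        exact (FractionalIdeal.coeIdeal_le_coeIdeal K).2 Ideal.mul_le_right
      exact (FractionalIdeal.coeIdeal_le_coeIdeal K).1 h2
    obtain ⟨u, hu, w, hw, huw⟩ := Ideal.isCoprime_iff_exists.1 (hAD.pow_right (n := 2))
    have ha2 : a ^ 2 ∈ D ^ 2 := by
      have h4 : a ^ 2 = a ^ 2 * u + a ^ 2 * w := by rw [← mul_add, huw, mul_one]
      rw [h4]
      exact add_mem (hA (Ideal.mul_mem_mul (Ideal.mem_span_singleton_self _) hu))
        (Ideal.mul_mem_left _ _ hw)
    have h5 : D ^ 2 ∣ Ideal.span {a} ^ 2 := by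
      rw [Ideal.span_singleton_pow, Ideal.dvd_span_singleton]
      exact ha2
    exact Ideal.dvd_span_singleton.1 ((UniqueFactorizationMonoid.pow_dvd_pow_iff_dvd two_ne_zero).1 h5)
  · intro ha
    obtain ⟨c, -, hc⟩ := key (a ^ 2) (Ideal.pow_mem_pow ha 2)
    change IsIntegral ℤ ((a : K) ^ 2 * x)
    have h6 : (a : K) ^ 2 * x = (c : K) := by
      rw [hc]
      push_cast
      ring
    rw [h6]
    exact c.isIntegral_coe

/-- The exponent `d_𝔭(I)` of `𝔭` in the factorization of a fractional ideal, with
`d_𝔭(0) = ∞`. -/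
noncomputable def expAt (𝔭 : IsDedekindDomain.HeightOneSpectrum (𝓞 K))
    (I : FractionalIdeal (𝓞 K)⁰ K) : WithTop ℤ :=
  open Classical in if I = 0 then ⊤ else (FractionalIdeal.count K 𝔭 I : ℤ)

variable (E : WeierstrassCurve K)

/-- The denominator ideal `D_P`, with `D_O = 0`. -/
noncomputable def den : E.toAffine.Point → FractionalIdeal (𝓞 K)⁰ K
  | .zero => 0
  | .some x _ _ => (denIdeal x : FractionalIdeal (𝓞 K)⁰ K)

/-- For a Weierstrass equation with coefficients in `𝓞_K`, the reduction of `P` modulo `𝔭` is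
non-singular. A point reduces to the (non-singular) point at infinity exactly when it is `O` or
`x(P)` is not `𝔭`-integral. Otherwise its coordinates are `𝔭`-integral, and the reduction is
non-singular exactly when one of the partial derivatives is a `𝔭`-adic unit. -/
def NonsingularMod (𝔭 : IsDedekindDomain.HeightOneSpectrum (𝓞 K)) : E.toAffine.Point → Prop
  | .zero => True
  | .some x y _ => 1 < 𝔭.valuation K x ∨
      𝔭.valuation K (E.toAffine.polynomialX.evalEval x y) = 1 ∨
      𝔭.valuation K (E.toAffine.polynomialY.evalEval x y) = 1

variable [DecidableEq K] {n : ℕ} (P : Fin n → E.toAffine.Point)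

/-- The ideals `A_{ii} = D_{P_i}` and `A_{ij} = D_{P_i + P_j} D_{P_i}⁻¹ D_{P_j}⁻¹` for `i ≠ j`. -/
noncomputable def formIdeal (i j : Fin n) : FractionalIdeal (𝓞 K)⁰ K :=
  if i = j then den E (P i) else den E (P i + P j) * (den E (P i))⁻¹ * (den E (P j))⁻¹

/-- `∏_{i ≤ j} c_{ij} ^ (v_i v_j)`, for coefficients `c_{ij}` in a commutative group with zero. -/
def prodForm {M : Type*} [CommGroupWithZero M] (c : Fin n → Fin n → M) (v : Fin n → ℤ) : M :=
  ∏ i, ∏ j with i ≤ j, c i j ^ (v i * v j)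

/-- The ideal-valued form `F_v(P) = ∏_{i ≤ j} A_{ij} ^ (v_i v_j)`. -/
noncomputable def idealForm (v : Fin n → ℤ) : FractionalIdeal (𝓞 K)⁰ K :=
  prodForm (formIdeal E P) v

/-- The fractional ideal `Ψ̂_v(P) = F_v(P) Ψ_v(P) 𝓞_K`. -/
noncomputable def netIdeal (v : Fin n → ℤ) : FractionalIdeal (𝓞 K)⁰ K :=
  idealForm E P v * FractionalIdeal.spanSingleton (𝓞 K)⁰ (netPoly E P v)

end NumberField

end EllNet

/-!
The theorem has two halves: the family `netPoly` is characterized by `IsNetPoly`, so the values of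
the net polynomials have to be constructed first; then their valuations have to be computed.

*Construction of the net.* Over the complex numbers `Ψ_v` is a product of values of the Weierstrass
`σ`-function. This is imitated algebraically over any field of characteristic `0`, for an injective
homomorphism from `ℤⁿ` to the points. The slope of the line through two points plays the part of
`ζ(a + b) - ζ(a) - ζ(b)`. It is a symmetric `2`-cocycle: for four points of sum zero the sum of the
slopes of two lines joining them in pairs does not depend on the pairing (`sl_add_sl`), as is seen
by comparing, in the coordinate ring, the two products of lines, which cut out the same four points.
A symmetric cocycle on `ℤⁿ` is a coboundary, and this gives an odd function `ζ` (`exists_zeta`). The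
function `g(a, b, c) = ζ(a + b + c) - ζ(a) - ζ(b) - ζ(c)` is again a cocycle, multiplicatively, so
it is the inverse of a third difference of a function `σ` (`exists_cubic_splitting`), and `σ` can be
normalized to `1` at `eᵢ` and at `eᵢ + eⱼ`. Since slopes and `g` degenerate when a sum of points
vanishes, the cocycles are split on the positive cone of a group order of `ℤⁿ`, where no sum
vanishes, and `ζ` and `σ` are then extended to odd functions (`exists_isSigma`). The recurrence
follows from a formula for `σ(p + q + s) σ(p - q) σ(s)` (`IsSigma.isElliptic`), and along multiples
of `eᵢ` the recurrence forces the division polynomials (`IsElliptic.eq_normEDS`). Hence net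
polynomials exist (`exists_isNetPoly`).

*Valuations.* For a prime `𝔭`, consider `h(v) = max(1, |x(v · P)|) |Ψ_v|²` (`netHeight`). The
symmetric functions of `x(P + Q)` and `x(P - Q)` are quotients of biquadratic forms in `x(P)` and
`x(Q)`. If `P` has non-singular reduction, these forms have no common zero modulo `𝔭`, and the Gauss
lemma gives `h(w + u) h(w - u) = h(w)² h(u)²` when `u · P` has non-singular reduction. Conversely
the duplication law `h(2u) = h(u)⁴` holds only if `u · P` has non-singular reduction
(`IntegralAt.locHeight_double_iff`). So the set of those `u` for which the parallelogram law holds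
for all `w` is a subgroup (`parallelogram_of_basis`); it contains all `eᵢ`, hence is everything.
This takes the place of the fact that the points of non-singular reduction form a group. It follows
that `log h` is a quadratic form, determined by its values at `eᵢ` and `eᵢ + eⱼ`
(`eq_sum_of_parallelogram`). At these elements `Ψ = 1`, and `log max(1, |x(P)|)` is twice the
exponent of `𝔭` in `D_P` (`count_den`), so the coefficients of the form are twice the exponents of
the ideals `A_{ij}` (`count_den_comb`).

The remaining claims are formal: `∏ c_{ij} ^ (v_i v_j)` is a quadratic form
(`isQuadForm_prodForm`), and multiplication by a quadratic form preserves the recurrence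
(`IsElliptic.quadForm_mul`).
-/

namespace EllNet

/-! ### Symmetric cocycles on a positive cone -/

/-- The set of positive elements for some total group order. -/
structure IsPosCone {A : Type*} [AddCommGroup A] (pos : A → Prop) : Prop where
  add : ∀ {a b}, pos a → pos b → pos (a + b)
  not_zero : ¬ pos 0
  total : ∀ a, a = 0 ∨ pos a ∨ pos (-a)

/-- The extension of the commutative monoid `S` by the abelian group `M` attached to a
normalized symmetric `2`-cocycle `f`: the set `M × S` with
`(m, a) + (m', b) = (m + m' + f(a, b), a + b)`. -/
@[ext]
structure Twisted {M S : Type*} (f : S → S → M) where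
  /-- The component in the group `M`. -/
  fst : M
  /-- The component in the monoid `S`. -/
  snd : S

/-- The commutative monoid structure on `Twisted f`. -/
abbrev Twisted.addCommMonoid {M S : Type*} [AddCommGroup M] [AddCommMonoid S] {f : S → S → M}
    (hsymm : ∀ a b, f a b = f b a) (hzero : ∀ a, f 0 a = 0)
    (hcoc : ∀ a b c, f a b + f (a + b) c = f b c + f a (b + c)) : AddCommMonoid (Twisted f) where
  add p q := ⟨p.fst + q.fst + f p.snd q.snd, p.snd + q.snd⟩
  zero := ⟨0, 0⟩
  nsmul := @nsmulRec _ ⟨⟨0, 0⟩⟩ ⟨fun p q ↦ ⟨p.fst + q.fst + f p.snd q.snd, p.snd + q.snd⟩⟩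
  add_assoc p q r := by
    refine Twisted.ext ?_ (add_assoc _ _ _)
    change p.fst + q.fst + f p.snd q.snd + r.fst + f (p.snd + q.snd) r.snd =
      p.fst + (q.fst + r.fst + f q.snd r.snd) + f p.snd (q.snd + r.snd)
    have h := hcoc p.snd q.snd r.snd
    grind
  zero_add p := by
    refine Twisted.ext ?_ (zero_add _)
    change 0 + p.fst + f 0 p.snd = p.fst
    rw [hzero, zero_add, add_zero]
  add_zero p := by
    refine Twisted.ext ?_ (add_zero _)
    change p.fst + 0 + f p.snd 0 = p.fst
    rw [hsymm, hzero, add_zero, add_zero]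
  add_comm p q := by
    refine Twisted.ext ?_ (add_comm _ _)
    change p.fst + q.fst + f p.snd q.snd = q.fst + p.fst + f q.snd p.snd
    rw [hsymm, add_comm p.fst]

/-- A symmetric cocycle on a submonoid of `ℤⁿ` containing the standard basis is a coboundary. The
splitting is constructed on `ℕⁿ` by the universal property of a free commutative monoid, and
carried over to `v` through `v + v⁻ = v⁺`. -/
theorem exists_splitting_submonoid {M : Type*} [AddCommGroup M] {n : ℕ}
    (S : AddSubmonoid (Fin n → ℤ)) (hS : ∀ i, Pi.single i 1 ∈ S) (f : S → S → M)
    (hsymm : ∀ a b, f a b = f b a) (hzero : ∀ a, f 0 a = 0)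
    (hcoc : ∀ a b c, f a b + f (a + b) c = f b c + f a (b + c)) (c : Fin n → M) :
    ∃ φ : S → M, (∀ i, φ ⟨Pi.single i 1, hS i⟩ = c i) ∧
      ∀ a b, φ (a + b) = φ a + φ b + f a b := by
  let _ : AddCommMonoid (Twisted f) := Twisted.addCommMonoid hsymm hzero hcoc
  have add_fst (p q : Twisted f) : (p + q).fst = p.fst + q.fst + f p.snd q.snd := rfl
  have add_snd (p q : Twisted f) : (p + q).snd = p.snd + q.snd := rfl
  have zero_snd : (0 : Twisted f).snd = 0 := rfl
  have cancel {p q r : Twisted f} (h : p + r = q + r) : p = q := by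
    have h2 : p.snd = q.snd := by
      have := congrArg Twisted.snd h
      rwa [add_snd, add_snd, add_left_inj] at this
    refine Twisted.ext ?_ h2
    have := congrArg Twisted.fst h
    rwa [add_fst, add_fst, h2, add_left_inj, add_left_inj] at this
  let E : Fin n → Twisted f := fun i ↦ ⟨c i, ⟨Pi.single i 1, hS i⟩⟩
  let s : (Fin n → ℕ) → Twisted f := fun v ↦ ∑ i, v i • E i
  have s_add (v w : Fin n → ℕ) : s (v + w) = s v + s w := by
    simp [s, add_smul, Finset.sum_add_distrib]
  let π : Twisted f →+ S := { toFun := Twisted.snd, map_zero' := zero_snd, map_add' := add_snd }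
  have snd_s (v : Fin n → ℕ) : ((s v).snd : Fin n → ℤ) = fun i ↦ (v i : ℤ) := by
    change (π (s v) : Fin n → ℤ) = _
    simp only [s, map_sum, map_nsmul, AddSubmonoid.coe_finsetSum, AddSubmonoidClass.coe_nsmul]
    change ∑ i, v i • (Pi.single i 1 : Fin n → ℤ) = _
    ext j
    simp [Finset.sum_apply, Pi.single_apply]
  let vp : S → Fin n → ℕ := fun v i ↦ (v.1 i).toNat
  let vm : S → Fin n → ℕ := fun v i ↦ (-v.1 i).toNat
  have hex (v : S) : ∃ x : Twisted f, x.snd = v ∧ x + s (vm v) = s (vp v) := by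
    refine ⟨⟨(s (vp v)).fst - ((s (vm v)).fst + f v (s (vm v)).snd), v⟩, rfl, ?_⟩
    refine Twisted.ext ?_ ?_
    · rw [add_fst, add_assoc, sub_add_cancel]
    · rw [add_snd]
      apply Subtype.ext
      rw [AddSubmonoid.coe_add, snd_s, snd_s]
      ext i
      simp only [Pi.add_apply, vm, vp]
      omega
  choose σ hσ1 hσ2 using hex
  refine ⟨fun v ↦ (σ v).fst, fun i ↦ ?_, fun a b ↦ ?_⟩
  · have h : σ ⟨Pi.single i 1, hS i⟩ = E i := by
      have h1 := hσ2 ⟨Pi.single i 1, hS i⟩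
      have h2 : vm ⟨Pi.single i 1, hS i⟩ = 0 := by
        ext j
        by_cases hj : j = i <;> simp [vm, hj]
      have h3 : vp ⟨Pi.single i 1, hS i⟩ = Pi.single i 1 := by
        ext j
        by_cases hj : j = i <;> simp [vp, hj]
      have h4 : s 0 = 0 := by simp [s]
      have h5 : s (Pi.single i 1) = E i := by
        simp only [s]
        rw [Finset.sum_eq_single i] <;> simp +contextual
      rwa [h2, h3, h4, h5, add_zero] at h1
    change (σ _).fst = c i
    rw [h]
  · have h : σ (a + b) = σ a + σ b := by
      apply cancel (r := s (vm (a + b) + vm a + vm b))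
      have h1 : vp (a + b) + vm a + vm b = vp a + vp b + vm (a + b) := by
        ext i
        simp only [Pi.add_apply, vm, vp, AddSubmonoid.coe_add]
        omega
      calc σ (a + b) + s (vm (a + b) + vm a + vm b)
          = (σ (a + b) + s (vm (a + b))) + s (vm a) + s (vm b) := by
            rw [s_add, s_add]; simp only [add_assoc]
        _ = s (vp (a + b) + vm a + vm b) := by rw [hσ2, s_add, s_add]
        _ = (σ a + s (vm a)) + (σ b + s (vm b)) + s (vm (a + b)) := by
            rw [h1, s_add, s_add, hσ2, hσ2]
        _ = _ := by rw [s_add, s_add]; abel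
    change (σ (a + b)).fst = _
    rw [h, add_fst, hσ1, hσ1]

variable {n : ℕ} {pos : (Fin n → ℤ) → Prop}

/-- The submonoid of nonnegative elements. -/
def IsPosCone.nonneg {A : Type*} [AddCommGroup A] {pos : A → Prop} (hpos : IsPosCone pos) :
    AddSubmonoid A where
  carrier := {a | a = 0 ∨ pos a}
  zero_mem' := Or.inl rfl
  add_mem' := by
    rintro a b (rfl | ha) (rfl | hb)
    · exact Or.inl (add_zero _)
    · exact Or.inr (by rwa [zero_add])
    · exact Or.inr (by rwa [add_zero])
    · exact Or.inr (hpos.add ha hb)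

/-- A symmetric cocycle on a positive cone of `ℤⁿ` is a coboundary, with prescribed values of the
splitting on the standard basis. -/
theorem exists_splitting {M : Type*} [AddCommGroup M] (hpos : IsPosCone pos)
    (hb : ∀ i, pos (Pi.single i 1)) (f : (Fin n → ℤ) → (Fin n → ℤ) → M)
    (hsymm : ∀ a b, pos a → pos b → f a b = f b a)
    (hcoc : ∀ a b c, pos a → pos b → pos c → f a b + f (a + b) c = f b c + f a (b + c))
    (c : Fin n → M) :
    ∃ φ : (Fin n → ℤ) → M, (∀ i, φ (Pi.single i 1) = c i) ∧
      ∀ a b, pos a → pos b → φ (a + b) = φ a + φ b + f a b := by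
  classical
  let S := hpos.nonneg
  let F : S → S → M := fun a b ↦ if pos a.1 ∧ pos b.1 then f a b else 0
  have hS (a : S) : a = 0 ∨ pos a.1 := a.2.imp (fun h ↦ Subtype.ext h) id
  have F0 (a : S) : F 0 a = 0 := by simp [F, hpos.not_zero]
  have Fs (a b : S) : F a b = F b a := by
    by_cases h : pos a.1 ∧ pos b.1
    · simp [F, h, hsymm a b h.1 h.2]
    · simp only [F, if_neg h, if_neg fun h' ↦ h (And.comm.1 h')]
  have Fp {a b : S} (ha : pos a.1) (hb : pos b.1) : F a b = f a b := if_pos ⟨ha, hb⟩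
  obtain ⟨φ, h1, h2⟩ := exists_splitting_submonoid S (fun i ↦ Or.inr (hb i)) F Fs F0 (by
    intro a b c
    rcases hS a with rfl | ha
    · rw [F0, F0, zero_add, zero_add, add_zero]
    rcases hS b with rfl | hb
    · rw [Fs a 0, F0, F0, zero_add, add_zero, zero_add, zero_add]
    rcases hS c with rfl | hc
    · rw [Fs _ 0, Fs _ 0, F0, F0, add_zero, zero_add, add_zero]
    rw [Fp ha hb, Fp hb hc, Fp (a := a + b) (hpos.add ha hb) hc,
      Fp (b := b + c) ha (hpos.add hb hc)]
    exact hcoc a b c ha hb hc) c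
  refine ⟨fun v ↦ if h : v ∈ S then φ ⟨v, h⟩ else 0, fun i ↦ ?_, fun a b ha hb ↦ ?_⟩
  · exact (dif_pos (show Pi.single i 1 ∈ S from Or.inr (hb i))).trans (h1 i)
  · have ha' : a ∈ S := Or.inr ha
    have hb' : b ∈ S := Or.inr hb
    simp only [dif_pos ha', dif_pos hb', dif_pos (S.add_mem ha' hb')]
    rw [← Fp (a := ⟨a, ha'⟩) (b := ⟨b, hb'⟩) ha hb, ← h2]
    rfl

/-- A homomorphism on a positive cone of `ℤⁿ` is determined by its values on the standard
basis. -/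
theorem eq_zero_of_add_of_basis {M : Type*} [AddCommGroup M] (hpos : IsPosCone pos)
    (hb : ∀ i, pos (Pi.single i 1)) (χ : (Fin n → ℤ) → M)
    (hadd : ∀ a b, pos a → pos b → χ (a + b) = χ a + χ b)
    (hχ : ∀ i, χ (Pi.single i 1) = 0) {v : Fin n → ℤ} (hv : pos v) : χ v = 0 := by
  classical
  have hS {a : Fin n → ℤ} (ha : a ∈ hpos.nonneg) : a = 0 ∨ pos a := ha
  let χ' : hpos.nonneg →+ M :=
    { toFun := fun a ↦ if pos a.1 then χ a else 0
      map_zero' := if_neg hpos.not_zero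
      map_add' := by
        intro a b
        have h0 := hpos.not_zero
        change (if pos (a.1 + b.1) then χ (a.1 + b.1) else 0) =
          (if pos a.1 then χ a.1 else 0) + (if pos b.1 then χ b.1 else 0)
        rcases hS a.2 with ha | ha <;> rcases hS b.2 with hb | hb
        · simp [ha, hb, h0]
        · simp [ha, hb, h0]
        · simp [ha, hb, h0]
        · simp [ha, hb, hpos.add ha hb, hadd] }
  let E : Fin n → hpos.nonneg := fun i ↦ ⟨Pi.single i 1, Or.inr (hb i)⟩
  have key (w : Fin n → ℕ) : χ' (∑ i, w i • E i) = 0 := by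
    rw [map_sum]
    refine Finset.sum_eq_zero fun i _ ↦ ?_
    rw [map_nsmul]
    change w i • (if pos (Pi.single i 1) then χ (Pi.single i 1) else 0) = 0
    rw [if_pos (hb i), hχ, smul_zero]
  have h1 : (⟨v, Or.inr hv⟩ : hpos.nonneg) + ∑ i, (-v i).toNat • E i =
      ∑ i, (v i).toNat • E i := by
    apply Subtype.ext
    simp only [E, AddSubmonoid.coe_add, AddSubmonoid.coe_finsetSum, AddSubmonoidClass.coe_nsmul]
    ext j
    simp [Finset.sum_apply, Pi.single_apply]
    omega
  have h2 := congrArg χ' h1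
  rw [map_add, key, key, add_zero] at h2
  change (if pos v then χ v else 0) = 0 at h2
  rwa [if_pos hv] at h2

/-- A function `h` of three variables that is symmetric, and a cocycle in two of them, is on a
positive cone of `ℤⁿ` the third difference of a function `W`; the values of `W` at the basis
vectors (here `0`) and at their pairwise sums can be prescribed. -/
theorem exists_cubic_splitting {M : Type*} [AddCommGroup M] (hpos : IsPosCone pos)
    (hb : ∀ i, pos (Pi.single i 1)) (h : (Fin n → ℤ) → (Fin n → ℤ) → (Fin n → ℤ) → M)
    (hs1 : ∀ a b c, h a b c = h b a c) (hs2 : ∀ a b c, h a b c = h a c b)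
    (hcoc : ∀ a b c d, pos a → pos b → pos c → pos d →
      h a b d + h (a + b) c d = h b c d + h a (b + c) d)
    (c : Fin n → Fin n → M) (hc : ∀ i j, c i j = c j i) :
    ∃ W : (Fin n → ℤ) → M, (∀ i, W (Pi.single i 1) = 0) ∧
      (∀ i j, W (Pi.single i 1 + Pi.single j 1) = c i j) ∧
      ∀ a b d, pos a → pos b → pos d →
        W (a + b + d) + W a + W b + W d = h a b d + W (a + b) + W (b + d) + W (a + d) := by
  classical
  choose β hβ1 hβ2 using fun i ↦ exists_splitting hpos hb (fun a b ↦ h a b (Pi.single i 1))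
    (fun a b _ _ ↦ hs1 a b _) (fun a b d ha hb' hd ↦ hcoc a b d _ ha hb' hd (hb i)) (c i)
  obtain ⟨B, hB1, hB2⟩ := exists_splitting (M := (Fin n → ℤ) → M) hpos hb
    (fun a b d ↦ if pos d then h a b d else 0) (fun a b _ _ ↦ by simp only [hs1 a b])
    (fun a b d ha hb hd ↦ by
      funext e
      by_cases he : pos e
      · simpa [he] using hcoc a b d e ha hb hd he
      · simp [he]) β
  have hB {a b d} (ha : pos a) (hb : pos b) (hd : pos d) :
      B (a + b) d = B a d + B b d + h a b d := by
    rw [hB2 a b ha hb]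
    simp [hd]
  -- additivity defect of `B d` in the second variable
  have hB' {a b d} (ha : pos a) (hb' : pos b) (hd : pos d) :
      B d (a + b) = B d a + B d b + h a b d := by
    refine sub_eq_zero.1 (eq_zero_of_add_of_basis hpos hb
      (fun d ↦ B d (a + b) - (B d a + B d b + h a b d)) (fun d e hd he ↦ ?_) (fun i ↦ ?_) hd)
    · have h1 := hcoc a b d e ha hb' hd he
      have h2 := hcoc b d e a hb' hd he ha
      have h3 := hB hd he (hpos.add ha hb')
      have h4 := hB hd he ha
      have h5 := hB hd he hb'
      have e1 : h b d a = h a b d := by rw [hs2, hs1]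
      have e2 : h (b + d) e a = h a (b + d) e := by rw [hs2, hs1]
      have e3 : h b (d + e) a = h a b (d + e) := by rw [hs2, hs1]
      have e4 : h (a + b) d e = h d e (a + b) := by rw [hs1, hs2]
      have e5 : h b d e = h d e b := by rw [hs1, hs2]
      rw [e1, e2, e3] at h2
      rw [e4, e5] at h1
      grind
    · rw [hB1, hβ2 i a b ha hb', sub_self]
  have hBe (i : Fin n) {b} (hb' : pos b) : B (Pi.single i 1) b = B b (Pi.single i 1) := by
    refine sub_eq_zero.1 (eq_zero_of_add_of_basis hpos hb
      (fun b ↦ B (Pi.single i 1) b - B b (Pi.single i 1)) (fun d e hd he ↦ ?_) (fun j ↦ ?_) hb')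
    · rw [hB hd he (hb i), hB' hd he (hb i)]
      abel
    · rw [hB1, hB1, hβ1, hβ1, hc, sub_self]
  have hBs {a b} (ha : pos a) (hb' : pos b) : B a b = B b a := by
    refine sub_eq_zero.1 (eq_zero_of_add_of_basis hpos hb
      (fun a ↦ B a b - B b a) (fun d e hd he ↦ ?_) (fun j ↦ ?_) ha)
    · rw [hB hd he hb', hB' hd he hb']
      abel
    · rw [hBe j hb', sub_self]
  obtain ⟨W, hW1, hW2⟩ := exists_splitting hpos hb B (fun a b ha hb ↦ hBs ha hb)
    (fun a b d ha hb' hd ↦ by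
      rw [hB ha hb' hd, hB' hb' hd ha, hs1 b d a, hs2 d b a, hs1 d a b, hs2 a d b]
      abel) 0
  refine ⟨W, hW1, fun i j ↦ ?_, fun a b d ha hb' hd ↦ ?_⟩
  · rw [hW2 _ _ (hb i) (hb j), hW1, hW1, hB1, hβ1]
    simp
  · rw [hW2 (a + b) d (hpos.add ha hb') hd, hB ha hb' hd, hW2 b d hb' hd, hW2 a d ha hd]
    abel

/-- The lexicographic order makes `ℤⁿ` a totally ordered group with positive basis vectors. -/
theorem exists_isPosCone (n : ℕ) :
    ∃ pos : (Fin n → ℤ) → Prop, IsPosCone pos ∧ ∀ i, pos (Pi.single i 1) := by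
  refine ⟨fun v ↦ 0 < toLex v, ⟨fun ha hb ↦ add_pos ha hb, lt_irrefl _, fun a ↦ ?_⟩, fun i ↦ ?_⟩
  · rcases lt_trichotomy (toLex a) 0 with h | h | h
    · exact Or.inr (Or.inr (neg_pos.2 h : 0 < -toLex a))
    · exact Or.inl h
    · exact Or.inr (Or.inl h)
  · refine ⟨i, fun j hj ↦ ?_, ?_⟩
    · change (0 : ℤ) = (Pi.single i 1 : Fin n → ℤ) j
      rw [Pi.single_eq_of_ne (ne_of_lt hj)]
    · change (0 : ℤ) < (Pi.single i 1 : Fin n → ℤ) i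
      simp

/-! ### Zeta systems and the addition formulas -/

/-- A group `A` of points on `Y² = X³ + αX + β` together with a function `ζ` playing the part of
the Weierstrass zeta function: the slope of the line through `a` and `b` is
`ζ(a + b) - ζ(a) - ζ(b)`. The values at `0` carry no information. -/
structure ZetaSystem (A K : Type*) [AddCommGroup A] [Field K] where
  /-- The `x`-coordinate. -/
  X : A → K
  /-- The `y`-coordinate. -/
  Y : A → K
  /-- The zeta function. -/
  ζ : A → K
  /-- The linear coefficient of the cubic. -/
  α : K
  /-- The constant coefficient of the cubic. -/
  β : K
  curve : ∀ {a}, a ≠ 0 → Y a ^ 2 = X a ^ 3 + α * X a + β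
  X_neg : ∀ a, X (-a) = X a
  Y_neg : ∀ {a}, a ≠ 0 → Y (-a) = -Y a
  ζ_neg : ∀ a, ζ (-a) = -ζ a
  X_inj : ∀ {a b}, a ≠ 0 → b ≠ 0 → X a = X b → a = b ∨ a = -b
  Y_ne : ∀ {a}, a ≠ 0 → Y a ≠ 0
  slope_sq : ∀ {a b}, a ≠ 0 → b ≠ 0 → a + b ≠ 0 →
    (ζ (a + b) - ζ a - ζ b) ^ 2 = X a + X b + X (a + b)
  slope_mul : ∀ {a b}, a ≠ 0 → b ≠ 0 → a + b ≠ 0 →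
    Y b - Y a = (ζ (a + b) - ζ a - ζ b) * (X b - X a)
  slope_self : ∀ {a}, a ≠ 0 → (ζ (a + a) - ζ a - ζ a) * (2 * Y a) = 3 * X a ^ 2 + α

namespace ZetaSystem

variable {A K : Type*} [AddCommGroup A] [Field K] (Z : ZetaSystem A K)

/-- The function `ζ(a + b + c) - ζ(a) - ζ(b) - ζ(c)`, which for the Weierstrass functions is
`σ(a + b) σ(b + c) σ(a + c) / (σ(a) σ(b) σ(c) σ(a + b + c))`. -/
def g (a b c : A) : K := Z.ζ (a + b + c) - Z.ζ a - Z.ζ b - Z.ζ c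

lemma g_comm₁₂ (a b c : A) : Z.g a b c = Z.g b a c := by
  simp only [g, add_comm a b]
  ring

lemma g_comm₂₃ (a b c : A) : Z.g a b c = Z.g a c b := by
  simp only [g, add_right_comm a b c]
  ring

variable {Z} {a b c d : A}

/-- With `g` written through `σ`, this is the formula for `σ(b + c) σ(b - c)`. Both factors on the
left are combinations of slopes, and the squares of slopes are known by `slope_sq`. -/
lemma g_mul_slope_sub [CharZero K] (ha : a ≠ 0) (hb : b ≠ 0) (hc : c ≠ 0) (hab : a + b ≠ 0)
    (hac : a + c ≠ 0) (habc : a + b + c ≠ 0) :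
    Z.g a b c * ((Z.ζ (a + b) - Z.ζ a - Z.ζ b) - (Z.ζ (a + c) - Z.ζ a - Z.ζ c)) =
      Z.X b - Z.X c := by
  have e : a + c + b = a + b + c := add_right_comm a c b
  have h1 := Z.slope_sq ha hb hab
  have h2 := Z.slope_sq hab hc habc
  have h3 := Z.slope_sq ha hc hac
  have h4 := Z.slope_sq hac hb (by rwa [e])
  rw [e] at h4
  have h20 : (2 : K) ≠ 0 := two_ne_zero
  apply mul_left_cancel₀ h20
  rw [g]
  linear_combination h1 - h2 - h3 + h4

/-- The product is symmetric in `a`, `b`, `c`, which makes `g` a cocycle. -/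
lemma two_mul_g_mul_g (ha : a ≠ 0) (hb : b ≠ 0) (hc : c ≠ 0) (hd : d ≠ 0) (hab : a + b ≠ 0)
    (habd : a + b + d ≠ 0) (habcd : a + b + c + d ≠ 0) :
    2 * (Z.g a b d * Z.g (a + b) c d) =
      (Z.ζ (a + b + c + d) - Z.ζ a - Z.ζ b - Z.ζ c - Z.ζ d) ^ 2
        - (Z.X a + Z.X b + Z.X c + Z.X (a + b + c + d)) + Z.X d := by
  have e : a + b + d + c = a + b + c + d := add_right_comm _ _ _
  have h1 := Z.slope_sq habd hc (by rwa [e])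
  have h2 := Z.slope_sq ha hb hab
  have h3 := Z.slope_sq hab hd habd
  rw [e] at h1
  simp only [g]
  linear_combination -h1 - h2 + h3

/-- With `g` written through `σ`, this combines the formulas for `σ(2a)` and `σ(2a + c) σ(c)`. -/
lemma g_self_mul (ha : a ≠ 0) (hc : c ≠ 0) (hac : a + c ≠ 0) (haac : a + a + c ≠ 0) :
    Z.g a a c * (Z.X (a + c) - Z.X a) = -(2 * Z.Y a) := by
  have e : a + (a + c) = a + a + c := (add_assoc _ _ _).symm
  have e' : a + -(a + c) = -c := by abel
  have h1 := Z.slope_mul ha hac (by rwa [e])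
  have h2 := Z.slope_mul ha (neg_ne_zero.2 hac) (by rw [e']; exact neg_ne_zero.2 hc)
  rw [e', Z.X_neg, Z.Y_neg hac, Z.ζ_neg, Z.ζ_neg] at h2
  rw [e] at h1
  rw [g]
  linear_combination -h1 - h2

/-- With `g` written through `σ`, this combines the formulas for `σ(2a + 2b)`,
`σ(2a + b) σ(b)` and `σ(a + 2b) σ(a)`. -/
lemma two_mul_Y_mul_g [CharZero K] (ha : a ≠ 0) (hb : b ≠ 0) (hab : a + b ≠ 0)
    (haab : a + a + b ≠ 0) :
    2 * Z.Y (a + b) * Z.g a b (a + b) = (Z.X (a + b) - Z.X a) * (Z.X (a + b) - Z.X b) := by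
  have e' : a + -(a + b) = -b := by abel
  have hX : Z.X a - Z.X (a + b) ≠ 0 := by
    intro h
    rcases Z.X_inj ha hab (sub_eq_zero.1 h) with h | h
    · exact hb (by simpa using h)
    · exact haab (by rw [add_assoc]; exact eq_neg_iff_add_eq_zero.1 h)
  have h1 := Z.slope_self hab
  have h2 := Z.slope_sq ha hb hab
  have h3 := Z.slope_mul ha (neg_ne_zero.2 hab) (by rw [e']; exact neg_ne_zero.2 hb)
  rw [e', Z.X_neg, Z.Y_neg hab, Z.ζ_neg, Z.ζ_neg] at h3
  have h4 := Z.curve ha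
  have h5 := Z.curve hab
  -- the cubic, restricted to the line and divided by `X - X (a + b)`
  have h6 : (Z.ζ (a + b) - Z.ζ a - Z.ζ b) ^ 2 * (Z.X a - Z.X (a + b)) -
      2 * (Z.ζ (a + b) - Z.ζ a - Z.ζ b) * Z.Y (a + b) =
      Z.X a ^ 2 + Z.X a * Z.X (a + b) + Z.X (a + b) ^ 2 + Z.α := by
    apply mul_left_cancel₀ hX
    have h7 : Z.Y a = (Z.ζ (a + b) - Z.ζ a - Z.ζ b) * (Z.X a - Z.X (a + b)) - Z.Y (a + b) := by
      linear_combination -h3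
    rw [h7] at h4
    linear_combination h4 - h5
  rw [g]
  linear_combination h1 - h6 + (Z.X a - Z.X (a + b)) * h2

end ZetaSystem

/-! ### The sigma function on positive elements -/

lemma IsPosCone.ne_zero {A : Type*} [AddCommGroup A] {pos : A → Prop} (hpos : IsPosCone pos)
    {a : A} (ha : pos a) : a ≠ 0 := by
  rintro rfl
  exact hpos.not_zero ha

namespace ZetaSystem

variable {K : Type*} [Field K] [CharZero K]

/-- On the positive cone `g` does not vanish, since no sum of its arguments is zero. -/
lemma g_ne_zero {A : Type*} [AddCommGroup A] {Z : ZetaSystem A K} {pos : A → Prop}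
    (hpos : IsPosCone pos) {a b c : A} (ha : pos a) (hb : pos b) (hc : pos c) :
    Z.g a b c ≠ 0 := by
  -- reduction to two distinct arguments, where `g` divides `X b - X c`
  have key {a b c : A} (ha : pos a) (hb : pos b) (hc : pos c) (hbc : b ≠ c) : Z.g a b c ≠ 0 := by
    intro h
    have h1 := g_mul_slope_sub (Z := Z) (hpos.ne_zero ha) (hpos.ne_zero hb) (hpos.ne_zero hc)
      (hpos.ne_zero (hpos.add ha hb)) (hpos.ne_zero (hpos.add ha hc))
      (hpos.ne_zero (hpos.add (hpos.add ha hb) hc))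
    rw [h, zero_mul] at h1
    rcases Z.X_inj (hpos.ne_zero hb) (hpos.ne_zero hc) (sub_eq_zero.1 h1.symm) with h2 | h2
    · exact hbc h2
    · exact hpos.ne_zero (hpos.add hb hc) (eq_neg_iff_add_eq_zero.1 h2)
  by_cases hbc : b = c
  · by_cases hab : a = b
    · subst hab hbc
      intro h
      have h1 := g_self_mul (Z := Z) (hpos.ne_zero ha) (hpos.ne_zero ha)
        (hpos.ne_zero (hpos.add ha ha)) (hpos.ne_zero (hpos.add (hpos.add ha ha) ha))
      rw [h, zero_mul] at h1
      exact Z.Y_ne (hpos.ne_zero ha) (by simpa using h1)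
    · rw [g_comm₁₂, g_comm₂₃]
      exact key hb hc ha (fun h ↦ hab (by rw [hbc, h]))
  · exact key ha hb hc hbc

variable {n : ℕ} (Z : ZetaSystem (Fin n → ℤ) K) {pos : (Fin n → ℤ) → Prop}

/-- A function `W` on the positive elements of `ℤⁿ` whose third difference is `1 / g`, as for the
Weierstrass sigma function. The values at `eᵢ` and `eᵢ + eⱼ` are free. -/
theorem exists_pos_sigma (hpos : IsPosCone pos) (hb : ∀ i, pos (Pi.single i 1)) :
    ∃ W : (Fin n → ℤ) → K, (∀ a, W a ≠ 0) ∧ (∀ i, W (Pi.single i 1) = 1) ∧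
      (∀ i j, i ≠ j → W (Pi.single i 1 + Pi.single j 1) = 1) ∧
      (∀ i, W (Pi.single i 1 + Pi.single i 1) = 2 * Z.Y (Pi.single i 1)) ∧
      ∀ a b d, pos a → pos b → pos d →
        Z.g a b d * (W (a + b + d) * W a * W b * W d) = W (a + b) * W (b + d) * W (a + d) := by
  classical
  let G : (Fin n → ℤ) → (Fin n → ℤ) → (Fin n → ℤ) → Kˣ :=
    fun a b d ↦ if h : Z.g a b d ≠ 0 then Units.mk0 _ h else 1
  have hG {a b d} (ha : pos a) (hb : pos b) (hd : pos d) : (G a b d : K) = Z.g a b d := by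
    simp [G, g_ne_zero hpos ha hb hd]
  have hY (i : Fin n) : 2 * Z.Y (Pi.single i 1) ≠ 0 :=
    mul_ne_zero two_ne_zero (Z.Y_ne (hpos.ne_zero (hb i)))
  obtain ⟨W, h1, h2, h3⟩ := exists_cubic_splitting (M := Additive Kˣ) hpos hb
    (fun a b d ↦ Additive.ofMul (G a b d)⁻¹) (fun a b d ↦ by simp only [G, Z.g_comm₁₂ a b d])
    (fun a b d ↦ by simp only [G, Z.g_comm₂₃ a b d]) (fun a b c d ha hb hc hd ↦ by
      apply Additive.toMul.injective
      change (G a b d)⁻¹ * (G (a + b) c d)⁻¹ = (G b c d)⁻¹ * (G a (b + c) d)⁻¹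
      rw [← mul_inv, ← mul_inv, inv_inj]
      apply Units.ext
      rw [Units.val_mul, Units.val_mul, hG ha hb hd, hG (hpos.add ha hb) hc hd, hG hb hc hd,
        hG ha (hpos.add hb hc) hd, Z.g_comm₁₂ a (b + c) d]
      have e : b + c + a + d = a + b + c + d := by abel
      have n0 {a} (ha : pos a) : a ≠ 0 := hpos.ne_zero ha
      have add {a b} (ha : pos a) (hb : pos b) : pos (a + b) := hpos.add ha hb
      have k1 := two_mul_g_mul_g (Z := Z) (n0 ha) (n0 hb) (n0 hc) (n0 hd) (n0 (add ha hb))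
        (n0 (add (add ha hb) hd)) (n0 (add (add (add ha hb) hc) hd))
      have k2 := two_mul_g_mul_g (Z := Z) (n0 hb) (n0 hc) (n0 ha) (n0 hd) (n0 (add hb hc))
        (n0 (add (add hb hc) hd)) (n0 (add (add (add hb hc) ha) hd))
      rw [e] at k2
      apply mul_left_cancel₀ (two_ne_zero (α := K))
      rw [k1, k2]
      ring)
    (fun i j ↦ if i = j then Additive.ofMul (Units.mk0 _ (hY i)) else 0)
    (fun i j ↦ by
      by_cases h : i = j
      · subst h; rfl
      · simp [h, Ne.symm h])
  refine ⟨fun a ↦ ((W a).toMul : Kˣ), fun a ↦ Units.ne_zero _, fun i ↦ ?_, fun i j hij ↦ ?_,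
    fun i ↦ ?_, fun a b d ha hb hd ↦ ?_⟩
  · simp [h1]
  · simp [h2, hij]
  · simp [h2]
  · have h4 := congrArg (fun m ↦ ((Additive.toMul m : Kˣ) : K)) (h3 a b d ha hb hd)
    simp only [toMul_add, toMul_ofMul, Units.val_mul, Units.val_inv_eq_inv_val, hG ha hb hd] at h4
    rw [h4]
    have := g_ne_zero (Z := Z) hpos ha hb hd
    field_simp

/-- The normalization at the basis vectors propagates: the quotient
`W(2a) / (2 Y(a) W(a)⁴)` is multiplicative in `a`. -/
theorem pos_sigma_double (hpos : IsPosCone pos) (hb : ∀ i, pos (Pi.single i 1))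
    {W : (Fin n → ℤ) → K} (hW0 : ∀ a, W a ≠ 0) (hW1 : ∀ i, W (Pi.single i 1) = 1)
    (hW2 : ∀ i, W (Pi.single i 1 + Pi.single i 1) = 2 * Z.Y (Pi.single i 1))
    (hW : ∀ a b d, pos a → pos b → pos d →
      Z.g a b d * (W (a + b + d) * W a * W b * W d) = W (a + b) * W (b + d) * W (a + d))
    {a : Fin n → ℤ} (ha : pos a) : W (a + a) = 2 * Z.Y a * W a ^ 4 := by
  classical
  let Y' : (Fin n → ℤ) → Kˣ := fun a ↦ if h : Z.Y a ≠ 0 then Units.mk0 _ h else 1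
  have hY' {a} (ha : pos a) : (Y' a : K) = Z.Y a := by simp [Y', Z.Y_ne (hpos.ne_zero ha)]
  let W' : (Fin n → ℤ) → Kˣ := fun a ↦ Units.mk0 _ (hW0 a)
  let t : Kˣ := Units.mk0 2 two_ne_zero
  let θ : (Fin n → ℤ) → Additive Kˣ := fun a ↦
    Additive.ofMul (W' (a + a) * (t * Y' a * W' a ^ 4)⁻¹)
  have h := eq_zero_of_add_of_basis hpos hb θ (fun a b ha hb ↦ ?_) (fun i ↦ ?_) ha
  · have h1 : W' (a + a) = t * Y' a * W' a ^ 4 := mul_inv_eq_one.1 h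
    have h2 := congrArg Units.val h1
    simpa [W', t, hY' ha] using h2
  · apply Additive.toMul.injective
    apply Units.ext
    change W (a + b + (a + b)) * (↑((t * Y' (a + b) * W' (a + b) ^ 4)⁻¹) : K) =
      (W (a + a) * (↑((t * Y' a * W' a ^ 4)⁻¹) : K)) *
      (W (b + b) * (↑((t * Y' b * W' b ^ 4)⁻¹) : K))
    simp only [Units.val_inv_eq_inv_val, Units.val_mul, Units.val_pow_eq_pow_val, hY' ha, hY' hb,
      hY' (hpos.add ha hb), W', t, Units.val_mk0]
    have n0 {a} (ha : pos a) : a ≠ 0 := hpos.ne_zero ha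
    have add {a b} (ha : pos a) (hb : pos b) : pos (a + b) := hpos.add ha hb
    have y1 := Z.Y_ne (n0 ha)
    have y2 := Z.Y_ne (n0 hb)
    have y3 := Z.Y_ne (n0 (add ha hb))
    have e1 : a + b + b = b + b + a := by abel
    have e2 : b + a = a + b := add_comm _ _
    have e3 : b + (a + b) = b + b + a := by abel
    have e4 : a + (a + b) = a + a + b := by abel
    have w1 := hW a b (a + b) ha hb (add ha hb)
    have w2 := hW a a b ha ha hb
    have w3 := hW b b a hb hb ha
    have g1 := two_mul_Y_mul_g (Z := Z) (n0 ha) (n0 hb) (n0 (add ha hb)) (n0 (add (add ha ha) hb))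
    have g2 := g_self_mul (Z := Z) (n0 ha) (n0 hb) (n0 (add ha hb)) (n0 (add (add ha ha) hb))
    have g3 := g_self_mul (Z := Z) (n0 hb) (n0 ha) (n0 (add hb ha)) (n0 (add (add hb hb) ha))
    have n1 := g_ne_zero (Z := Z) hpos ha hb (add ha hb)
    have n2 := g_ne_zero (Z := Z) hpos ha ha hb
    have n3 := g_ne_zero (Z := Z) hpos hb hb ha
    rw [e3, e4] at w1
    rw [e2] at w3 g3
    have := hW0 a
    have := hW0 b
    have := hW0 (a + b)
    have := hW0 (a + a)
    have := hW0 (b + b)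
    have := hW0 (a + a + b)
    have := hW0 (b + b + a)
    generalize W (a + b + (a + b)) = w0 at *
    generalize W (a + a + b) = w4 at *
    generalize W (b + b + a) = w5 at *
    generalize W (a + b) = w6 at *
    generalize W (a + a) = w7 at *
    generalize W (b + b) = w8 at *
    generalize W a = w9 at *
    generalize W b = w10 at *
    generalize Z.g a b (a + b) = r1 at *
    generalize Z.g a a b = r2 at *
    generalize Z.g b b a = r3 at *
    generalize Z.Y a = s1 at *
    generalize Z.Y b = s2 at *
    generalize Z.Y (a + b) = s3 at *
    generalize Z.X a = x1 at *
    generalize Z.X b = x2 at *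
    generalize Z.X (a + b) = x3 at *
    -- solve for all terms through `a`, `b` and `a + b`, and compare
    have q0 : w0 = w5 * w4 / (r1 * w9 * w10) := by
      field_simp
      apply mul_left_cancel₀ ‹w6 ≠ 0›
      linear_combination w1
    have q4 : w4 = w7 * w6 ^ 2 / (r2 * w9 ^ 2 * w10) := by
      field_simp
      linear_combination w2
    have q5 : w5 = w8 * w6 ^ 2 / (r3 * w10 ^ 2 * w9) := by
      field_simp
      linear_combination w3
    have q3 : s3 = 2 * s1 * s2 / (r1 * r2 * r3) := by
      field_simp
      apply mul_left_cancel₀ (two_ne_zero (α := K))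
      linear_combination r2 * r3 * g1 + r3 * (x3 - x2) * g2 - 2 * s1 * g3
    rw [q0, q4, q5, q3]
    field_simp
  · apply Additive.toMul.injective
    apply Units.ext
    change W (Pi.single i 1 + Pi.single i 1) *
      (↑((t * Y' (Pi.single i 1) * W' (Pi.single i 1) ^ 4)⁻¹) : K) = 1
    simp only [Units.val_inv_eq_inv_val, Units.val_mul, Units.val_pow_eq_pow_val, hY' (hb i),
      W', t, Units.val_mk0, hW1, hW2]
    have := Z.Y_ne (hpos.ne_zero (hb i))
    field_simp

end ZetaSystem

/-! ### The odd sigma function and the elliptic net relation -/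

namespace ZetaSystem

variable {K : Type*} [Field K] {A : Type*} [AddCommGroup A]

/-- The relation saying that the third difference of `Ψ` is `1 / g`. -/
def CubicRel (Z : ZetaSystem A K) (Ψ : A → K) (a b c : A) : Prop :=
  Z.g a b c * (Ψ (a + b + c) * Ψ a * Ψ b * Ψ c) = Ψ (a + b) * Ψ (b + c) * Ψ (a + c)

/-- A sigma function for a zeta system: an odd function, nonzero away from `0`, that satisfies the
formulas for `σ(a + b) σ(a - b)`, `σ(2a)` and the third difference. -/
structure IsSigma (Z : ZetaSystem A K) (Ψ : A → K) : Prop where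
  map_zero : Ψ 0 = 0
  ne_zero : ∀ {a}, a ≠ 0 → Ψ a ≠ 0
  neg : ∀ a, Ψ (-a) = -Ψ a
  add_mul_sub : ∀ {a b}, a ≠ 0 → b ≠ 0 →
    Ψ (a + b) * Ψ (a - b) = Ψ a ^ 2 * Ψ b ^ 2 * (Z.X b - Z.X a)
  double : ∀ {a}, a ≠ 0 → Ψ (a + a) = 2 * Z.Y a * Ψ a ^ 4
  cubic : ∀ {a b c}, a ≠ 0 → b ≠ 0 → c ≠ 0 → a + b + c ≠ 0 → Z.CubicRel Ψ a b c

section CubicRel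

variable {Z : ZetaSystem A K} {Ψ : A → K} {a b c : A}

lemma CubicRel.swap₁₂ (h : Z.CubicRel Ψ a b c) : Z.CubicRel Ψ b a c := by
  unfold CubicRel at *
  rw [Z.g_comm₁₂ b a, add_comm b a]
  linear_combination h

lemma CubicRel.swap₂₃ (h : Z.CubicRel Ψ a b c) : Z.CubicRel Ψ a c b := by
  unfold CubicRel at *
  rw [Z.g_comm₂₃ a c, add_right_comm a c b, add_comm c b]
  linear_combination h

lemma CubicRel.neg (hΨ : ∀ a, Ψ (-a) = -Ψ a) (h : Z.CubicRel Ψ a b c) :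
    Z.CubicRel Ψ (-a) (-b) (-c) := by
  unfold CubicRel g at *
  simp only [← neg_add, hΨ, Z.ζ_neg]
  linear_combination -h

/-- The relation is symmetric in the four elements `a`, `b`, `c`, `-(a + b + c)` of sum zero. -/
lemma CubicRel.swap₃₄ (hΨ : ∀ a, Ψ (-a) = -Ψ a) (h : Z.CubicRel Ψ a b c) :
    Z.CubicRel Ψ a b (-(a + b + c)) := by
  unfold CubicRel g at *
  have e1 : a + b + -(a + b + c) = -c := by abel
  have e2 : b + -(a + b + c) = -(a + c) := by abel
  have e3 : a + -(a + b + c) = -(b + c) := by abel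
  rw [e1, e2, e3]
  simp only [hΨ, Z.ζ_neg]
  linear_combination h

/-- If a sum of two of the arguments vanishes, then both sides are zero. -/
lemma CubicRel.of_add_eq_zero (h0 : Ψ 0 = 0) (hbc : b + c = 0) : Z.CubicRel Ψ a b c := by
  unfold CubicRel g
  rw [add_assoc, hbc, h0, eq_neg_of_add_eq_zero_right hbc, Z.ζ_neg, add_zero]
  ring

end CubicRel

/-- The third difference relation when two of the four elements of sum zero are positive and two
are negative. It follows from the relation for the positive triple `y`, `b`, `b + x`. -/
lemma cubicRel_mixed [CharZero K] {Z : ZetaSystem A K} {pos : A → Prop} (hpos : IsPosCone pos)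
    {Ψ : A → K} (h0 : ∀ a, pos a → Ψ a ≠ 0) (hneg : ∀ a, Ψ (-a) = -Ψ a)
    (hsub : ∀ a b, pos a → pos b →
      Ψ (a + a + b) * Ψ b = Ψ (a + b) ^ 2 * Ψ a ^ 2 * (Z.X a - Z.X (a + b)))
    (h : ∀ a b c, pos a → pos b → pos c → Z.CubicRel Ψ a b c)
    {b x y : A} (hb : pos b) (hx : pos x) (hy : pos y) :
    Z.CubicRel Ψ (b + x + y) b (-(b + x)) := by
  have n0 {a} (ha : pos a) : a ≠ 0 := hpos.ne_zero ha
  have add {a b} (ha : pos a) (hb : pos b) : pos (a + b) := hpos.add ha hb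
  have k1 := g_mul_slope_sub (Z := Z) (n0 hy) (n0 hb) (n0 (add hb hx)) (n0 (add hy hb))
    (n0 (add hy (add hb hx))) (n0 (add (add hy hb) (add hb hx)))
  have k2 := h y b (b + x) hy hb (add hb hx)
  have k3 := hsub b x hb hx
  have k4 := g_ne_zero (Z := Z) hpos hy hb (add hb hx)
  have n1 := h0 _ hb
  have n2 := h0 _ (add hb hx)
  unfold CubicRel at *
  generalize hG : Z.g y b (b + x) = G at *
  unfold g at *
  have e1 : b + x + y + b + -(b + x) = b + y := by abel
  have e2 : b + x + y + b = b + b + x + y := by abel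
  have e3 : b + -(b + x) = -x := by abel
  have e4 : b + x + y + -(b + x) = y := by abel
  have e5 : y + b + (b + x) = b + b + x + y := by abel
  have e6 : b + (b + x) = b + b + x := by abel
  have e7 : y + (b + x) = b + x + y := by abel
  have e8 : y + b = b + y := by abel
  rw [e1, e2, e3, e4, hneg, hneg, Z.ζ_neg]
  rw [e7, e8] at k1
  rw [e5, e6, e7, e8] at k2
  apply mul_left_cancel₀ (mul_ne_zero k4 (mul_ne_zero n1 n2))
  linear_combination Ψ (b + y) * Ψ (b + x + y) * Ψ b ^ 2 * Ψ (b + x) ^ 2 * (-k1) + Ψ x * k2 +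
    Ψ (b + y) * Ψ (b + x + y) * k3

/-- Reduction of the third difference relation to positive elements. -/
lemma cubicRel_of_pos [CharZero K] {Z : ZetaSystem A K} {pos : A → Prop} (hpos : IsPosCone pos)
    {Ψ : A → K} (hz : Ψ 0 = 0) (h0 : ∀ a, pos a → Ψ a ≠ 0) (hneg : ∀ a, Ψ (-a) = -Ψ a)
    (hsub : ∀ a b, pos a → pos b →
      Ψ (a + a + b) * Ψ b = Ψ (a + b) ^ 2 * Ψ a ^ 2 * (Z.X a - Z.X (a + b)))
    (h : ∀ a b c, pos a → pos b → pos c → Z.CubicRel Ψ a b c)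
    {a b c : A} (ha : a ≠ 0) (hb : b ≠ 0) (hc : c ≠ 0) (habc : a + b + c ≠ 0) :
    Z.CubicRel Ψ a b c := by
  have hmix {b x y : A} (hb : pos b) (hx : pos x) (hy : pos y) :=
    cubicRel_mixed hpos h0 hneg hsub h hb hx hy
  -- two positive elements and one negative element
  have two {a b c : A} (ha : pos a) (hb : pos b) (hc : pos c) (habc : a + b + -c ≠ 0) :
      Z.CubicRel Ψ a b (-c) := by
    rcases hpos.total (a + b + -c) with h1 | hd | hd
    · exact absurd h1 habc
    · -- passing from `c + d - a = b` to `a + b - c = d`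
      have back (h1 : Z.CubicRel Ψ c (a + b + -c) (-a)) : Z.CubicRel Ψ a b (-c) := by
        have h2 := ((h1.neg hneg).swap₂₃.swap₁₂.swap₂₃)
        rw [neg_neg] at h2
        have h3 := (h2.swap₂₃.swap₃₄ hneg).swap₂₃
        have e : -(a + -c + -(a + b + -c)) = b := by abel
        rwa [e] at h3
      rcases hpos.total (c + -b) with h1 | h1 | h1
      · exact CubicRel.of_add_eq_zero hz (by rw [← neg_eq_zero]; rw [← h1]; abel)
      · rcases hpos.total (a + -c) with h2 | h2 | h2
        · exact (CubicRel.of_add_eq_zero hz h2).swap₁₂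
        · have h3 := hmix hb h1 h2
          have e1 : b + (c + -b) + (a + -c) = a := by abel
          have e2 : b + (c + -b) = c := by abel
          rwa [e1, e2] at h3
        · have h3 := hmix hd h1 h2
          have e1 : a + b + -c + (c + -b) + -(a + -c) = c := by abel
          have e2 : a + b + -c + (c + -b) = a := by abel
          rw [e1, e2] at h3
          exact back h3
      · rcases hpos.total (a + -c) with h2 | h2 | h2
        · exact (CubicRel.of_add_eq_zero hz h2).swap₁₂
        · have h3 := hmix hc h2 h1
          have e1 : c + (a + -c) + -(c + -b) = a + b + -c := by abel
          have e2 : c + (a + -c) = a := by abel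
          rw [e1, e2] at h3
          exact back h3.swap₁₂
        · have h3 := hmix ha h2 h1
          have e1 : a + -(a + -c) + -(c + -b) = b := by abel
          have e2 : a + -(a + -c) = c := by abel
          rw [e1, e2] at h3
          exact h3.swap₁₂
    · have h1 := (h a b _ ha hb hd).swap₃₄ hneg
      have e : -(a + b + -(a + b + -c)) = -c := by abel
      rwa [e] at h1
  rcases hpos.total a with h1 | h1 | h1
  · exact absurd h1 ha
  · rcases hpos.total b with h2 | h2 | h2
    · exact absurd h2 hb
    · rcases hpos.total c with h3 | h3 | h3
      · exact absurd h3 hc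
      · exact h a b c h1 h2 h3
      · have h4 := two h1 h2 h3 (by rwa [neg_neg])
        rwa [neg_neg] at h4
    · rcases hpos.total c with h3 | h3 | h3
      · exact absurd h3 hc
      · have h4 := two h1 h3 h2 (by rwa [neg_neg, add_right_comm])
        rw [neg_neg] at h4
        exact h4.swap₂₃
      · have h4 := (two h2 h3 h1 (by
          rw [← neg_ne_zero] at habc
          convert habc using 1
          abel)).neg hneg
        rw [neg_neg, neg_neg, neg_neg] at h4
        exact h4.swap₂₃.swap₁₂
  · rcases hpos.total b with h2 | h2 | h2
    · exact absurd h2 hb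
    · rcases hpos.total c with h3 | h3 | h3
      · exact absurd h3 hc
      · have h4 := two h2 h3 h1 (by
          convert habc using 1
          abel)
        rw [neg_neg] at h4
        exact h4.swap₂₃.swap₁₂
      · have h4 := (two h1 h3 h2 (by
          rw [← neg_ne_zero] at habc
          convert habc using 1
          abel)).neg hneg
        rw [neg_neg, neg_neg, neg_neg] at h4
        exact h4.swap₂₃
    · rcases hpos.total c with h3 | h3 | h3
      · exact absurd h3 hc
      · have h4 := (two h1 h2 h3 (by
          rw [← neg_ne_zero] at habc
          convert habc using 1
          abel)).neg hneg
        rwa [neg_neg, neg_neg, neg_neg] at h4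
      · have h4 := (h _ _ _ h1 h2 h3).neg hneg
        rwa [neg_neg, neg_neg, neg_neg] at h4

/-- Every zeta system on `ℤⁿ` has a sigma function, normalized at `eᵢ` and `eᵢ + eⱼ`. -/
theorem exists_isSigma [CharZero K] {n : ℕ} (Z : ZetaSystem (Fin n → ℤ) K) :
    ∃ Ψ : (Fin n → ℤ) → K, Z.IsSigma Ψ ∧ (∀ i, Ψ (Pi.single i 1) = 1) ∧
      ∀ i j, i ≠ j → Ψ (Pi.single i 1 + Pi.single j 1) = 1 := by
  classical
  obtain ⟨pos, hpos, hb⟩ := exists_isPosCone n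
  obtain ⟨W, hW0, hW1, hW2, hW3, hW⟩ := Z.exists_pos_sigma hpos hb
  -- the odd extension of `W`
  let Ψ : (Fin n → ℤ) → K := fun a ↦ if pos a then W a else if pos (-a) then -W (-a) else 0
  have excl {a} (ha : pos a) : ¬ pos (-a) := fun h ↦ by
    have := hpos.add ha h
    rw [add_neg_cancel] at this
    exact hpos.not_zero this
  have hΨp {a} (ha : pos a) : Ψ a = W a := if_pos ha
  have hΨz : Ψ 0 = 0 := by simp [Ψ, hpos.not_zero]
  have hneg (a) : Ψ (-a) = -Ψ a := by
    rcases hpos.total a with rfl | h | h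
    · rw [neg_zero, hΨz, neg_zero]
    · simp [Ψ, h, excl h]
    · have h' : ¬ pos a := by simpa using excl h
      simp [Ψ, h, h']
  have h0 (a) (ha : pos a) : Ψ a ≠ 0 := by
    rw [hΨp ha]
    exact hW0 a
  have hcub (a b c) (ha : pos a) (hb : pos b) (hc : pos c) : Z.CubicRel Ψ a b c := by
    unfold CubicRel
    rw [hΨp ha, hΨp hb, hΨp hc, hΨp (hpos.add ha hb), hΨp (hpos.add ha hc), hΨp (hpos.add hb hc),
      hΨp (hpos.add (hpos.add ha hb) hc)]
    exact hW a b c ha hb hc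
  have hdbl (a) (ha : pos a) : Ψ (a + a) = 2 * Z.Y a * Ψ a ^ 4 := by
    rw [hΨp ha, hΨp (hpos.add ha ha)]
    exact Z.pos_sigma_double hpos hb hW0 hW1 hW3 hW ha
  have hsub (a b) (ha : pos a) (hb : pos b) :
      Ψ (a + a + b) * Ψ b = Ψ (a + b) ^ 2 * Ψ a ^ 2 * (Z.X a - Z.X (a + b)) := by
    have h1 := hcub a a b ha ha hb
    unfold CubicRel at h1
    rw [hdbl a ha] at h1
    have h2 := g_self_mul (Z := Z) (hpos.ne_zero ha) (hpos.ne_zero hb)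
      (hpos.ne_zero (hpos.add ha hb)) (hpos.ne_zero (hpos.add (hpos.add ha ha) hb))
    apply mul_left_cancel₀ (mul_ne_zero (g_ne_zero (Z := Z) hpos ha ha hb)
      (pow_ne_zero 2 (h0 a ha)))
    linear_combination h1 + Ψ (a + b) ^ 2 * Ψ a ^ 4 * h2
  have pn {a} (ha : a ≠ 0) : pos a ∨ pos (-a) := (hpos.total a).resolve_left ha
  have key {a b} (ha : pos a) (hb : pos b) :
      Ψ (a + b) * Ψ (a - b) = Ψ a ^ 2 * Ψ b ^ 2 * (Z.X b - Z.X a) := by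
    rcases hpos.total (a - b) with h | h | h
    · rw [h, hΨz, sub_eq_zero.1 h]
      ring
    · have h1 := hsub b (a - b) hb h
      have e1 : b + b + (a - b) = a + b := by abel
      have e2 : b + (a - b) = a := by abel
      rwa [e1, e2] at h1
    · have h1 := hsub a _ ha h
      have e1 : a + a + -(a - b) = a + b := by abel
      have e2 : a + -(a - b) = b := by abel
      rw [e1, e2, hneg] at h1
      linear_combination -h1
  refine ⟨Ψ, ⟨hΨz, fun {a} ha ↦ ?_, hneg, fun {a b} ha hb ↦ ?_, fun {a} ha ↦ ?_,
    fun {a b c} ha hb hc habc ↦ cubicRel_of_pos hpos hΨz h0 hneg hsub hcub ha hb hc habc⟩,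
    fun i ↦ ?_, fun i j hij ↦ ?_⟩
  · rcases pn ha with h | h
    · exact h0 a h
    · rw [← neg_neg a, hneg]
      exact neg_ne_zero.2 (h0 _ h)
  · rcases pn ha with ha | ha <;> rcases pn hb with hb | hb
    · exact key ha hb
    · have h1 := key ha hb
      rw [sub_neg_eq_add, ← sub_eq_add_neg, hneg, Z.X_neg] at h1
      linear_combination h1
    · have h1 := key ha hb
      rw [show -a + b = -(a - b) by abel, show -a - b = -(a + b) by abel] at h1
      simp only [hneg, Z.X_neg] at h1
      linear_combination h1
    · have h1 := key ha hb
      rw [show -a + -b = -(a + b) by abel, show -a - -b = -(a - b) by abel] at h1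
      simp only [hneg, Z.X_neg] at h1
      linear_combination h1
  · rcases pn ha with h | h
    · exact hdbl a h
    · have h1 := hdbl _ h
      rw [← neg_add, hneg, hneg, Z.Y_neg ha] at h1
      linear_combination -h1
  · rw [hΨp (hb i), hW1]
  · rw [hΨp (hpos.add (hb i) (hb j)), hW2 i j hij]

namespace IsSigma

variable {Z : ZetaSystem A K} {Ψ : A → K}

/-- The relation behind the net recurrence: `Ψ(p + q + s) Ψ(p - q) Ψ(s)`, divided by
`Ψ(p) Ψ(q) Ψ(p + s) Ψ(q + s)`, is a difference of a function of `p` and a function of `q`. -/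
lemma add_add_mul_sub_mul [CharZero K] (h : Z.IsSigma Ψ) {p q s : A} (hp : p ≠ 0) (hq : q ≠ 0)
    (hs : s ≠ 0) (hps : p + s ≠ 0) (hqs : q + s ≠ 0) :
    Ψ (p + q + s) * Ψ (p - q) * Ψ s =
      ((Z.ζ (q + s) - Z.ζ q) - (Z.ζ (p + s) - Z.ζ p)) *
        (Ψ p * Ψ q * Ψ (p + s) * Ψ (q + s)) := by
  -- both sides vanish, or the duplication formula applies, or the formulas for `σ(p + q) σ(p - q)`
  -- and for the third difference can be combined
  by_cases h1 : p + q + s = 0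
  · have e1 : p + s = -q := by rw [← add_eq_zero_iff_eq_neg, add_right_comm, h1]
    have e2 : q + s = -p := by rw [← add_eq_zero_iff_eq_neg, ← h1]; abel
    rw [h1, e1, e2, h.map_zero, Z.ζ_neg, Z.ζ_neg]
    ring
  by_cases h2 : p + q = 0
  · obtain rfl : q = -p := eq_neg_of_add_eq_zero_right h2
    have k1 := h.double hp
    have k2 := h.add_mul_sub hs hp
    have e1 : s - p ≠ 0 := by rwa [sub_eq_neg_add]
    have e2 : p + (s - p) = s := by abel
    have e3 : p + p + (s - p) = p + s := by abel
    have k3 := g_self_mul (Z := Z) hp e1 (by rwa [e2]) (by rwa [e3])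
    rw [e2, g, e3] at k3
    rw [h2, zero_add, sub_neg_eq_add, k1, neg_add_eq_sub, h.neg, Z.ζ_neg, add_comm p s]
    rw [add_comm p s] at k3
    linear_combination -(Z.ζ (s - p) + Z.ζ p - Z.ζ (s + p) + Z.ζ p) * Ψ p ^ 2 * (-k2)
      + Ψ s ^ 2 * Ψ p ^ 4 * k3
  · have k1 := h.cubic hp hq hs h1
    unfold CubicRel at k1
    have k2 := h.add_mul_sub hp hq
    have e1 : s + p + q = p + q + s := by abel
    have k3 := g_mul_slope_sub (Z := Z) hs hp hq (by rwa [add_comm]) (by rwa [add_comm])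
      (by rwa [e1])
    have e2 : Z.g s p q = Z.g p q s := by rw [g_comm₁₂, g_comm₂₃]
    rw [e2, add_comm s p, add_comm s q] at k3
    have k4 : Z.g p q s ≠ 0 := by
      intro h3
      rw [h3, zero_mul] at k1
      exact mul_ne_zero (mul_ne_zero (h.ne_zero h2) (h.ne_zero hqs)) (h.ne_zero hps) k1.symm
    apply mul_left_cancel₀ (mul_ne_zero k4 (mul_ne_zero (h.ne_zero hp) (h.ne_zero hq)))
    linear_combination Ψ (p - q) * k1 + Ψ (q + s) * Ψ (p + s) * k2
      + Ψ p ^ 2 * Ψ q ^ 2 * Ψ (p + s) * Ψ (q + s) * k3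

/-- A sigma function is an elliptic net. -/
theorem isElliptic [CharZero K] (h : Z.IsSigma Ψ) : EllNet.IsElliptic Ψ := by
  refine ⟨h.map_zero, fun p q r s ↦ ?_⟩
  have h0 := h.map_zero
  by_cases hp : p = 0
  · subst hp
    simp only [zero_sub, zero_add, add_zero, sub_zero, h.neg, h0]
    ring
  by_cases hq : q = 0
  · subst hq
    simp only [zero_sub, zero_add, add_zero, sub_zero, h.neg, h0, add_comm r p]
    ring
  by_cases hr : r = 0
  · subst hr
    simp only [zero_sub, zero_add, add_zero, sub_zero, h.neg, h0]
    ring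
  by_cases hs : s = 0
  · subst hs
    simp only [add_zero]
    linear_combination Ψ r ^ 2 * h.add_mul_sub hp hq + Ψ p ^ 2 * h.add_mul_sub hq hr +
      Ψ q ^ 2 * h.add_mul_sub hr hp
  by_cases hps : p + s = 0
  · have e1 : p + q + s = q := by rw [add_right_comm, hps, zero_add]
    have e2 : r + p + s = r := by rw [add_assoc, hps, add_zero]
    have e3 : p - q = -(q + s) := by rw [eq_neg_iff_add_eq_zero, ← hps]; abel
    have e4 : r - p = r + s := by rw [sub_eq_iff_eq_add, add_assoc, add_comm s p, hps, add_zero]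
    rw [e1, e2, e3, e4, hps, h0, h.neg]
    ring
  by_cases hqs : q + s = 0
  · have e1 : p + q + s = p := by rw [add_assoc, hqs, add_zero]
    have e2 : q + r + s = r := by rw [add_right_comm, hqs, zero_add]
    have e3 : q - r = -(r + s) := by rw [eq_neg_iff_add_eq_zero, ← hqs]; abel
    have e4 : p - q = p + s := by rw [sub_eq_iff_eq_add, add_assoc, add_comm s q, hqs, add_zero]
    rw [e1, e2, e3, e4, hqs, h0, h.neg]
    ring
  by_cases hrs : r + s = 0
  · have e1 : r + p + s = p := by rw [add_right_comm, hrs, zero_add]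
    have e2 : q + r + s = q := by rw [add_assoc, hrs, add_zero]
    have e3 : r - p = -(p + s) := by rw [eq_neg_iff_add_eq_zero, ← hrs]; abel
    have e4 : q - r = q + s := by rw [sub_eq_iff_eq_add, add_assoc, add_comm s r, hrs, add_zero]
    rw [e1, e2, e3, e4, hrs, h0, h.neg]
    ring
  -- the three terms are a cyclic sum of differences
  apply mul_left_cancel₀ (h.ne_zero hs)
  linear_combination
    Ψ (r + s) * Ψ r * h.add_add_mul_sub_mul hp hq hs hps hqs +
    Ψ (p + s) * Ψ p * h.add_add_mul_sub_mul hq hr hs hqs hrs +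
    Ψ (q + s) * Ψ q * h.add_add_mul_sub_mul hr hp hs hrs hps

end IsSigma

end ZetaSystem

/-! ### Slopes of lines through points of a Weierstrass curve -/

section Slope

open Polynomial WeierstrassCurve.Affine WeierstrassCurve.Affine.CoordinateRing
open scoped Polynomial.Bivariate

variable {F : Type*} [Field F] {W : WeierstrassCurve.Affine F}

/-- The `x`-coordinate of a point, with the value `0` at the point at infinity. -/
def xc : W.Point → F
  | .zero => 0
  | .some x _ _ => x

/-- The `y`-coordinate of a point, with the value `0` at the point at infinity. -/
def yc : W.Point → F
  | .zero => 0
  | .some _ y _ => y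

lemma exists_eq_some {P : W.Point} (hP : P ≠ 0) : ∃ x y h, P = .some x y h := by
  cases P with
  | zero => exact absurd rfl hP
  | some x y h => exact ⟨x, y, h, rfl⟩

lemma xc_neg (P : W.Point) : xc (-P) = xc P := by
  cases P <;> rfl

lemma yc_neg {P : W.Point} (hP : P ≠ 0) : yc (-P) = W.negY (xc P) (yc P) := by
  obtain ⟨x, y, h, rfl⟩ := exists_eq_some hP
  rfl

lemma equation_xc_yc {P : W.Point} (hP : P ≠ 0) : W.Equation (xc P) (yc P) := by
  obtain ⟨x, y, h, rfl⟩ := exists_eq_some hP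
  exact h.1

lemma point_ext {P Q : W.Point} (hP : P ≠ 0) (hQ : Q ≠ 0) (hx : xc P = xc Q)
    (hy : yc P = yc Q) : P = Q := by
  obtain ⟨x, y, h, rfl⟩ := exists_eq_some hP
  obtain ⟨x', y', h', rfl⟩ := exists_eq_some hQ
  obtain rfl : x = x' := hx
  obtain rfl : y = y' := hy
  rfl

/-- A unit of the coordinate ring is a constant: its norm to `F[X]` has degree `0`, and the degree
of the norm of `p + q Y` is `max (2 deg p) (2 deg q + 3)`. -/
lemma exists_eq_C_of_isUnit {u : W.CoordinateRing} (hu : IsUnit u) :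
    ∃ c : F, u = C c • (1 : W.CoordinateRing) := by
  obtain ⟨p, q, rfl⟩ := exists_smul_basis_eq u
  have h1 := Polynomial.degree_eq_zero_of_isUnit (hu.map (Algebra.norm F[X]))
  rw [degree_norm_smul_basis] at h1
  have hq : q = 0 := by
    by_contra hq
    have h2 := (le_max_right (2 • p.degree) (2 • q.degree + 3)).trans h1.le
    rw [Polynomial.degree_eq_natDegree hq] at h2
    have h3 : ((2 * q.natDegree + 3 : ℕ) : WithBot ℕ) ≤ ((0 : ℕ) : WithBot ℕ) := by
      simpa [two_nsmul, two_mul] using h2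
    have h4 := Nat.cast_le.1 h3
    omega
  subst hq
  have hp : p.degree ≤ 0 := by
    by_contra hp
    have h2 := (le_max_left (2 • p.degree) _).trans h1.le
    rw [two_nsmul] at h2
    have h3 : (0 : WithBot ℕ) < p.degree := not_le.1 hp
    exact absurd (h2.trans_lt h3) (not_lt.2 (le_add_of_nonneg_left h3.le))
  refine ⟨p.coeff 0, ?_⟩
  rw [← Polynomial.eq_C_of_degree_le_zero hp, zero_smul, add_zero]

/-- The ideal of functions vanishing at a point of the affine curve. -/
noncomputable def ptIdeal (P : W.Point) : Ideal W.CoordinateRing :=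
  XYIdeal W (xc P) (C (yc P))

lemma ptIdeal_neg_mul {P : W.Point} (hP : P ≠ 0) :
    ptIdeal (-P) * ptIdeal P = Ideal.span {XClass W (xc P)} := by
  rw [ptIdeal, xc_neg, yc_neg hP]
  obtain ⟨x, y, h, rfl⟩ := exists_eq_some hP
  exact XYIdeal_neg_mul h

lemma eq_or_eq_neg_of_xc {P Q : W.Point} (hP : P ≠ 0) (hQ : Q ≠ 0) (hx : xc P = xc Q) :
    P = Q ∨ P = -Q := by
  obtain ⟨x, y, h, rfl⟩ := exists_eq_some hP
  obtain ⟨x', y', h', rfl⟩ := exists_eq_some hQ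
  exact Point.X_eq_iff.1 hx

variable [DecidableEq F]

/-- The slope of the line through two points of the curve, the tangent line for equal points. -/
def sl (P Q : W.Point) : F := W.slope (xc P) (xc Q) (yc P) (yc Q)

/-- The function defining the line through two points. -/
noncomputable def lineFun (P Q : W.Point) : W.CoordinateRing :=
  YClass W (linePolynomial (xc P) (yc P) (sl P Q))

lemma not_vertical {P Q : W.Point} (hP : P ≠ 0) (hQ : Q ≠ 0) (hPQ : P + Q ≠ 0) :
    ¬ (xc P = xc Q ∧ yc P = W.negY (xc Q) (yc Q)) := by
  rintro ⟨h1, h2⟩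
  apply hPQ
  rw [← yc_neg hQ] at h2
  rw [← xc_neg Q] at h1
  rw [point_ext hP (neg_ne_zero.2 hQ) h1 h2, neg_add_cancel]

lemma xc_add {P Q : W.Point} (hP : P ≠ 0) (hQ : Q ≠ 0) (hPQ : P + Q ≠ 0) :
    xc (P + Q) = W.addX (xc P) (xc Q) (sl P Q) := by
  have h := not_vertical hP hQ hPQ
  obtain ⟨x, y, h1, rfl⟩ := exists_eq_some hP
  obtain ⟨x', y', h2, rfl⟩ := exists_eq_some hQ
  have h' : ¬ (x = x' ∧ y = W.negY x' y') := h
  rw [Point.add_some h']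
  rfl

lemma yc_add {P Q : W.Point} (hP : P ≠ 0) (hQ : Q ≠ 0) (hPQ : P + Q ≠ 0) :
    yc (P + Q) = W.addY (xc P) (xc Q) (yc P) (sl P Q) := by
  have h := not_vertical hP hQ hPQ
  obtain ⟨x, y, h1, rfl⟩ := exists_eq_some hP
  obtain ⟨x', y', h2, rfl⟩ := exists_eq_some hQ
  have h' : ¬ (x = x' ∧ y = W.negY x' y') := h
  rw [Point.add_some h']
  rfl

lemma ptIdeal_mul_ptIdeal {P Q : W.Point} (hP : P ≠ 0) (hQ : Q ≠ 0) (hPQ : P + Q ≠ 0) :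
    Ideal.span {XClass W (xc (P + Q))} * (ptIdeal P * ptIdeal Q) =
      Ideal.span {lineFun P Q} * ptIdeal (P + Q) := by
  rw [ptIdeal, ptIdeal, ptIdeal, xc_add hP hQ hPQ, yc_add hP hQ hPQ]
  exact XYIdeal_mul_XYIdeal (equation_xc_yc hP) (equation_xc_yc hQ) (not_vertical hP hQ hPQ)

/-- The conic consisting of the lines through `a, b` and through `c, d`, where
`a + b + c + d = 0`, cuts out these four points and the points `±(a + b)`. -/
lemma span_lineFun_mul_lineFun {a b c d : W.Point} (ha : a ≠ 0) (hb : b ≠ 0) (hc : c ≠ 0)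
    (hd : d ≠ 0) (hab : a + b ≠ 0) (habcd : a + b + (c + d) = 0) :
    Ideal.span {XClass W (xc (a + b))} * (ptIdeal a * ptIdeal b * (ptIdeal c * ptIdeal d)) =
      Ideal.span {lineFun a b * lineFun c d} := by
  have hcd : c + d = -(a + b) := eq_neg_of_add_eq_zero_right habcd
  have h1 := ptIdeal_mul_ptIdeal ha hb hab
  have h2 := ptIdeal_mul_ptIdeal hc hd (by rw [hcd]; exact neg_ne_zero.2 hab)
  rw [hcd, xc_neg] at h2
  have h3 := ptIdeal_neg_mul hab
  rw [← Ideal.span_singleton_mul_right_inj (XClass_ne_zero (xc (a + b))),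
    ← Ideal.span_singleton_mul_span_singleton]
  calc _ = Ideal.span {XClass W (xc (a + b))} * (ptIdeal a * ptIdeal b) *
        (Ideal.span {XClass W (xc (a + b))} * (ptIdeal c * ptIdeal d)) := by ring
    _ = Ideal.span {lineFun a b} * Ideal.span {lineFun c d} *
        (ptIdeal (-(a + b)) * ptIdeal (a + b)) := by rw [h1, h2]; ring
    _ = _ := by rw [h3]; ring

/-- The product of two lines and a vertical line in the basis `1`, `Y` of the coordinate ring. The
coefficient of `Y` contains the sum of the two slopes. -/
lemma XClass_mul_lineFun_mul_lineFun (x : F) (a b c d : W.Point) :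
    XClass W x * (lineFun a b * lineFun c d) =
      ((X - C x) * ((X ^ 3 + C W.a₂ * X ^ 2 + C W.a₄ * X + C W.a₆) +
        linePolynomial (xc a) (yc a) (sl a b) * linePolynomial (xc c) (yc c) (sl c d))) •
          (1 : W.CoordinateRing) +
      (-((X - C x) * (C W.a₁ * X + C W.a₃ + linePolynomial (xc a) (yc a) (sl a b) +
        linePolynomial (xc c) (yc c) (sl c d)))) • mk W Y := by
  rw [lineFun, lineFun, YClass, YClass, XClass, WeierstrassCurve.Affine.CoordinateRing.smul,
    WeierstrassCurve.Affine.CoordinateRing.smul, mul_one, ← map_mul, ← map_mul, ← map_mul,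
    ← map_add]
  refine AdjoinRoot.mk_eq_mk.2 ⟨C (X - C x), ?_⟩
  rw [WeierstrassCurve.Affine.polynomial]
  simp only [map_add, map_sub, map_mul, map_neg]
  ring1

/-- For four points of sum zero, the sum of the slopes of the lines through two pairs of points
does not depend on the pairing. The two products of lines, each multiplied by the vertical line of
the other, generate the same ideal, so they differ by a constant. -/
theorem sl_add_sl {a b c d : W.Point} (ha : a ≠ 0) (hb : b ≠ 0) (hc : c ≠ 0) (hd : d ≠ 0)
    (hab : a + b ≠ 0) (hbc : b + c ≠ 0) (habcd : a + b + c + d = 0) :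
    sl a b + sl c d = sl b c + sl a d := by
  have h1 := span_lineFun_mul_lineFun ha hb hc hd hab (by rw [← habcd]; abel)
  have h2 := span_lineFun_mul_lineFun hb hc ha hd hbc (by rw [← habcd]; abel)
  have h3 : Ideal.span {XClass W (xc (b + c)) * (lineFun a b * lineFun c d)} =
      Ideal.span {XClass W (xc (a + b)) * (lineFun b c * lineFun a d)} := by
    rw [← Ideal.span_singleton_mul_span_singleton,
      ← Ideal.span_singleton_mul_span_singleton (XClass W (xc (a + b))), ← h1, ← h2]
    ring
  rw [Ideal.span_singleton_eq_span_singleton] at h3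
  obtain ⟨u, hu⟩ := h3
  obtain ⟨k, hk⟩ := exists_eq_C_of_isUnit u.isUnit
  rw [hk, XClass_mul_lineFun_mul_lineFun, XClass_mul_lineFun_mul_lineFun, mul_smul_comm, mul_one,
    smul_add, smul_smul, smul_smul, ← sub_eq_zero, add_sub_add_comm, ← sub_smul, ← sub_smul] at hu
  obtain ⟨e1, e2⟩ := smul_basis_eq_zero hu
  -- the leading coefficient of the component of `1` shows that the constant is `1`; the leading
  -- coefficient of the component of `Y` is the sum of the slopes, up to `a₁`
  have f1 := congrArg (coeff · 4) e1
  have f2 := congrArg (coeff · 2) e2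
  have p4 (A B D E : F) : (X ^ 4 + C A * X ^ 3 + C B * X ^ 2 + C D * X + C E).coeff 4 = 1 := by
    simp
  have p2 (A B D : F) : (C A * X ^ 2 + C B * X + C D).coeff 2 = A := by
    simp
  have g1 (x l1 l2 x1 x2 y1 y2 : F) : ((X - C x) * (X ^ 3 + C W.a₂ * X ^ 2 + C W.a₄ * X + C W.a₆
      + linePolynomial x1 y1 l1 * linePolynomial x2 y2 l2)).coeff 4 = 1 := by
    rw [← p4 (W.a₂ + l1 * l2 - x) (W.a₄ + l1 * (y2 - l2 * x2) + l2 * (y1 - l1 * x1) -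
      x * (W.a₂ + l1 * l2)) (W.a₆ + (y1 - l1 * x1) * (y2 - l2 * x2) - x * (W.a₄ +
      l1 * (y2 - l2 * x2) + l2 * (y1 - l1 * x1)))
      (- x * (W.a₆ + (y1 - l1 * x1) * (y2 - l2 * x2)))]
    congr 1
    simp only [linePolynomial, map_add, map_sub, map_mul, map_neg]
    ring1
  have g2 (x l1 l2 x1 x2 y1 y2 : F) : ((X - C x) * (C W.a₁ * X + C W.a₃ +
      linePolynomial x1 y1 l1 + linePolynomial x2 y2 l2)).coeff 2 = W.a₁ + l1 + l2 := by
    rw [← p2 (W.a₁ + l1 + l2) (W.a₃ + (y1 - l1 * x1) + (y2 - l2 * x2) - x * (W.a₁ + l1 + l2))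
      (-x * (W.a₃ + (y1 - l1 * x1) + (y2 - l2 * x2)))]
    congr 1
    simp only [linePolynomial, map_add, map_sub, map_mul, map_neg]
    ring1
  rw [coeff_sub, coeff_C_mul, g1, g1, coeff_zero] at f1
  rw [coeff_sub, coeff_C_mul, coeff_neg, coeff_neg, g2, g2, coeff_zero] at f2
  linear_combination -f2 - (W.a₁ + sl a b + sl c d) * f1

end Slope

section Slope

open WeierstrassCurve.Affine

variable {F : Type*} [Field F] {W : WeierstrassCurve.Affine F} [DecidableEq F]

lemma eq_of_xc_eq {P Q : W.Point} (hP : P ≠ 0) (hQ : Q ≠ 0) (hPQ : P + Q ≠ 0)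
    (hx : xc P = xc Q) : P = Q :=
  (eq_or_eq_neg_of_xc hP hQ hx).resolve_right fun h ↦ hPQ (by rw [h, neg_add_cancel])

lemma sl_mul {P Q : W.Point} (hP : P ≠ 0) (hQ : Q ≠ 0) (hPQ : P + Q ≠ 0) :
    sl P Q * (xc Q - xc P) = yc Q - yc P := by
  by_cases hx : xc P = xc Q
  · rw [eq_of_xc_eq hP hQ hPQ hx, sub_self, sub_self, mul_zero]
  · rw [sl, slope_of_X_ne hx]
    have := sub_ne_zero.2 hx
    field_simp
    ring

lemma sl_comm {P Q : W.Point} (hP : P ≠ 0) (hQ : Q ≠ 0) (hPQ : P + Q ≠ 0) :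
    sl P Q = sl Q P := by
  by_cases hx : xc P = xc Q
  · rw [eq_of_xc_eq hP hQ hPQ hx]
  · have h1 := sl_mul hP hQ hPQ
    have h2 := sl_mul hQ hP (by rwa [add_comm])
    apply mul_right_cancel₀ (sub_ne_zero.2 hx)
    linear_combination -h1 - h2

lemma sl_sq {P Q : W.Point} (hP : P ≠ 0) (hQ : Q ≠ 0) (hPQ : P + Q ≠ 0) :
    sl P Q ^ 2 + W.a₁ * sl P Q - W.a₂ = xc P + xc Q + xc (P + Q) := by
  rw [xc_add hP hQ hPQ, addX]
  ring

lemma yc_neg_add_sub {P Q : W.Point} (hP : P ≠ 0) (hQ : Q ≠ 0) (hPQ : P + Q ≠ 0) :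
    yc (-(P + Q)) - yc P = sl P Q * (xc (P + Q) - xc P) := by
  rw [yc_neg hPQ, yc_add hP hQ hPQ, addY, ← xc_add hP hQ hPQ, negY_negY, negAddY,
    ← xc_add hP hQ hPQ]
  ring

lemma sl_self_mul {P : W.Point} (hP : P ≠ 0) (hPP : P + P ≠ 0) :
    sl P P * (2 * yc P + W.a₁ * xc P + W.a₃) =
      3 * xc P ^ 2 + 2 * W.a₂ * xc P + W.a₄ - W.a₁ * yc P := by
  have h : yc P ≠ W.negY (xc P) (yc P) := fun h ↦ not_vertical hP hP hPP ⟨rfl, h⟩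
  have h' := sub_ne_zero.2 h
  rw [sl, slope_of_Y_ne rfl h]
  field_simp
  rw [negY]
  ring

lemma two_mul_yc_ne_zero {P : W.Point} (hP : P ≠ 0) (hPP : P + P ≠ 0) :
    2 * yc P + W.a₁ * xc P + W.a₃ ≠ 0 := by
  intro h
  refine not_vertical hP hP hPP ⟨rfl, ?_⟩
  rw [negY]
  linear_combination h

/-- The line through `P` and `Q` is the line through `P` and the third intersection point. -/
lemma sl_third {P Q : W.Point} (hP : P ≠ 0) (hQ : Q ≠ 0) (hPQ : P + Q ≠ 0) :
    sl P (-(P + Q)) = sl P Q := by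
  have hR : -(P + Q) ≠ 0 := neg_ne_zero.2 hPQ
  have e : P + -(P + Q) = -Q := by abel
  have hPR : P + -(P + Q) ≠ 0 := by rw [e]; exact neg_ne_zero.2 hQ
  have h1 := sl_mul hP hQ hPQ
  have h2 := sl_mul hP hR hPR
  have h3 := yc_neg_add_sub hP hQ hPQ
  have h4 := yc_neg_add_sub hP hR hPR
  rw [e, neg_neg, xc_neg] at h4
  rw [xc_neg] at h2
  by_cases hx : xc P = xc Q
  · by_cases hx' : xc P = xc (P + Q)
    · have hR' : P = -(P + Q) := eq_of_xc_eq hP hR hPR (by rw [xc_neg]; exact hx')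
      rw [← hR', ← eq_of_xc_eq hP hQ hPQ hx]
    · apply mul_right_cancel₀ (sub_ne_zero.2 (Ne.symm hx'))
      rw [h2, h3]
  · apply mul_right_cancel₀ (sub_ne_zero.2 (Ne.symm hx))
    rw [h1, ← h4]

/-- By this relation, adding `a₁ / 2` to the slope makes it odd. -/
lemma sl_neg_neg {P Q : W.Point} (hP : P ≠ 0) (hQ : Q ≠ 0) (hPQ : P + Q ≠ 0) :
    sl (-P) (-Q) = -sl P Q - W.a₁ := by
  have hPQ' : -P + -Q ≠ 0 := by rw [← neg_add]; exact neg_ne_zero.2 hPQ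
  by_cases hx : xc P = xc Q
  · obtain rfl := eq_of_xc_eq hP hQ hPQ hx
    have h1 := sl_self_mul hP hPQ
    have h2 := sl_self_mul (neg_ne_zero.2 hP) hPQ'
    have h3 := two_mul_yc_ne_zero hP hPQ
    rw [xc_neg, yc_neg hP, negY] at h2
    apply mul_right_cancel₀ h3
    linear_combination -h2 + h1
  · have h1 := sl_mul hP hQ hPQ
    have h2 := sl_mul (neg_ne_zero.2 hP) (neg_ne_zero.2 hQ) hPQ'
    rw [xc_neg, xc_neg, yc_neg hP, yc_neg hQ, negY, negY] at h2
    apply mul_right_cancel₀ (sub_ne_zero.2 (Ne.symm hx))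
    linear_combination h2 + h1

end Slope

/-! ### The zeta function of a free group of points -/

/-- A slope function on `ℤⁿ` is the coboundary of an odd zeta function. The zeta function is found
on a positive cone. The symmetry of the slope in three points `a`, `b`, `-(a + b)` on a line then
reduces arguments of mixed sign to positive ones. -/
theorem exists_zeta {K : Type*} [Field K] [CharZero K] {n : ℕ}
    (l : (Fin n → ℤ) → (Fin n → ℤ) → K)
    (hcomm : ∀ {a b}, a ≠ 0 → b ≠ 0 → a + b ≠ 0 → l a b = l b a)
    (hneg : ∀ {a b}, a ≠ 0 → b ≠ 0 → a + b ≠ 0 → l (-a) (-b) = -l a b)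
    (hthird : ∀ {a b}, a ≠ 0 → b ≠ 0 → a + b ≠ 0 → l a (-(a + b)) = l a b)
    (hcoc : ∀ {a b c}, a ≠ 0 → b ≠ 0 → c ≠ 0 → a + b ≠ 0 → b + c ≠ 0 → a + b + c ≠ 0 →
      l a b + l (a + b) c = l b c + l a (b + c)) :
    ∃ ζ : (Fin n → ℤ) → K, (∀ a, ζ (-a) = -ζ a) ∧
      ∀ {a b}, a ≠ 0 → b ≠ 0 → a + b ≠ 0 → ζ (a + b) - ζ a - ζ b = l a b := by
  classical
  obtain ⟨pos, hpos, hb⟩ := exists_isPosCone n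
  have n0 {a} (ha : pos a) : a ≠ 0 := hpos.ne_zero ha
  obtain ⟨z, -, hz⟩ := exists_splitting hpos hb l
    (fun a b ha hb ↦ hcomm (n0 ha) (n0 hb) (n0 (hpos.add ha hb)))
    (fun a b c ha hb hc ↦ hcoc (n0 ha) (n0 hb) (n0 hc) (n0 (hpos.add ha hb))
      (n0 (hpos.add hb hc)) (n0 (hpos.add (hpos.add ha hb) hc))) 0
  -- the odd extension of `z`
  let ζ : (Fin n → ℤ) → K := fun a ↦ if pos a then z a else if pos (-a) then -z (-a) else 0
  have excl {a} (ha : pos a) : ¬ pos (-a) := fun h ↦ by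
    have := hpos.add ha h
    rw [add_neg_cancel] at this
    exact hpos.not_zero this
  have hζp {a} (ha : pos a) : ζ a = z a := if_pos ha
  have hζ (a) : ζ (-a) = -ζ a := by
    rcases hpos.total a with rfl | h | h
    · simp [ζ, hpos.not_zero]
    · simp [ζ, h, excl h]
    · have h' : ¬ pos a := by simpa using excl h
      simp [ζ, h, h']
  have h1 {a b} (ha : pos a) (hb : pos b) : ζ (a + b) - ζ a - ζ b = l a b := by
    rw [hζp ha, hζp hb, hζp (hpos.add ha hb), hz a b ha hb]
    ring
  have hn {a b} (ha : a ≠ 0) (hb : b ≠ 0) (hab : a + b ≠ 0)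
      (h : ζ (-a + -b) - ζ (-a) - ζ (-b) = l (-a) (-b)) : ζ (a + b) - ζ a - ζ b = l a b := by
    rw [← neg_add, hζ, hζ, hζ, hneg ha hb hab] at h
    linear_combination -h
  have hs {a b} (ha : a ≠ 0) (hb : b ≠ 0) (hab : a + b ≠ 0)
      (h : ζ (b + a) - ζ b - ζ a = l b a) : ζ (a + b) - ζ a - ζ b = l a b := by
    rw [hcomm ha hb hab, ← h, add_comm b a]
    ring
  have ht {a b} (ha : a ≠ 0) (hb : b ≠ 0) (hab : a + b ≠ 0)
      (h : ζ (a + -(a + b)) - ζ a - ζ (-(a + b)) = l a (-(a + b))) :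
      ζ (a + b) - ζ a - ζ b = l a b := by
    rw [hthird ha hb hab, show a + -(a + b) = -b by abel, hζ, hζ] at h
    linear_combination h
  -- one positive and one negative element
  have h2 {a b} (ha : pos a) (hb : pos (-b)) (hab : a + b ≠ 0) :
      ζ (a + b) - ζ a - ζ b = l a b := by
    have hb0 : b ≠ 0 := neg_ne_zero.1 (n0 hb)
    rcases hpos.total (a + b) with h | h | h
    · exact absurd h hab
    · have hba : b + a ≠ 0 := by rwa [add_comm]
      refine hs (n0 ha) hb0 hab (hn hb0 (n0 ha) hba ?_)
      have e : -(-b + -a) = a + b := by abel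
      refine ht (n0 hb) (neg_ne_zero.2 (n0 ha)) (by rw [← neg_add]; exact neg_ne_zero.2 hba) ?_
      rw [e]
      exact h1 hb h
    · exact ht (n0 ha) hb0 hab (h1 ha h)
  refine ⟨ζ, hζ, fun {a b} ha hb hab ↦ ?_⟩
  have hab' : -a + -b ≠ 0 := by rw [← neg_add]; exact neg_ne_zero.2 hab
  rcases (hpos.total a).resolve_left ha with h | h <;>
    rcases (hpos.total b).resolve_left hb with h' | h'
  · exact h1 h h'
  · exact h2 h h' hab
  · exact hs ha hb hab (h2 h' h (by rwa [add_comm]))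
  · exact hn ha hb hab (h1 h h')

section Curve

open WeierstrassCurve.Affine

variable {K : Type*} [Field K] [CharZero K] [DecidableEq K] (W : WeierstrassCurve.Affine K)

/-- An injective family of points of a Weierstrass curve indexed by `ℤⁿ` gives a zeta system. The
coordinates are those of the short Weierstrass equation. Injectivity and the absence of torsion in
`ℤⁿ` ensure that only the index `0` gives the point at infinity and that no point is its own
negative. -/
theorem exists_zetaSystem {n : ℕ} (v : (Fin n → ℤ) →+ W.Point) (hv : Function.Injective v) :
    ∃ Z : ZetaSystem (Fin n → ℤ) K, (∀ a, Z.X a = xc (v a) + W.b₂ / 12) ∧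
      ∀ a, Z.Y a = yc (v a) + (W.a₁ * xc (v a) + W.a₃) / 2 := by
  have n0 {a} (ha : a ≠ 0) : v a ≠ 0 := (map_ne_zero_iff v hv).2 ha
  have n1 {a b} (hab : a + b ≠ 0) : v a + v b ≠ 0 := by
    rw [← map_add]
    exact n0 hab
  have two {a : Fin n → ℤ} (ha : a ≠ 0) : a + a ≠ 0 := by
    intro h
    apply ha
    ext i
    have := congrFun h i
    simp only [Pi.add_apply, Pi.zero_apply] at this ⊢
    omega
  have h2 : (2 : K) ≠ 0 := two_ne_zero
  have h12 : (12 : K) ≠ 0 := by norm_num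
  obtain ⟨ζ, hζ, hl⟩ := exists_zeta (fun a b ↦ sl (v a) (v b) + W.a₁ / 2)
    (fun ha hb hab ↦ by rw [sl_comm (n0 ha) (n0 hb) (n1 hab)])
    (fun ha hb hab ↦ by
      rw [map_neg, map_neg, sl_neg_neg (n0 ha) (n0 hb) (n1 hab)]
      ring)
    (fun ha hb hab ↦ by rw [map_neg, map_add, sl_third (n0 ha) (n0 hb) (n1 hab)])
    (fun {a b c} ha hb hc hab hbc habc ↦ by
      have hd : -(v a + v b + v c) ≠ 0 := by
        rw [← map_add, ← map_add]
        exact neg_ne_zero.2 (n0 habc)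
      have h1 := sl_add_sl (n0 ha) (n0 hb) (n0 hc) hd (n1 hab) (n1 hbc) (add_neg_cancel _)
      have e1 : sl (v c) (-(v a + v b + v c)) = sl (v a + v b) (v c) := by
        have hcab : v c + (v a + v b) ≠ 0 := by
          rw [← map_add, ← map_add]
          exact n0 (by rwa [add_comm])
        rw [add_comm (v a + v b) (v c), sl_third (n0 hc) (n1 hab) hcab,
          sl_comm (n0 hc) (n1 hab) hcab]
      have e2 : sl (v a) (-(v a + v b + v c)) = sl (v a) (v b + v c) := by
        rw [add_assoc, sl_third (n0 ha) (n1 hbc)]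
        rw [← add_assoc]
        exact neg_ne_zero.1 hd
      rw [e1, e2] at h1
      rw [map_add, map_add]
      linear_combination h1)
  refine ⟨{
    X := fun a ↦ xc (v a) + W.b₂ / 12
    Y := fun a ↦ yc (v a) + (W.a₁ * xc (v a) + W.a₃) / 2
    ζ := ζ
    α := W.b₄ / 2 - W.b₂ ^ 2 / 48
    β := W.b₆ / 4 - W.b₂ ^ 3 / 1728 - (W.b₄ / 2 - W.b₂ ^ 2 / 48) * W.b₂ / 12
    curve := fun {a} ha ↦ ?_
    X_neg := fun a ↦ by rw [map_neg, xc_neg]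
    Y_neg := fun {a} ha ↦ ?_
    ζ_neg := hζ
    X_inj := fun {a b} ha hb h ↦ ?_
    Y_ne := fun {a} ha ↦ ?_
    slope_sq := fun {a b} ha hb hab ↦ ?_
    slope_mul := fun {a b} ha hb hab ↦ ?_
    slope_self := fun {a} ha ↦ ?_ }, fun _ ↦ rfl, fun _ ↦ rfl⟩
  · have h1 := (equation_iff ..).1 (equation_xc_yc (n0 ha))
    rw [WeierstrassCurve.b₂, WeierstrassCurve.b₄, WeierstrassCurve.b₆]
    linear_combination h1
  · rw [map_neg, xc_neg, yc_neg (n0 ha), negY]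
    ring
  · rcases eq_or_eq_neg_of_xc (n0 ha) (n0 hb) (add_right_cancel h) with h1 | h1
    · exact Or.inl (hv h1)
    · exact Or.inr (hv (by rw [h1, map_neg]))
  · intro h
    apply two_mul_yc_ne_zero (n0 ha) (n1 (two ha))
    linear_combination 2 * h
  · have h1 := sl_sq (n0 ha) (n0 hb) (n1 hab)
    rw [hl ha hb hab, map_add, WeierstrassCurve.b₂]
    linear_combination h1
  · have h1 := sl_mul (n0 ha) (n0 hb) (n1 hab)
    rw [hl ha hb hab]
    linear_combination -h1
  · have h1 := sl_self_mul (n0 ha) (n1 (two ha))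
    rw [hl ha ha (two ha), WeierstrassCurve.b₂, WeierstrassCurve.b₄]
    linear_combination h1

end Curve

/-! ### The values of the net polynomials -/

/-- An odd elliptic net on `ℤ` with `f 1 = 1` is the normalised elliptic divisibility sequence with
the same initial values. -/
theorem IsElliptic.eq_normEDS {K : Type*} [Field K] {f : ℤ → K} (hf : IsElliptic f)
    (hodd : ∀ m, f (-m) = -f m) (h1 : f 1 = 1) {b c d : K} (hb : b ≠ 0) (h2 : f 2 = b)
    (h3 : f 3 = c) (h4 : f 4 = d * b) (m : ℤ) : f m = normEDS b c d m := by
  have h0 := hf.1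
  have hev (m : ℤ) : f (2 * m) * b =
      f (m - 1) ^ 2 * f m * f (m + 2) - f (m - 2) * f m * f (m + 1) ^ 2 := by
    have h := hf.2 (m + 1) (m - 1) 1 0
    ring_nf at h ⊢
    rw [hodd, h1, h2] at h
    linear_combination h
  have hod (m : ℤ) : f (2 * m + 1) =
      f (m + 2) * f m ^ 3 - f (m - 1) * f (m + 1) ^ 3 := by
    have h := hf.2 (m + 1) m 1 0
    ring_nf at h ⊢
    rw [hodd, h1] at h
    linear_combination h
  have hnat (k : ℕ) : f k = normEDS b c d k := by
    induction k using normEDSRec with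
    | zero => simpa using h0
    | one => simpa using h1
    | two => simpa using h2
    | three => simpa using h3
    | four => simpa using h4
    | even m i1 i2 i3 i4 i5 =>
      apply mul_right_cancel₀ hb
      have e := hev (m + 3)
      have e' := normEDS_even b c d (m + 3)
      push_cast at i1 i2 i3 i4 i5 ⊢
      ring_nf at e e' i1 i2 i3 i4 i5 ⊢
      rw [e, e', i1, i2, i3, i4, i5]
    | odd m i1 i2 i3 i4 =>
      have e := hod (m + 2)
      have e' := normEDS_odd b c d (m + 2)
      push_cast at i1 i2 i3 i4 ⊢
      ring_nf at e e' i1 i2 i3 i4 ⊢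
      rw [e, e', i1, i2, i3, i4]
  rcases Int.eq_nat_or_neg m with ⟨k, rfl | rfl⟩
  · exact hnat k
  · rw [hodd, normEDS_neg, hnat]

section NetPoly

open WeierstrassCurve.Affine

variable {K : Type*} [Field K] [DecidableEq K] (E : WeierstrassCurve K) {n : ℕ}

/-- The duplication formulas in terms of the division polynomials of index `3` and `4`. -/
lemma division_three_four {P : E.toAffine.Point} (hP : P ≠ 0) (hPP : P + P ≠ 0) :
    (2 * yc P + E.a₁ * xc P + E.a₃) ^ 2 * (xc P - xc (P + P)) = E.Ψ₃.eval (xc P) ∧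
    (2 * yc (P + P) + E.a₁ * xc (P + P) + E.a₃) * (2 * yc P + E.a₁ * xc P + E.a₃) ^ 3 =
      E.preΨ₄.eval (xc P) := by
  have h1 := sl_sq hP hP hPP
  have h2 := sl_self_mul hP hPP
  have h3 := (equation_iff ..).1 (equation_xc_yc hP)
  have h4 := yc_neg_add_sub hP hP hPP
  rw [yc_neg hPP, negY] at h4
  have h5 : (2 * yc P + E.a₁ * xc P + E.a₃) ^ 2 =
      4 * xc P ^ 3 + E.b₂ * xc P ^ 2 + 2 * E.b₄ * xc P + E.b₆ := by
    rw [WeierstrassCurve.b₂, WeierstrassCurve.b₄, WeierstrassCurve.b₆]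
    linear_combination 4 * h3
  set x := xc P
  set y := yc P
  set s := sl P P
  have h6 : (2 * y + E.a₁ * x + E.a₃) ^ 2 * (x - xc (P + P)) = E.Ψ₃.eval x := by
    have : E.Ψ₃.eval x = 3 * x ^ 4 + E.b₂ * x ^ 3 + 3 * E.b₄ * x ^ 2 + 3 * E.b₆ * x + E.b₈ := by
      simp [WeierstrassCurve.Ψ₃]
    rw [this, WeierstrassCurve.b₂, WeierstrassCurve.b₄, WeierstrassCurve.b₆, WeierstrassCurve.b₈]
    linear_combination (2 * y + E.a₁ * x + E.a₃) ^ 2 * h1 - (s * (2 * y + E.a₁ * x + E.a₃) +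
      3 * x ^ 2 + 2 * E.a₂ * x + E.a₄ - E.a₁ * y + E.a₁ * (2 * y + E.a₁ * x + E.a₃)) * h2 +
      (12 * x + E.a₁ ^ 2 + 4 * E.a₂) * h3
  refine ⟨h6, ?_⟩
  have h7 : (2 * yc (P + P) + E.a₁ * xc (P + P) + E.a₃) * (2 * y + E.a₁ * x + E.a₃) ^ 3 =
      -((2 * y + E.a₁ * x + E.a₃) ^ 2) ^ 2 + (6 * x ^ 2 + E.b₂ * x + E.b₄) * E.Ψ₃.eval x := by
    rw [← h6, WeierstrassCurve.b₂, WeierstrassCurve.b₄]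
    linear_combination (-2 * (2 * y + E.a₁ * x + E.a₃) ^ 3) * h4 +
      2 * (2 * y + E.a₁ * x + E.a₃) ^ 2 * (x - xc (P + P)) * h2
  have : E.preΨ₄.eval x = 2 * x ^ 6 + E.b₂ * x ^ 5 + 5 * E.b₄ * x ^ 4 + 10 * E.b₆ * x ^ 3 +
      10 * E.b₈ * x ^ 2 + (E.b₂ * E.b₈ - E.b₄ * E.b₆) * x + (E.b₄ * E.b₈ - E.b₆ ^ 2) := by
    simp [WeierstrassCurve.preΨ₄]
  have h8 : E.Ψ₃.eval x = 3 * x ^ 4 + E.b₂ * x ^ 3 + 3 * E.b₄ * x ^ 2 + 3 * E.b₆ * x + E.b₈ := by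
    simp [WeierstrassCurve.Ψ₃]
  rw [h7, this, h5, h8]
  linear_combination (-x ^ 2) * E.b_relation

/-- The map `v ↦ v · P` as an additive homomorphism. -/
noncomputable def combHom (P : Fin n → E.toAffine.Point) : (Fin n → ℤ) →+ E.toAffine.Point :=
  (Fintype.linearCombination ℤ P).toAddMonoidHom

lemma combHom_apply (P : Fin n → E.toAffine.Point) (v : Fin n → ℤ) :
    combHom E P v = comb E P v := rfl

lemma combHom_single (P : Fin n → E.toAffine.Point) (i : Fin n) :
    combHom E P (Pi.single i 1) = P i := by
  rw [combHom_apply, comb, Finset.sum_eq_single i]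
  · rw [Pi.single_eq_same, one_smul]
  · intro j _ hj
    rw [Pi.single_eq_of_ne hj, zero_smul]
  · simp

lemma combHom_injective {P : Fin n → E.toAffine.Point} (hP : LinearIndependent ℤ P) :
    Function.Injective (combHom E P) :=
  hP.fintypeLinearCombination_injective

lemma single_add_single_ne_zero {i j : Fin n} (hij : i ≠ j) :
    (Pi.single i 1 + Pi.single j 1 : Fin n → ℤ) ≠ 0 := by
  intro h
  have := congrFun h i
  simp [hij] at this

lemma add_ne_zero_of_linearIndependent {P : Fin n → E.toAffine.Point}
    (hP : LinearIndependent ℤ P) {i j : Fin n} (hij : i ≠ j) : P i + P j ≠ 0 := by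
  have h := (map_ne_zero_iff _ (combHom_injective E hP)).2 (single_add_single_ne_zero hij)
  rwa [map_add, combHom_single, combHom_single] at h

variable {E} in
lemma IsNetPoly.single_one {P : Fin n → E.toAffine.Point}
    {Ψ : (Fin n → ℤ) → K} (h : IsNetPoly E P Ψ) {i : Fin n} (hi : P i ≠ 0) :
    Ψ (Pi.single i 1) = 1 := by
  obtain ⟨x, y, hxy, e⟩ := exists_eq_some hi
  rw [h.single i x y hxy e, WeierstrassCurve.ψ_one, Polynomial.evalEval_one]

variable [CharZero K]

/-- Net polynomials exist for linearly independent points: their values are those of a sigma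
function. -/
theorem exists_isNetPoly {P : Fin n → E.toAffine.Point} (hP : LinearIndependent ℤ P) :
    ∃ Ψ, IsNetPoly E P Ψ := by
  have hv := combHom_injective E hP
  obtain ⟨Z, hX, hY⟩ := exists_zetaSystem E.toAffine (combHom E P) hv
  obtain ⟨Ψ, hΨ, hΨ1, hΨ2⟩ := Z.exists_isSigma
  have n0 {a} (ha : a ≠ 0) : combHom E P a ≠ 0 := (map_ne_zero_iff _ hv).2 ha
  have e0 (i : Fin n) : (Pi.single i 1 : Fin n → ℤ) ≠ 0 := by
    simp
  have e2 (i : Fin n) : (Pi.single i 1 + Pi.single i 1 : Fin n → ℤ) ≠ 0 := by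
    rw [← Pi.single_add]
    simp
  refine ⟨Ψ, hΨ.isElliptic, ?_, hΨ2, ?_, ?_, ?_⟩
  · intro i x y h hi m
    have hf : IsElliptic (fun m : ℤ ↦ Ψ (Pi.single i m)) := by
      refine ⟨(congrArg Ψ (Pi.single_zero i)).trans hΨ.map_zero, fun p q r s ↦ ?_⟩
      have := hΨ.isElliptic.2 (Pi.single i p) (Pi.single i q) (Pi.single i r) (Pi.single i s)
      simpa only [Pi.single_add, Pi.single_sub] using this
    have hu := n0 (e0 i)
    have huu := n0 (e2 i)
    rw [map_add] at huu
    obtain ⟨h3, h4⟩ := division_three_four E hu huu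
    have hb := two_mul_yc_ne_zero hu huu
    have hYi : 2 * Z.Y (Pi.single i 1) = 2 * yc (combHom E P (Pi.single i 1)) +
        E.a₁ * xc (combHom E P (Pi.single i 1)) + E.a₃ := by
      rw [hY]
      ring
    have hY2 : 2 * Z.Y (Pi.single i 1 + Pi.single i 1) =
        2 * yc (combHom E P (Pi.single i 1) + combHom E P (Pi.single i 1)) +
        E.a₁ * xc (combHom E P (Pi.single i 1) + combHom E P (Pi.single i 1)) + E.a₃ := by
      rw [hY, map_add]
      ring
    have f2 := hΨ.double (e0 i)
    rw [hΨ1, hYi, one_pow, mul_one] at f2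
    have f3 := hΨ.add_mul_sub (e2 i) (e0 i)
    rw [add_sub_cancel_right, hΨ1, mul_one, one_pow, mul_one, hX, hX, f2, map_add,
      add_sub_add_right_eq_sub, h3] at f3
    have f4 := hΨ.double (e2 i)
    rw [hY2, f2] at f4
    rw [combHom_single, hi] at *
    have key := hf.eq_normEDS (b := 2 * y + E.a₁ * x + E.a₃) (c := E.Ψ₃.eval x)
      (d := E.preΨ₄.eval x) (fun m ↦ by rw [Pi.single_neg, hΨ.neg]) (hΨ1 i) hb
      (by simpa only [← Pi.single_add] using! f2)
      (by simpa only [← Pi.single_add] using! f3)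
      (by
        have e : (Pi.single i 4 : Fin n → ℤ) =
          Pi.single i 1 + Pi.single i 1 + (Pi.single i 1 + Pi.single i 1) := by
          simp only [← Pi.single_add]
          rfl
        change Ψ (Pi.single i 4) = _
        rw [e, f4]
        change _ = E.preΨ₄.eval (xc (.some x y h)) * _
        rw [← h4]
        simp only [yc, xc]
        ring) m
    rw [← Polynomial.coe_evalEvalRingHom, WeierstrassCurve.ψ, map_normEDS,
      Polynomial.coe_evalEvalRingHom, Polynomial.evalEval_C, Polynomial.evalEval_C,
      WeierstrassCurve.ψ₂, evalEval_polynomialY]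
    exact key
  · intro i j hij x y h x' y' h' hi hj
    have hi0 := n0 (e0 i)
    have hj0 := n0 (e0 j)
    have hij0 := n0 (single_add_single_ne_zero hij)
    rw [map_add] at hij0
    have h1 := hΨ.add_mul_sub (single_add_single_ne_zero hij) (e0 i)
    rw [add_sub_cancel_left, hΨ1, hΨ1, hΨ2 i j hij, hX, hX, map_add] at h1
    have e : (Pi.single i 2 + Pi.single j 1 : Fin n → ℤ) =
        Pi.single i 1 + Pi.single j 1 + Pi.single i 1 := by
      rw [add_right_comm, ← Pi.single_add]
      rfl
    have hx : xc (combHom E P (Pi.single i 1)) ≠ xc (combHom E P (Pi.single j 1)) := by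
      intro hx
      have h3 := congrFun (hv (eq_of_xc_eq hi0 hj0 hij0 hx)) i
      simp [hij] at h3
    have h2 := sl_sq hi0 hj0 hij0
    have h3 := sl_mul hi0 hj0 hij0
    rw [← eq_div_iff (sub_ne_zero.2 hx.symm)] at h3
    rw [h3] at h2
    rw [e]
    simp only [combHom_single, hi, hj] at h1 h2
    change ((y' - y) / (x' - x)) ^ 2 + E.a₁ * ((y' - y) / (x' - x)) - E.a₂ = x + x' + _ at h2
    change _ = 1 ^ 2 * 1 ^ 2 * (x + _ - _) at h1
    linear_combination h1 + h2
  · intro a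
    rw [← combHom_apply, map_eq_zero_iff _ hv]
    exact ⟨fun h ↦ by_contra fun ha ↦ hΨ.ne_zero ha h, fun h ↦ by rw [h, hΨ.map_zero]⟩
  · intro a b x y h x' y' h' ha hb
    rw [← combHom_apply] at ha hb
    have ha0 : a ≠ 0 := by
      rintro rfl
      rw [map_zero] at ha
      cases ha
    have hb0 : b ≠ 0 := by
      rintro rfl
      rw [map_zero] at hb
      cases hb
    have h1 := hΨ.add_mul_sub ha0 hb0
    rw [hX, hX, ha, hb] at h1
    change _ = Ψ a ^ 2 * Ψ b ^ 2 * (x' + _ - (x + _)) at h1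
    linear_combination h1

/-- For linearly independent points the family `netPoly` has the properties that define it. -/
theorem isNetPoly_netPoly {P : Fin n → E.toAffine.Point} (hP : LinearIndependent ℤ P) :
    IsNetPoly E P (netPoly E P) :=
  Classical.epsilon_spec (exists_isNetPoly E hP)

end NetPoly

/-! ### Local heights and the parallelogram law -/

section LocalHeight

variable {K Γ : Type*} [Field K] [LinearOrderedCommGroupWithZero Γ] (v : Valuation K Γ)

/-- The multiplicative local height `max(1, |x|)` of an element of a valued field. -/
def locHeight (x : K) : Γ := max 1 (v x)

variable {v}

lemma locHeight_ne_zero (x : K) : locHeight v x ≠ 0 :=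
  (zero_lt_one.trans_le (le_max_left _ _)).ne'

/-- The Gauss lemma for the polynomial with roots `x` and `y`. -/
lemma locHeight_mul_locHeight (x y : K) :
    locHeight v x * locHeight v y = max 1 (max (v (x + y)) (v (x * y))) := by
  unfold locHeight
  wlog h : v y ≤ v x generalizing x y
  · rw [mul_comm, this y x (le_of_not_ge h), add_comm y x, mul_comm y x]
  rcases le_or_gt (v x) 1 with hx | hx
  · have hy := h.trans hx
    have h1 : v (x + y) ≤ 1 := v.map_add_le hx hy
    have h2 : v (x * y) ≤ 1 := by
      rw [map_mul]
      exact mul_le_one' hx hy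
    rw [max_eq_left hx, max_eq_left hy, one_mul, max_eq_left (max_le h1 h2)]
  · have h1 : v (x + y) ≤ v x := v.map_add_le le_rfl h
    rw [max_eq_right hx.le]
    rcases le_or_gt (v y) 1 with hy | hy
    · have h2 : v (x + y) = v x := v.map_add_eq_of_lt_left (hy.trans_lt hx)
      have h3 : v (x * y) ≤ v x := by
        rw [map_mul]
        exact mul_le_of_le_one_right' hy
      rw [max_eq_left hy, mul_one, h2, max_eq_left h3, max_eq_right hx.le]
    · have h3 : v x ≤ v (x * y) := by
        rw [map_mul]
        exact le_mul_of_one_le_right' hy.le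
      rw [max_eq_right hy.le, max_eq_right (h1.trans h3), max_eq_right (hx.le.trans h3), map_mul]

/-- The maximum of the valuations of three elements with common factor `d` and unit content
otherwise. -/
lemma max_eq_of_mul {a b c d p q r : K} (ha : a = d * p) (hb : b = d * q) (hc : c = d * r)
    (hp : p ∈ v.integer) (hq : q ∈ v.integer) (hr : r ∈ v.integer)
    (h : v p = 1 ∨ v q = 1 ∨ v r = 1) : max (v a) (max (v b) (v c)) = v d := by
  rw [Valuation.mem_integer_iff] at hp hq hr
  subst ha hb hc
  rw [map_mul, map_mul, map_mul]
  apply le_antisymm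
  · exact max_le (mul_le_of_le_one_right' hp)
      (max_le (mul_le_of_le_one_right' hq) (mul_le_of_le_one_right' hr))
  · rcases h with h | h | h <;> rw [h] <;> simp

lemma map_eq_one_of_sub {x y : K} (hy : v y = 1) (h : v (x - y) < 1) : v x = 1 := by
  have := v.map_add_eq_of_lt_right (x := x - y) (y := y) (by rwa [hy])
  rw [← hy, ← this, sub_add_cancel]

lemma map_mul_lt_one {x y : K} (hx : v x < 1) (hy : y ∈ v.integer) : v (x * y) < 1 := by
  rw [map_mul]
  exact (mul_le_of_le_one_right' hy).trans_lt hx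

end LocalHeight

section Reduction

variable {K Γ : Type*} [Field K] [LinearOrderedCommGroupWithZero Γ]
  (v : Valuation K Γ) (E : WeierstrassCurve K)

/-- The coefficients of the Weierstrass equation are integral. -/
structure IntegralAt : Prop where
  a₁ : E.a₁ ∈ v.integer
  a₂ : E.a₂ ∈ v.integer
  a₃ : E.a₃ ∈ v.integer
  a₄ : E.a₄ ∈ v.integer
  a₆ : E.a₆ ∈ v.integer

/-- For an integral Weierstrass equation, the point with coordinates `x` and `y` has non-singular
reduction: it reduces to the point at infinity, or one of the partial derivatives is a unit. -/
def GoodAt (x y : K) : Prop :=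
  1 < v x ∨ v (E.toAffine.polynomialX.evalEval x y) = 1 ∨
    v (E.toAffine.polynomialY.evalEval x y) = 1

variable {v E}

lemma IntegralAt.b₂ (h : IntegralAt v E) : E.b₂ ∈ v.integer :=
  add_mem (pow_mem h.a₁ 2) (mul_mem (ofNat_mem _ 4) h.a₂)

lemma IntegralAt.b₄ (h : IntegralAt v E) : E.b₄ ∈ v.integer :=
  add_mem (mul_mem (ofNat_mem _ 2) h.a₄) (mul_mem h.a₁ h.a₃)

lemma IntegralAt.b₆ (h : IntegralAt v E) : E.b₆ ∈ v.integer :=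
  add_mem (pow_mem h.a₃ 2) (mul_mem (ofNat_mem _ 4) h.a₆)

lemma IntegralAt.b₈ (h : IntegralAt v E) : E.b₈ ∈ v.integer := by
  have h1 := h.a₁
  have h2 := h.a₂
  have h3 := h.a₃
  have h4 := h.a₄
  have h6 := h.a₆
  rw [WeierstrassCurve.b₈]
  repeat' first
    | assumption | exact ofNat_mem _ _ | apply add_mem | apply sub_mem | apply mul_mem
    | apply pow_mem

lemma IntegralAt.y_mem (h : IntegralAt v E) {x y : K} (hx : x ∈ v.integer)
    (hxy : E.toAffine.Equation x y) : y ∈ v.integer := by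
  have h1 := h.a₁
  have h2 := h.a₂
  have h3 := h.a₃
  have h4 := h.a₄
  have h6 := h.a₆
  have e := (WeierstrassCurve.Affine.equation_iff ..).1 hxy
  by_contra hy
  rw [Valuation.mem_integer_iff, not_le] at hy
  have hy0 : y ≠ 0 := by
    rintro rfl
    rw [map_zero] at hy
    exact not_lt_zero hy
  have hy' : v y⁻¹ < 1 := by
    rw [map_inv₀]
    exact inv_lt_one_of_one_lt₀ hy
  have hyi : y⁻¹ ∈ v.integer := hy'.le
  have h5 : (1 : K) = y⁻¹ * ((x ^ 3 + E.a₂ * x ^ 2 + E.a₄ * x + E.a₆) * y⁻¹ -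
      (E.a₁ * x + E.a₃)) := by
    field_simp
    linear_combination e
  have h7 := map_mul_lt_one hy'
    (show (x ^ 3 + E.a₂ * x ^ 2 + E.a₄ * x + E.a₆) * y⁻¹ - (E.a₁ * x + E.a₃) ∈ v.integer by
      repeat' first
        | assumption | apply add_mem | apply sub_mem | apply mul_mem | apply pow_mem)
  rw [← h5, map_one] at h7
  exact lt_irrefl _ h7

/-- At an integral point the duplication polynomials `ψ₂²` and `Φ₂` generate the unit ideal exactly
when the reduction is non-singular. With `q` and `p` the partial derivatives with respect to `y` and
`x`, the first is `q²`, and the second is congruent to `p²` modulo `q`. -/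
lemma IntegralAt.goodAt_iff (h : IntegralAt v E) {x y : K} (hx : x ∈ v.integer)
    (hxy : E.toAffine.Equation x y) :
    GoodAt v E x y ↔ v (4 * x ^ 3 + E.b₂ * x ^ 2 + 2 * E.b₄ * x + E.b₆) = 1 ∨
      v (x ^ 4 - E.b₄ * x ^ 2 - 2 * E.b₆ * x - E.b₈) = 1 := by
  have h1 := h.a₁
  have h2 := h.a₂
  have h3 := h.a₃
  have h4 := h.a₄
  have h6 := h.a₆
  have hy := h.y_mem hx hxy
  have e := (WeierstrassCurve.Affine.equation_iff ..).1 hxy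
  rw [GoodAt, WeierstrassCurve.Affine.evalEval_polynomialX,
    WeierstrassCurve.Affine.evalEval_polynomialY]
  obtain ⟨p, hp⟩ : ∃ p, E.a₁ * y - (3 * x ^ 2 + 2 * E.a₂ * x + E.a₄) = p := ⟨_, rfl⟩
  obtain ⟨q, hq⟩ : ∃ q, 2 * y + E.a₁ * x + E.a₃ = q := ⟨_, rfl⟩
  have e1 : 4 * x ^ 3 + E.b₂ * x ^ 2 + 2 * E.b₄ * x + E.b₆ = q ^ 2 := by
    rw [← hq, WeierstrassCurve.b₂, WeierstrassCurve.b₄, WeierstrassCurve.b₆]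
    linear_combination -4 * e
  have e2 : x ^ 4 - E.b₄ * x ^ 2 - 2 * E.b₆ * x - E.b₈ =
      p ^ 2 - q * (E.a₁ * p + (E.a₂ + 2 * x) * q) := by
    rw [← hp, ← hq, WeierstrassCurve.b₄, WeierstrassCurve.b₆, WeierstrassCurve.b₈]
    linear_combination (8 * x + 4 * E.a₂ + E.a₁ ^ 2) * e
  have hpi : p ∈ v.integer := by
    rw [← hp]
    repeat' first
      | assumption | exact ofNat_mem _ _ | apply add_mem | apply sub_mem | apply mul_mem
      | apply pow_mem
  have hqi : q ∈ v.integer := by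
    rw [← hq]
    repeat' first
      | assumption | exact ofNat_mem _ _ | apply add_mem | apply mul_mem
  have hri : E.a₁ * p + (E.a₂ + 2 * x) * q ∈ v.integer := by
    repeat' first
      | assumption | exact ofNat_mem _ _ | apply add_mem | apply mul_mem
  have hx' : ¬ 1 < v x := not_lt.2 hx
  rw [hp, hq, e1, e2, map_pow, pow_eq_one_iff_of_nonneg zero_le two_ne_zero, or_iff_right hx',
    or_comm]
  rcases (Valuation.mem_integer_iff _ _).1 hqi |>.lt_or_eq with hq1 | hq1
  · have h7 := map_mul_lt_one hq1 hri
    rw [or_iff_right hq1.ne, or_iff_right hq1.ne]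
    constructor
    · intro h8
      refine map_eq_one_of_sub (y := p ^ 2) (by rw [map_pow, h8, one_pow]) ?_
      rwa [sub_sub_cancel_left, Valuation.map_neg]
    · intro h8
      have h9 : v (p ^ 2) = 1 := map_eq_one_of_sub h8 (by rwa [sub_sub_cancel])
      rwa [map_pow, pow_eq_one_iff_of_nonneg zero_le two_ne_zero] at h9
  · exact ⟨fun _ ↦ Or.inl hq1, fun _ ↦ Or.inl hq1⟩

lemma inv_mem_of_one_lt {x : K} (hx : 1 < v x) : x ≠ 0 ∧ v x⁻¹ < 1 := by
  refine ⟨?_, ?_⟩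
  · rintro rfl
    rw [map_zero] at hx
    exact not_lt_zero hx
  · rw [map_inv₀]
    exact inv_lt_one_of_one_lt₀ hx

/-- The biquadratic forms that give the `x`-coordinates of `P + Q` and `P - Q` have maximum
`H(P)² H(Q)²` if `P` has non-singular reduction. Modulo `x - x'` the last two forms
are the duplication polynomials. A non-integral coordinate is replaced by its inverse. -/
lemma IntegralAt.max_biquadratic (h : IntegralAt v E) {x y x' : K}
    (hxy : E.toAffine.Equation x y) (hg : GoodAt v E x y) :
    max (v ((x - x') ^ 2))
      (max (v (2 * x ^ 2 * x' + 2 * x * x' ^ 2 + E.b₂ * x * x' + E.b₄ * (x + x') + E.b₆))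
        (v (x ^ 2 * x' ^ 2 - E.b₄ * x * x' - E.b₆ * (x + x') - E.b₈))) =
      locHeight v x ^ 2 * locHeight v x' ^ 2 := by
  have h2 := h.b₂
  have h4 := h.b₄
  have h6 := h.b₆
  have h8 := h.b₈
  unfold locHeight
  rcases le_or_gt (v x) 1 with hx | hx <;> rcases le_or_gt (v x') 1 with hx' | hx'
  · have hxi : x ∈ v.integer := hx
    have hxi' : x' ∈ v.integer := hx'
    rw [max_eq_left hx, max_eq_left hx', one_pow, one_mul, ← map_one v]
    have hd : x - x' ∈ v.integer := sub_mem hxi hxi'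
    refine max_eq_of_mul (one_mul _).symm (one_mul _).symm (one_mul _).symm (pow_mem hd 2) ?_ ?_ ?_
    · repeat' first
        | assumption | exact ofNat_mem _ _ | apply add_mem | apply sub_mem | apply mul_mem
        | apply pow_mem
    · repeat' first
        | assumption | apply add_mem | apply sub_mem | apply mul_mem | apply pow_mem
    · rcases (Valuation.mem_integer_iff _ _).1 hd |>.lt_or_eq with hd | hd
      · right
        refine ((h.goodAt_iff hxi hxy).1 hg).imp (fun h9 ↦ map_eq_one_of_sub h9 ?_)
          (fun h9 ↦ map_eq_one_of_sub h9 ?_)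
        · have e : 2 * x ^ 2 * x' + 2 * x * x' ^ 2 + E.b₂ * x * x' + E.b₄ * (x + x') + E.b₆ -
              (4 * x ^ 3 + E.b₂ * x ^ 2 + 2 * E.b₄ * x + E.b₆) =
              (x - x') * (-(2 * x * (2 * x + x') + E.b₂ * x + E.b₄)) := by
            ring
          rw [e]
          apply map_mul_lt_one hd
          repeat' first
            | assumption | exact ofNat_mem _ _ | apply neg_mem | apply add_mem | apply mul_mem
        · have e : x ^ 2 * x' ^ 2 - E.b₄ * x * x' - E.b₆ * (x + x') - E.b₈ -
              (x ^ 4 - E.b₄ * x ^ 2 - 2 * E.b₆ * x - E.b₈) =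
              (x - x') * (E.b₄ * x + E.b₆ - x ^ 2 * (x + x')) := by
            ring
          rw [e]
          apply map_mul_lt_one hd
          repeat' first
            | assumption | apply sub_mem | apply add_mem | apply mul_mem | apply pow_mem
      · left
        rw [map_pow, hd, one_pow]
  · obtain ⟨hx0, ht⟩ := inv_mem_of_one_lt hx'
    obtain ⟨t, rfl⟩ : ∃ t, x' = t⁻¹ := ⟨x'⁻¹, (inv_inv x').symm⟩
    rw [inv_inv] at ht
    have hxi : x ∈ v.integer := hx
    have hti : t ∈ v.integer := ht.le
    have ht0 : t ≠ 0 := inv_eq_zero.not.1 hx0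
    rw [max_eq_left hx, max_eq_right hx'.le, one_pow, one_mul, ← map_pow]
    refine max_eq_of_mul (p := (t * x - 1) ^ 2)
      (q := 2 * x ^ 2 * t + 2 * x + E.b₂ * x * t + E.b₄ * (x * t ^ 2 + t) + E.b₆ * t ^ 2)
      (r := x ^ 2 - E.b₄ * x * t - E.b₆ * (x * t ^ 2 + t) - E.b₈ * t ^ 2)
      (by field_simp) (by field_simp) (by field_simp) ?_ ?_ ?_ (Or.inl ?_)
    · exact pow_mem (sub_mem (mul_mem hti hxi) (one_mem _)) 2
    · repeat' first
        | assumption | exact ofNat_mem _ _ | apply add_mem | apply sub_mem | apply mul_mem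
        | apply pow_mem
    · repeat' first
        | assumption | apply add_mem | apply sub_mem | apply mul_mem | apply pow_mem
    · rw [map_pow, pow_eq_one_iff_of_nonneg zero_le two_ne_zero, ← v.map_neg]
      refine map_eq_one_of_sub v.map_one ?_
      rw [neg_sub, sub_sub_cancel_left, v.map_neg]
      exact map_mul_lt_one ht hxi
  · obtain ⟨hx0, ht⟩ := inv_mem_of_one_lt hx
    obtain ⟨t, rfl⟩ : ∃ t, x = t⁻¹ := ⟨x⁻¹, (inv_inv x).symm⟩
    rw [inv_inv] at ht
    have hxi : x' ∈ v.integer := hx'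
    have hti : t ∈ v.integer := ht.le
    have ht0 : t ≠ 0 := inv_eq_zero.not.1 hx0
    rw [max_eq_left hx', max_eq_right hx.le, one_pow, mul_one, ← map_pow]
    refine max_eq_of_mul (p := (1 - t * x') ^ 2)
      (q := 2 * x' + 2 * x' ^ 2 * t + E.b₂ * x' * t + E.b₄ * (t + x' * t ^ 2) + E.b₆ * t ^ 2)
      (r := x' ^ 2 - E.b₄ * x' * t - E.b₆ * (t + x' * t ^ 2) - E.b₈ * t ^ 2)
      (by field_simp) (by field_simp) (by field_simp) ?_ ?_ ?_ (Or.inl ?_)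
    · exact pow_mem (sub_mem (one_mem _) (mul_mem hti hxi)) 2
    · repeat' first
        | assumption | exact ofNat_mem _ _ | apply add_mem | apply sub_mem | apply mul_mem
        | apply pow_mem
    · repeat' first
        | assumption | apply add_mem | apply sub_mem | apply mul_mem | apply pow_mem
    · rw [map_pow, pow_eq_one_iff_of_nonneg zero_le two_ne_zero]
      refine map_eq_one_of_sub v.map_one ?_
      rw [sub_sub_cancel_left, v.map_neg]
      exact map_mul_lt_one ht hxi
  · obtain ⟨hx0, ht⟩ := inv_mem_of_one_lt hx
    obtain ⟨hx0', ht'⟩ := inv_mem_of_one_lt hx'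
    obtain ⟨t, rfl⟩ : ∃ t, x = t⁻¹ := ⟨x⁻¹, (inv_inv x).symm⟩
    obtain ⟨t', rfl⟩ : ∃ t, x' = t⁻¹ := ⟨x'⁻¹, (inv_inv x').symm⟩
    rw [inv_inv] at ht ht'
    have hti : t ∈ v.integer := ht.le
    have hti' : t' ∈ v.integer := ht'.le
    have ht0 : t ≠ 0 := inv_eq_zero.not.1 hx0
    have ht0' : t' ≠ 0 := inv_eq_zero.not.1 hx0'
    rw [max_eq_right hx'.le, max_eq_right hx.le, ← map_pow, ← map_pow, ← map_mul]
    refine max_eq_of_mul (p := (t' - t) ^ 2)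
      (q := 2 * t' + 2 * t + E.b₂ * t * t' + E.b₄ * (t' ^ 2 * t + t ^ 2 * t') +
        E.b₆ * t ^ 2 * t' ^ 2)
      (r := 1 - t * (E.b₄ * t' + E.b₆ * (t' ^ 2 + t * t') + E.b₈ * t * t' ^ 2))
      (by field_simp) (by field_simp) (by field_simp; ring) ?_ ?_ ?_ (Or.inr (Or.inr ?_))
    · exact pow_mem (sub_mem hti' hti) 2
    · repeat' first
        | assumption | exact ofNat_mem _ _ | apply add_mem | apply sub_mem | apply mul_mem
        | apply pow_mem
    · repeat' first
        | assumption | exact one_mem _ | apply add_mem | apply sub_mem | apply mul_mem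
        | apply pow_mem
    · refine map_eq_one_of_sub v.map_one ?_
      rw [sub_sub_cancel_left, v.map_neg]
      apply map_mul_lt_one ht
      repeat' first
        | assumption | apply add_mem | apply sub_mem | apply mul_mem | apply pow_mem

variable [DecidableEq K]

open WeierstrassCurve.Affine

/-- The duplication formula for the local height detects non-singular reduction. -/
theorem IntegralAt.locHeight_double_iff (h : IntegralAt v E) {P : E.toAffine.Point}
    (hP : P ≠ 0) (hPP : P + P ≠ 0) :
    locHeight v (xc (P + P)) * v (2 * yc P + E.a₁ * xc P + E.a₃) ^ 2 = locHeight v (xc P) ^ 4 ↔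
      GoodAt v E (xc P) (yc P) := by
  have hxy := equation_xc_yc hP
  have e := (equation_iff ..).1 hxy
  have e1 : (2 * yc P + E.a₁ * xc P + E.a₃) ^ 2 =
      4 * xc P ^ 3 + E.b₂ * xc P ^ 2 + 2 * E.b₄ * xc P + E.b₆ := by
    rw [WeierstrassCurve.b₂, WeierstrassCurve.b₄, WeierstrassCurve.b₆]
    linear_combination 4 * e
  have e2 := (division_three_four E hP hPP).1
  have e3 : E.Ψ₃.eval (xc P) = 3 * xc P ^ 4 + E.b₂ * xc P ^ 3 + 3 * E.b₄ * xc P ^ 2 +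
      3 * E.b₆ * xc P + E.b₈ := by
    simp [WeierstrassCurve.Ψ₃]
  rw [e3] at e2
  have e4 : (2 * yc P + E.a₁ * xc P + E.a₃) ^ 2 * xc (P + P) =
      xc P ^ 4 - E.b₄ * xc P ^ 2 - 2 * E.b₆ * xc P - E.b₈ := by
    linear_combination xc P * e1 - e2
  have e5 : locHeight v (xc (P + P)) * v (2 * yc P + E.a₁ * xc P + E.a₃) ^ 2 =
      max (v (4 * xc P ^ 3 + E.b₂ * xc P ^ 2 + 2 * E.b₄ * xc P + E.b₆))
        (v (xc P ^ 4 - E.b₄ * xc P ^ 2 - 2 * E.b₆ * xc P - E.b₈)) := by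
    rw [← e4, ← e1, map_mul, ← map_pow, locHeight, mul_comm, ← max_mul_mul_left, mul_one]
  have h2 := h.b₂
  have h4 := h.b₄
  have h6 := h.b₆
  have h8 := h.b₈
  rcases le_or_gt (v (xc P)) 1 with hx | hx
  · have hxi : xc P ∈ v.integer := hx
    have m1 : 4 * xc P ^ 3 + E.b₂ * xc P ^ 2 + 2 * E.b₄ * xc P + E.b₆ ∈ v.integer := by
      repeat' first
        | assumption | exact ofNat_mem _ _ | apply add_mem | apply mul_mem | apply pow_mem
    have m2 : xc P ^ 4 - E.b₄ * xc P ^ 2 - 2 * E.b₆ * xc P - E.b₈ ∈ v.integer := by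
      repeat' first
        | assumption | exact ofNat_mem _ _ | apply sub_mem | apply mul_mem | apply pow_mem
    rw [h.goodAt_iff hxi hxy, e5, locHeight, max_eq_left hx, one_pow]
    constructor
    · intro h9
      rcases max_choice (v (4 * xc P ^ 3 + E.b₂ * xc P ^ 2 + 2 * E.b₄ * xc P + E.b₆))
        (v (xc P ^ 4 - E.b₄ * xc P ^ 2 - 2 * E.b₆ * xc P - E.b₈)) with h | h
      · exact Or.inl (h ▸ h9)
      · exact Or.inr (h ▸ h9)
    · rintro (h9 | h9)
      · rw [h9, max_eq_left m2]
      · rw [h9, max_eq_right m1]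
  · refine ⟨fun _ ↦ Or.inl hx, fun hg ↦ ?_⟩
    have h9 := h.max_biquadratic (x' := xc P) hxy hg
    rw [sub_self, zero_pow two_ne_zero, map_zero, max_eq_right zero_le] at h9
    rw [e5, show locHeight v (xc P) ^ 4 = _ from pow_add _ 2 2, ← h9]
    congr 2
    · congr 1
      ring
    · ring

variable [CharZero K]

/-- The sum and the product of the `x`-coordinates of `P + Q` and `P - Q`. -/
lemma xc_add_xc_sub {P Q : E.toAffine.Point} (hP : P ≠ 0) (hQ : Q ≠ 0) (h1 : P + Q ≠ 0)
    (h2 : P - Q ≠ 0) :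
    (xc P - xc Q) ^ 2 * (xc (P + Q) + xc (P - Q)) =
      2 * xc P ^ 2 * xc Q + 2 * xc P * xc Q ^ 2 + E.b₂ * xc P * xc Q + E.b₄ * (xc P + xc Q) +
        E.b₆ ∧
    (xc P - xc Q) ^ 2 * (xc (P + Q) * xc (P - Q)) =
      xc P ^ 2 * xc Q ^ 2 - E.b₄ * xc P * xc Q - E.b₆ * (xc P + xc Q) - E.b₈ := by
  have hQ' : -Q ≠ 0 := neg_ne_zero.2 hQ
  have hx : xc P - xc Q ≠ 0 := by
    intro h
    rcases eq_or_eq_neg_of_xc hP hQ (sub_eq_zero.1 h) with h | h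
    · exact h2 (by rw [h, sub_self])
    · exact h1 (by rw [h, neg_add_cancel])
  have h2' : P + -Q ≠ 0 := by rwa [← sub_eq_add_neg]
  have s1 := sl_sq hP hQ h1
  have s2 := sl_sq hP hQ' h2'
  have m1 := sl_mul hP hQ h1
  have m2 := sl_mul hP hQ' h2'
  rw [xc_neg, yc_neg hQ, negY] at m2
  rw [xc_neg, ← sub_eq_add_neg] at s2
  have eP := (equation_iff ..).1 (equation_xc_yc hP)
  have eQ := (equation_iff ..).1 (equation_xc_yc hQ)
  have b8 := E.b_relation
  generalize sl P Q = l at *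
  generalize sl P (-Q) = l' at *
  generalize xc (P + Q) = x3 at *
  generalize xc (P - Q) = x4 at *
  generalize xc P = x1 at *
  generalize xc Q = x2 at *
  generalize yc P = y1 at *
  generalize yc Q = y2 at *
  -- completing the square
  obtain ⟨Y1, hY1⟩ : ∃ Y, y1 = Y - (E.a₁ * x1 + E.a₃) / 2 := ⟨_, (add_sub_cancel_right _ _).symm⟩
  obtain ⟨Y2, hY2⟩ : ∃ Y, y2 = Y - (E.a₁ * x2 + E.a₃) / 2 := ⟨_, (add_sub_cancel_right _ _).symm⟩
  subst hY1 hY2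
  have f1 : Y1 ^ 2 = x1 ^ 3 + E.b₂ / 4 * x1 ^ 2 + E.b₄ / 2 * x1 + E.b₆ / 4 := by
    rw [WeierstrassCurve.b₂, WeierstrassCurve.b₄, WeierstrassCurve.b₆]
    linear_combination eP
  have f2 : Y2 ^ 2 = x2 ^ 3 + E.b₂ / 4 * x2 ^ 2 + E.b₄ / 2 * x2 + E.b₆ / 4 := by
    rw [WeierstrassCurve.b₂, WeierstrassCurve.b₄, WeierstrassCurve.b₆]
    linear_combination eQ
  have g1 : (x1 - x2) ^ 2 * x3 = (Y1 - Y2) ^ 2 - (E.b₂ / 4 + x1 + x2) * (x1 - x2) ^ 2 := by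
    have : (l + E.a₁ / 2) * (x2 - x1) = Y2 - Y1 := by linear_combination m1
    rw [← neg_sub Y2, ← this, WeierstrassCurve.b₂]
    linear_combination -(x1 - x2) ^ 2 * s1
  have g2 : (x1 - x2) ^ 2 * x4 = (Y1 + Y2) ^ 2 - (E.b₂ / 4 + x1 + x2) * (x1 - x2) ^ 2 := by
    have : (l' + E.a₁ / 2) * (x2 - x1) = -(Y2 + Y1) := by linear_combination m2
    rw [add_comm Y1, ← neg_sq (Y2 + Y1), ← this, WeierstrassCurve.b₂]
    linear_combination -(x1 - x2) ^ 2 * s2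
  constructor
  · linear_combination g1 + g2 + 2 * f1 + 2 * f2
  · apply mul_left_cancel₀ (pow_ne_zero 2 hx)
    have : (x1 - x2) ^ 2 * ((x1 - x2) ^ 2 * (x3 * x4)) =
        (Y1 ^ 2 - Y2 ^ 2) ^ 2 - 2 * (Y1 ^ 2 + Y2 ^ 2) * (E.b₂ / 4 + x1 + x2) * (x1 - x2) ^ 2 +
          (E.b₂ / 4 + x1 + x2) ^ 2 * (x1 - x2) ^ 4 := by
      linear_combination (x1 - x2) ^ 2 * x4 * g1 +
        ((Y1 - Y2) ^ 2 - (E.b₂ / 4 + x1 + x2) * (x1 - x2) ^ 2) * g2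
    rw [this, f1, f2]
    linear_combination ((x1 - x2) ^ 2 / 4) * b8

/-- The parallelogram law for the local height, if one of the points has non-singular
reduction. -/
theorem IntegralAt.locHeight_parallelogram (h : IntegralAt v E) {P Q : E.toAffine.Point}
    (hP : P ≠ 0) (hQ : Q ≠ 0) (h1 : P + Q ≠ 0) (h2 : P - Q ≠ 0)
    (hg : GoodAt v E (xc P) (yc P)) :
    locHeight v (xc (P + Q)) * locHeight v (xc (P - Q)) * v (xc P - xc Q) ^ 2 =
      locHeight v (xc P) ^ 2 * locHeight v (xc Q) ^ 2 := by
  obtain ⟨e1, e2⟩ := xc_add_xc_sub hP hQ h1 h2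
  rw [← h.max_biquadratic (equation_xc_yc hP) hg, ← e1, ← e2, locHeight_mul_locHeight,
    v.map_mul (_ ^ 2), v.map_mul (_ ^ 2), max_mul_mul_left, ← map_pow]
  nth_rewrite 2 [← mul_one (v ((xc P - xc Q) ^ 2))]
  rw [max_mul_mul_left, mul_comm]

end Reduction

/-! ### Quadratic functions on `ℤⁿ` -/

section Quadratic

variable {n : ℕ}

lemma mem_of_single_mem {S : AddSubgroup (Fin n → ℤ)} (h : ∀ i, Pi.single i 1 ∈ S)
    (v : Fin n → ℤ) : v ∈ S := by
  rw [pi_eq_sum_univ' v]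
  refine sum_mem fun i _ ↦ S.zsmul_mem ?_ _
  convert h i using 1

/-- The parallelogram law holds everywhere if it holds for translations by basis vectors, and for
every translation `u` with `f (2 u) = 4 f u`: if it holds for `a` and `b`, then `f (2 (a + b))` can
be computed, and it holds for `a + b`. -/
theorem parallelogram_of_basis {f : (Fin n → ℤ) → ℤ}
    (hdouble : ∀ u, f (u + u) = 4 * f u → ∀ w, f (w + u) + f (w - u) = 2 * f w + 2 * f u)
    (h0 : f 0 = 0)
    (hbasis : ∀ i w, f (w + Pi.single i 1) + f (w - Pi.single i 1) =
      2 * f w + 2 * f (Pi.single i 1)) (u w : Fin n → ℤ) :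
    f (w + u) + f (w - u) = 2 * f w + 2 * f u := by
  let S : AddSubgroup (Fin n → ℤ) :=
    { carrier := {u | ∀ w, f (w + u) + f (w - u) = 2 * f w + 2 * f u}
      zero_mem' := fun w ↦ by
        rw [add_zero, sub_zero, h0]
        ring
      add_mem' := fun {a b} ha hb ↦ by
        apply hdouble
        have h1 := hb (a + a + b)
        have h2 := ha (a + b)
        have h3 := ha a
        rw [sub_self, h0] at h3
        rw [add_sub_cancel_right] at h1
        rw [add_sub_cancel_left] at h2
        rw [show a + b + (a + b) = a + a + b + b by abel]
        rw [show a + b + a = a + a + b by abel] at h2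
        linarith
      neg_mem' := fun {a} ha w ↦ by
        have h1 := ha 0
        rw [zero_add, zero_sub, h0] at h1
        have h2 := ha w
        rw [sub_neg_eq_add, ← sub_eq_add_neg]
        linarith }
  exact mem_of_single_mem (S := S) hbasis u w

/-- A function with the parallelogram law that vanishes at all `eᵢ` and `eᵢ + eⱼ` is zero. -/
theorem eq_zero_of_parallelogram {d : (Fin n → ℤ) → ℤ}
    (h : ∀ u w, d (w + u) + d (w - u) = 2 * d w + 2 * d u) (h1 : ∀ i, d (Pi.single i 1) = 0)
    (h2 : ∀ i j, i ≠ j → d (Pi.single i 1 + Pi.single j 1) = 0) (v : Fin n → ℤ) : d v = 0 := by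
  have h0 : d 0 = 0 := by
    have := h 0 0
    rw [add_zero, sub_zero] at this
    linarith
  have hdb (x) : d (x + x) = 4 * d x := by
    have := h x x
    rw [sub_self, h0] at this
    linarith
  -- the parallelogram law implies the identity of polarization
  have h3 (x y z) : d (x + y + z) + d x + d y + d z = d (x + y) + d (x + z) + d (y + z) := by
    have e1 := h z (x + y)
    have e2 := h y (x - z)
    have e3 := h (y + z) x
    have e4 := h z x
    rw [show x - z + y = x + y - z by abel, show x - z - y = x - (y + z) by abel] at e2
    rw [← add_assoc] at e3
    linarith
  -- the elements orthogonal to `y`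
  let S (y : Fin n → ℤ) : AddSubgroup (Fin n → ℤ) :=
    { carrier := {x | d (x + y) = d x + d y}
      zero_mem' := by
        change d (0 + y) = d 0 + d y
        rw [zero_add, h0, zero_add]
      add_mem' := fun {a b} ha hb ↦ by
        change d (a + b + y) = d (a + b) + d y
        have := h3 a b y
        change d (a + y) = d a + d y at ha
        change d (b + y) = d b + d y at hb
        linarith
      neg_mem' := fun {a} ha ↦ by
        change d (-a + y) = d (-a) + d y
        change d (a + y) = d a + d y at ha
        have e1 := h a y
        have e2 := h a 0
        rw [zero_add, zero_sub, h0] at e2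
        rw [neg_add_eq_sub]
        rw [add_comm y a] at e1
        linarith }
  have hS (i) (x) : x ∈ S (Pi.single i 1) := by
    refine mem_of_single_mem (fun j ↦ ?_) x
    change d (Pi.single j 1 + Pi.single i 1) = d (Pi.single j 1) + d (Pi.single i 1)
    rw [h1, h1]
    by_cases hij : j = i
    · rw [hij, hdb, h1]
      rfl
    · rw [h2 j i hij]
      rfl
  have h4 : d (v + v) = d v + d v :=
    mem_of_single_mem (S := S v) (fun i ↦ by
      change d (Pi.single i 1 + v) = d (Pi.single i 1) + d v
      rw [add_comm, add_comm (d _)]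
      exact hS i v) v
  have := hdb v
  linarith

lemma sum_single_mul_single (c : Fin n → Fin n → ℤ) (k l : Fin n) :
    ∑ i, ∑ j with i ≤ j, (Pi.single k 1 : Fin n → ℤ) i * (Pi.single l 1 : Fin n → ℤ) j * c i j =
      if k ≤ l then c k l else 0 := by
  simp only [Finset.sum_filter, Pi.single_apply]
  rw [Finset.sum_eq_single k, Finset.sum_eq_single l]
  · simp
  · intro j _ hj
    simp [hj]
  · simp
  · intro i _ hi
    simp [hi]
  · simp

/-- A function with the parallelogram law is a quadratic form with integral coefficients. -/
theorem eq_sum_of_parallelogram {f : (Fin n → ℤ) → ℤ} {c : Fin n → Fin n → ℤ}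
    (h : ∀ u w, f (w + u) + f (w - u) = 2 * f w + 2 * f u) (h1 : ∀ i, f (Pi.single i 1) = c i i)
    (h2 : ∀ i j, i < j → f (Pi.single i 1 + Pi.single j 1) = c i i + c j j + c i j)
    (v : Fin n → ℤ) : f v = ∑ i, ∑ j with i ≤ j, v i * v j * c i j := by
  let q (v : Fin n → ℤ) : ℤ := ∑ i, ∑ j with i ≤ j, v i * v j * c i j
  have q1 (i) : q (Pi.single i 1) = c i i := by
    simp only [q]
    rw [sum_single_mul_single, if_pos le_rfl]
  have q2 (i j) (hij : i < j) : q (Pi.single i 1 + Pi.single j 1) = c i i + c j j + c i j := by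
    have e : q (Pi.single i 1 + Pi.single j 1) = q (Pi.single i 1) + q (Pi.single j 1) +
        ∑ k, ∑ l with k ≤ l, (Pi.single i 1 : Fin n → ℤ) k * (Pi.single j 1 : Fin n → ℤ) l * c k l +
        ∑ k, ∑ l with k ≤ l,
          (Pi.single j 1 : Fin n → ℤ) k * (Pi.single i 1 : Fin n → ℤ) l * c k l := by
      simp only [q, ← Finset.sum_add_distrib]
      refine Finset.sum_congr rfl fun k _ ↦ Finset.sum_congr rfl fun l _ ↦ ?_
      simp only [Pi.add_apply]
      ring
    rw [e, q1, q1, sum_single_mul_single, sum_single_mul_single, if_pos hij.le,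
      if_neg (not_le.2 hij), add_zero]
  have key := eq_zero_of_parallelogram (d := fun v ↦ f v - q v) (fun u w ↦ ?_) (fun i ↦ ?_)
    (fun i j hij ↦ ?_) v
  · exact sub_eq_zero.1 key
  · have e : q (w + u) + q (w - u) = 2 * q w + 2 * q u := by
      simp only [q, Finset.mul_sum, ← Finset.sum_add_distrib]
      refine Finset.sum_congr rfl fun k _ ↦ Finset.sum_congr rfl fun l _ ↦ ?_
      simp only [Pi.add_apply, Pi.sub_apply]
      ring
    linarith [h u w]
  · rw [h1, q1, sub_self]
  · rcases lt_or_gt_of_ne hij with hij | hij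
    · rw [h2 i j hij, q2 i j hij, sub_self]
    · rw [add_comm, h2 j i hij, q2 j i hij, sub_self]

lemma IsQuadForm.finset_prod {A M ι : Type*} [AddCommGroup A] [CommMonoid M] (s : Finset ι)
    {F : ι → A → M} (hF : ∀ i ∈ s, IsQuadForm (F i)) : IsQuadForm fun v ↦ ∏ i ∈ s, F i v := by
  constructor
  · intro x y z
    simp only [← Finset.prod_mul_distrib]
    exact Finset.prod_congr rfl fun i hi ↦ (hF i hi).1 x y z
  · intro x y
    simp only [← Finset.prod_mul_distrib, ← Finset.prod_pow]
    exact Finset.prod_congr rfl fun i hi ↦ (hF i hi).2 x y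

theorem isQuadForm_prodForm {M : Type*} [CommGroupWithZero M] {c : Fin n → Fin n → M}
    (hc : ∀ i j, i ≤ j → c i j ≠ 0) : IsQuadForm (prodForm c) := by
  refine IsQuadForm.finset_prod _ fun i _ ↦ IsQuadForm.finset_prod _ fun j hj ↦ ?_
  have h := hc i j (Finset.mem_filter.1 hj).2
  constructor
  · intro x y z
    simp only [← zpow_add₀ h, Pi.add_apply]
    congr 1
    ring
  · intro x y
    simp only [← zpow_add₀ h, ← zpow_natCast, ← zpow_mul, Pi.add_apply, Pi.sub_apply]
    congr 1
    push_cast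
    ring

lemma prodForm_ne_zero {M : Type*} [CommGroupWithZero M] {c : Fin n → Fin n → M}
    (hc : ∀ i j, i ≤ j → c i j ≠ 0) (v : Fin n → ℤ) : prodForm c v ≠ 0 :=
  Finset.prod_ne_zero_iff.2 fun i _ ↦ Finset.prod_ne_zero_iff.2 fun j hj ↦
    zpow_ne_zero _ (hc i j (Finset.mem_filter.1 hj).2)

end Quadratic

/-! ### The local height of the net -/

section NetHeight

open WeierstrassCurve.Affine
open scoped WithZero

/-- Elliptic nets with values in an integral domain are odd functions. -/
lemma IsElliptic.neg {A R : Type*} [AddCommGroup A] [CommRing R] [IsDomain R] {Ψ : A → R}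
    (h : IsElliptic Ψ) (a : A) : Ψ (-a) = -Ψ a := by
  have key (a) (ha : Ψ a ≠ 0) : Ψ (-a) = -Ψ a := by
    have h1 := h.2 a a 0 0
    simp only [add_zero, zero_add, sub_self, sub_zero, zero_sub, h.1, mul_zero] at h1
    apply mul_left_cancel₀ (pow_ne_zero 3 ha)
    linear_combination h1
  by_cases ha : Ψ a = 0
  · by_contra h1
    have h2 : Ψ (-a) ≠ 0 := fun h3 ↦ h1 (by rw [h3, ha, neg_zero])
    have h3 := key _ h2
    rw [neg_neg, ha, eq_comm, neg_eq_zero] at h3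
    exact h2 h3
  · exact key a ha

/-- The square of `Ψ (2 u) / Ψ (u) ^ 4` is determined by the `x`-coordinates of the multiples of
`u`. It is found from the values of `Ψ` at `2u`, …, `5u`. -/
lemma sq_mul_sub_of_add_mul_sub {K : Type*} [Field K] {n : ℕ} {Ψ x : (Fin n → ℤ) → K}
    (hne : ∀ {a}, a ≠ 0 → Ψ a ≠ 0)
    (h : ∀ {a b}, a ≠ 0 → b ≠ 0 → Ψ (a + b) * Ψ (a - b) = Ψ a ^ 2 * Ψ b ^ 2 * (x b - x a))
    {u : Fin n → ℤ} (hu : u ≠ 0) :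
    Ψ ((2 : ℤ) • u) ^ 2 * (x ((2 : ℤ) • u) - x ((3 : ℤ) • u)) =
      Ψ u ^ 8 * ((x u - x ((2 : ℤ) • u)) * (x u - x ((3 : ℤ) • u)) ^ 2 *
        (x u - x ((4 : ℤ) • u))) ∧ x ((2 : ℤ) • u) - x ((3 : ℤ) • u) ≠ 0 := by
  have hk (k : ℤ) (hk : k ≠ 0) : k • u ≠ 0 := smul_ne_zero hk hu
  have h1 := h (hk 2 (by norm_num)) hu
  have h2 := h (hk 3 (by norm_num)) hu
  have h3 := h (hk 3 (by norm_num)) (hk 2 (by norm_num))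
  have h4 := h (hk 4 (by norm_num)) hu
  have e5 : (4 : ℤ) • u + u = (5 : ℤ) • u := by module
  have e4 : (3 : ℤ) • u + u = (4 : ℤ) • u := by module
  have e3 : (2 : ℤ) • u + u = (3 : ℤ) • u := by module
  have d2 : (3 : ℤ) • u - u = (2 : ℤ) • u := by module
  have d1 : (2 : ℤ) • u - u = u := by module
  have d3 : (4 : ℤ) • u - u = (3 : ℤ) • u := by module
  have e5' : (3 : ℤ) • u + (2 : ℤ) • u = (5 : ℤ) • u := by module
  have d1' : (3 : ℤ) • u - (2 : ℤ) • u = u := by module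
  rw [e3, d1] at h1
  rw [e4, d2] at h2
  rw [e5', d1'] at h3
  rw [e5, d3] at h4
  have p1 := hne hu
  have p2 := hne (hk 2 (by norm_num))
  have p3 := hne (hk 3 (by norm_num))
  have p5 := hne (hk 5 (by norm_num))
  have h1' : Ψ ((3 : ℤ) • u) = Ψ ((2 : ℤ) • u) ^ 2 * Ψ u * (x u - x ((2 : ℤ) • u)) := by
    apply mul_right_cancel₀ p1
    linear_combination h1
  refine ⟨?_, fun h0 ↦ ?_⟩
  · apply mul_left_cancel₀ (mul_ne_zero (pow_ne_zero 2 p2) (pow_ne_zero 3 p3))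
    linear_combination (-Ψ ((2 : ℤ) • u) ^ 2 * Ψ ((3 : ℤ) • u)) * h3 +
      Ψ ((2 : ℤ) • u) ^ 2 * Ψ u * h4 + Ψ u ^ 3 * (x u - x ((4 : ℤ) • u)) *
      (Ψ ((4 : ℤ) • u) * Ψ ((2 : ℤ) • u) +
        Ψ ((3 : ℤ) • u) ^ 2 * Ψ u ^ 2 * (x u - x ((3 : ℤ) • u))) * h2 +
      Ψ u ^ 7 * Ψ ((3 : ℤ) • u) ^ 3 * (x u - x ((3 : ℤ) • u)) ^ 2 *
        (x u - x ((4 : ℤ) • u)) * h1'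
  · rw [h0, mul_zero] at h3
    exact mul_ne_zero p5 p1 h3

variable {K : Type*} [Field K] [DecidableEq K] {E : WeierstrassCurve K} {n : ℕ}
  {P : Fin n → E.toAffine.Point} {Ψ : (Fin n → ℤ) → K}

lemma IsNetPoly.ne_zero (h : IsNetPoly E P Ψ) (hP : LinearIndependent ℤ P) {a : Fin n → ℤ}
    (ha : a ≠ 0) : Ψ a ≠ 0 := by
  rw [Ne, h.eq_zero_iff, ← combHom_apply, map_eq_zero_iff _ (combHom_injective E hP)]
  exact ha

lemma IsNetPoly.add_mul_sub (h : IsNetPoly E P Ψ) (hP : LinearIndependent ℤ P) {a b : Fin n → ℤ}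
    (ha : a ≠ 0) (hb : b ≠ 0) :
    Ψ (a + b) * Ψ (a - b) =
      Ψ a ^ 2 * Ψ b ^ 2 * (xc (combHom E P b) - xc (combHom E P a)) := by
  have hv := combHom_injective E hP
  obtain ⟨x, y, hxy, ha'⟩ := exists_eq_some ((map_ne_zero_iff _ hv).2 ha)
  obtain ⟨x', y', hxy', hb'⟩ := exists_eq_some ((map_ne_zero_iff _ hv).2 hb)
  have h1 := h.x_sub_x a b x y hxy x' y' hxy' ha' hb'
  rw [ha', hb']
  change _ = _ * (x' - x)
  linear_combination h1

/-- The multiplicative local height of `a · P`, normalized by the net polynomial. At `a = 0` the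
value is `0` and carries no information. -/
noncomputable def netHeight (v : Valuation K ℤᵐ⁰) (E : WeierstrassCurve K)
    (P : Fin n → E.toAffine.Point) (Ψ : (Fin n → ℤ) → K) (a : Fin n → ℤ) : ℤᵐ⁰ :=
  locHeight v (xc (combHom E P a)) * v (Ψ a) ^ 2

variable {v : Valuation K ℤᵐ⁰}

lemma netHeight_ne_zero (h : IsNetPoly E P Ψ) (hP : LinearIndependent ℤ P) {a : Fin n → ℤ}
    (ha : a ≠ 0) : netHeight v E P Ψ a ≠ 0 :=
  mul_ne_zero (locHeight_ne_zero _) (pow_ne_zero 2 (v.ne_zero_iff.2 (h.ne_zero hP ha)))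

lemma netHeight_neg (h : IsNetPoly E P Ψ) (a : Fin n → ℤ) :
    netHeight v E P Ψ (-a) = netHeight v E P Ψ a := by
  rw [netHeight, netHeight, map_neg, xc_neg, h.isElliptic.neg, v.map_neg]

/-- The logarithmic height of the net, with the value `0` at `0`. -/
noncomputable def logHeight (v : Valuation K ℤᵐ⁰) (E : WeierstrassCurve K)
    (P : Fin n → E.toAffine.Point) (Ψ : (Fin n → ℤ) → K) (a : Fin n → ℤ) : ℤ :=
  open Classical in if a = 0 then 0 else WithZero.log (netHeight v E P Ψ a)

lemma logHeight_zero : logHeight v E P Ψ 0 = 0 := if_pos rfl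

lemma logHeight_of_ne {a : Fin n → ℤ} (ha : a ≠ 0) :
    logHeight v E P Ψ a = WithZero.log (netHeight v E P Ψ a) := if_neg ha

lemma logHeight_neg (h : IsNetPoly E P Ψ) (a : Fin n → ℤ) :
    logHeight v E P Ψ (-a) = logHeight v E P Ψ a := by
  simp only [logHeight, neg_eq_zero, netHeight_neg h]

variable [CharZero K]

/-- The duplication formula, up to sign. It is not part of `IsNetPoly`, except at the basis
vectors. -/
lemma IsNetPoly.sq_double (h : IsNetPoly E P Ψ) (hP : LinearIndependent ℤ P) {a : Fin n → ℤ}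
    (ha : a ≠ 0) :
    Ψ (a + a) ^ 2 = (2 * yc (combHom E P a) + E.a₁ * xc (combHom E P a) + E.a₃) ^ 2 *
      Ψ a ^ 8 := by
  -- the sigma function of the zeta system satisfies the same relations and the duplication formula
  obtain ⟨Z, hX, hY⟩ := exists_zetaSystem E.toAffine (combHom E P) (combHom_injective E hP)
  obtain ⟨Ψ', hΨ', -⟩ := Z.exists_isSigma
  obtain ⟨h1, h2⟩ := sq_mul_sub_of_add_mul_sub (Ψ := Ψ) (x := fun a ↦ xc (combHom E P a))
    (h.ne_zero hP) (h.add_mul_sub hP) ha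
  obtain ⟨h3, -⟩ := sq_mul_sub_of_add_mul_sub (Ψ := Ψ') (x := Z.X)
    hΨ'.ne_zero hΨ'.add_mul_sub ha
  have h4 := hΨ'.double ha
  rw [← two_zsmul] at h4 ⊢
  simp only [hX, add_sub_add_right_eq_sub] at h3
  rw [h4, hY] at h3
  have h5 : (2 * yc (combHom E P a) + E.a₁ * xc (combHom E P a) + E.a₃) ^ 2 *
      (xc (combHom E P ((2 : ℤ) • a)) - xc (combHom E P ((3 : ℤ) • a))) =
      ((xc (combHom E P a) - xc (combHom E P ((2 : ℤ) • a))) *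
        (xc (combHom E P a) - xc (combHom E P ((3 : ℤ) • a))) ^ 2 *
        (xc (combHom E P a) - xc (combHom E P ((4 : ℤ) • a)))) := by
    apply mul_left_cancel₀ (pow_ne_zero 8 (hΨ'.ne_zero ha))
    linear_combination h3
  apply mul_right_cancel₀ h2
  linear_combination h1 - Ψ a ^ 8 * h5

lemma add_self_ne_zero {a : Fin n → ℤ} (ha : a ≠ 0) : a + a ≠ 0 := by
  rw [← two_zsmul]
  exact smul_ne_zero two_ne_zero ha

lemma netHeight_double_iff (hE : IntegralAt v E) (h : IsNetPoly E P Ψ)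
    (hP : LinearIndependent ℤ P) {a : Fin n → ℤ} (ha : a ≠ 0) :
    netHeight v E P Ψ (a + a) = netHeight v E P Ψ a ^ 4 ↔
      GoodAt v E (xc (combHom E P a)) (yc (combHom E P a)) := by
  have hv := combHom_injective E hP
  have h1 := (map_ne_zero_iff _ hv).2 (add_self_ne_zero ha)
  rw [map_add] at h1
  rw [← hE.locHeight_double_iff ((map_ne_zero_iff _ hv).2 ha) h1, netHeight, netHeight, ← map_pow,
    h.sq_double hP ha, map_add, map_mul, map_pow, map_pow, mul_pow, ← mul_assoc, ← pow_mul]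
  exact mul_left_inj' (pow_ne_zero 8 (v.ne_zero_iff.2 (h.ne_zero hP ha)))

lemma netHeight_parallelogram (hE : IntegralAt v E) (h : IsNetPoly E P Ψ)
    (hP : LinearIndependent ℤ P) {a b : Fin n → ℤ} (ha : a ≠ 0) (hb : b ≠ 0) (hab : a + b ≠ 0)
    (hab' : a - b ≠ 0) (hg : GoodAt v E (xc (combHom E P a)) (yc (combHom E P a))) :
    netHeight v E P Ψ (a + b) * netHeight v E P Ψ (a - b) =
      netHeight v E P Ψ a ^ 2 * netHeight v E P Ψ b ^ 2 := by
  have n0 {a} (ha : a ≠ 0) := (map_ne_zero_iff _ (combHom_injective E hP)).2 ha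
  have h1 := hE.locHeight_parallelogram (n0 ha) (n0 hb) (by rw [← map_add]; exact n0 hab)
    (by rw [← map_sub]; exact n0 hab') hg
  have h2 : v (Ψ (a + b)) * v (Ψ (a - b)) =
      v (Ψ a) ^ 2 * v (Ψ b) ^ 2 * v (xc (combHom E P a) - xc (combHom E P b)) := by
    rw [← map_mul, h.add_mul_sub hP ha hb, map_mul, map_mul, map_pow, map_pow, v.map_sub_swap]
  rw [← map_add, ← map_sub] at h1
  simp only [netHeight]
  calc _ = locHeight v (xc (combHom E P (a + b))) * locHeight v (xc (combHom E P (a - b))) *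
        (v (Ψ (a + b)) * v (Ψ (a - b))) ^ 2 := by
        rw [mul_pow]
        ac_rfl
    _ = (locHeight v (xc (combHom E P (a + b))) * locHeight v (xc (combHom E P (a - b))) *
        v (xc (combHom E P a) - xc (combHom E P b)) ^ 2) * (v (Ψ a) ^ 2 * v (Ψ b) ^ 2) ^ 2 := by
        rw [h2, mul_pow _ (v (_ - _))]
        ac_rfl
    _ = _ := by
        rw [h1, mul_pow, mul_pow (locHeight _ _), mul_pow (locHeight _ _), mul_mul_mul_comm]

lemma logHeight_double_iff (hE : IntegralAt v E) (h : IsNetPoly E P Ψ)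
    (hP : LinearIndependent ℤ P) {a : Fin n → ℤ} (ha : a ≠ 0) :
    logHeight v E P Ψ (a + a) = 4 * logHeight v E P Ψ a ↔
      GoodAt v E (xc (combHom E P a)) (yc (combHom E P a)) := by
  have h1 := netHeight_ne_zero (v := v) h hP ha
  have h2 := netHeight_ne_zero (v := v) h hP (add_self_ne_zero ha)
  have h3 : (netHeight v E P Ψ a ^ 4).log = 4 * (netHeight v E P Ψ a).log := by
    rw [WithZero.log_pow, nsmul_eq_mul]
    rfl
  rw [← netHeight_double_iff hE h hP ha, logHeight_of_ne ha, logHeight_of_ne (add_self_ne_zero ha),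
    ← h3, ← WithZero.exp_inj, WithZero.exp_log h2, WithZero.exp_log (pow_ne_zero 4 h1)]

/-- The parallelogram law for the logarithmic height and a point of good reduction. -/
lemma logHeight_parallelogram_of_goodAt (hE : IntegralAt v E) (h : IsNetPoly E P Ψ)
    (hP : LinearIndependent ℤ P) {a : Fin n → ℤ} (ha : a ≠ 0)
    (hg : GoodAt v E (xc (combHom E P a)) (yc (combHom E P a))) (b : Fin n → ℤ) :
    logHeight v E P Ψ (b + a) + logHeight v E P Ψ (b - a) =
      2 * logHeight v E P Ψ b + 2 * logHeight v E P Ψ a := by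
  have h2 := (logHeight_double_iff hE h hP ha).2 hg
  by_cases hb : b = 0
  · rw [hb, zero_add, zero_sub, logHeight_neg h, logHeight_zero]
    ring
  by_cases hab : a + b = 0
  · obtain rfl := eq_neg_of_add_eq_zero_right hab
    rw [← neg_add', neg_add_cancel, logHeight_neg h, logHeight_neg h, logHeight_zero, h2]
    ring
  by_cases hab' : a - b = 0
  · obtain rfl := sub_eq_zero.1 hab'
    rw [sub_self, logHeight_zero, h2]
    ring
  have h3 := congrArg WithZero.log (netHeight_parallelogram hE h hP ha hb hab hab' hg)
  rw [WithZero.log_mul (netHeight_ne_zero h hP hab) (netHeight_ne_zero h hP hab'),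
    WithZero.log_mul (pow_ne_zero 2 (netHeight_ne_zero h hP ha))
      (pow_ne_zero 2 (netHeight_ne_zero h hP hb)), WithZero.log_pow, WithZero.log_pow,
    ← logHeight_of_ne ha, ← logHeight_of_ne hb, ← logHeight_of_ne hab, ← logHeight_of_ne hab'] at h3
  rw [add_comm b a, ← neg_sub a b, logHeight_neg h, h3]
  simp only [nsmul_eq_mul, Nat.cast_ofNat]
  ring

/-- If the given points have good reduction, then the logarithmic height of the net is a quadratic
function. -/
theorem logHeight_parallelogram (hE : IntegralAt v E) (h : IsNetPoly E P Ψ)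
    (hP : LinearIndependent ℤ P) (hg : ∀ i, GoodAt v E (xc (P i)) (yc (P i)))
    (a b : Fin n → ℤ) :
    logHeight v E P Ψ (b + a) + logHeight v E P Ψ (b - a) =
      2 * logHeight v E P Ψ b + 2 * logHeight v E P Ψ a := by
  refine parallelogram_of_basis (fun a ha ↦ ?_) logHeight_zero (fun i ↦ ?_) a b
  · by_cases ha0 : a = 0
    · intro w
      rw [ha0, add_zero, sub_zero, logHeight_zero]
      ring
    · exact logHeight_parallelogram_of_goodAt hE h hP ha0
        ((logHeight_double_iff hE h hP ha0).1 ha)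
  · refine logHeight_parallelogram_of_goodAt hE h hP (by simp) ?_
    rw [combHom_single]
    exact hg i

end NetHeight

/-! ### Fractional ideals and their exponents -/

section Fractional

open IsDedekindDomain FractionalIdeal

variable {R K : Type*} [CommRing R] [IsDedekindDomain R] [Field K] [Algebra R K]
  [IsFractionRing R K]

lemma count_spanSingleton (𝔭 : HeightOneSpectrum R) {x : K} (hx : x ≠ 0) :
    count K 𝔭 (spanSingleton R⁰ x) = -WithZero.log (𝔭.valuation K x) := by
  obtain ⟨n, d, rfl⟩ := IsLocalization.exists_mk'_eq R⁰ x
  have hn : n ≠ 0 := by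
    rintro rfl
    exact hx (IsLocalization.mk'_zero _)
  have hd := nonZeroDivisors.coe_ne_zero d
  have e : spanSingleton R⁰ (IsLocalization.mk' K n d) =
      spanSingleton R⁰ (algebraMap R K d)⁻¹ *
        ((Ideal.span {n} : Ideal R) : FractionalIdeal R⁰ K) := by
    rw [coeIdeal_span_singleton, spanSingleton_mul_spanSingleton, IsFractionRing.mk'_eq_div,
      div_eq_inv_mul]
  rw [count_well_defined K 𝔭 (spanSingleton_ne_zero_iff.2 hx) e, HeightOneSpectrum.valuation_of_mk',
    HeightOneSpectrum.intValuation_if_neg _ hn, HeightOneSpectrum.intValuation_if_neg _ hd,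
    ← WithZero.exp_sub, WithZero.log_exp]
  ring

lemma le_one_of_count_nonneg {I : FractionalIdeal R⁰ K} (hI : I ≠ 0)
    (h : ∀ 𝔭 : HeightOneSpectrum R, 0 ≤ count K 𝔭 I) : I ≤ 1 := by
  rw [← finprod_heightOneSpectrum_factorization' (K := K) hI]
  refine finprod_induction (p := (· ≤ 1)) le_rfl (fun _ _ h1 h2 ↦ mul_le_one' h1 h2) fun 𝔭 ↦ ?_
  obtain ⟨m, hm⟩ := Int.eq_ofNat_of_zero_le (h 𝔭)
  rw [hm, zpow_natCast]
  exact pow_le_one' coeIdeal_le_one m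

lemma le_of_count_le {I J : FractionalIdeal R⁰ K} (hI : I ≠ 0) (hJ : J ≠ 0)
    (h : ∀ 𝔭 : HeightOneSpectrum R, count K 𝔭 J ≤ count K 𝔭 I) : I ≤ J := by
  have h1 : J⁻¹ * I ≤ 1 := le_one_of_count_nonneg (mul_ne_zero (inv_ne_zero hJ) hI) fun 𝔭 ↦ by
    rw [count_mul K 𝔭 (inv_ne_zero hJ) hI, count_inv]
    linarith [h 𝔭]
  calc I = J * (J⁻¹ * I) := (mul_inv_cancel_left₀ hJ I).symm
    _ ≤ J * 1 := mul_le_mul_right h1 J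
    _ = J := mul_one J

lemma eq_of_count_eq {I J : FractionalIdeal R⁰ K} (hI : I ≠ 0) (hJ : J ≠ 0)
    (h : ∀ 𝔭 : HeightOneSpectrum R, count K 𝔭 I = count K 𝔭 J) : I = J :=
  le_antisymm (le_of_count_le hI hJ fun 𝔭 ↦ (h 𝔭).ge) (le_of_count_le hJ hI fun 𝔭 ↦ (h 𝔭).le)

lemma spanSingleton_zpow (x : K) (m : ℤ) :
    spanSingleton R⁰ (x ^ m) = spanSingleton R⁰ x ^ m := by
  cases m with
  | ofNat m => simp only [Int.ofNat_eq_natCast, zpow_natCast, spanSingleton_pow]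
  | negSucc m => simp only [zpow_negSucc, spanSingleton_pow, spanSingleton_inv]

lemma spanSingleton_prodForm {n : ℕ} (α : Fin n → Fin n → K) (v : Fin n → ℤ) :
    spanSingleton R⁰ (prodForm α v) = prodForm (fun i j ↦ spanSingleton R⁰ (α i j)) v := by
  let φ : K →* FractionalIdeal R⁰ K :=
    { toFun := spanSingleton R⁰
      map_one' := spanSingleton_one
      map_mul' := fun x y ↦ (spanSingleton_mul_spanSingleton x y).symm }
  change φ _ = _
  simp only [prodForm, map_prod]
  refine Finset.prod_congr rfl fun i _ ↦ Finset.prod_congr rfl fun j _ ↦ spanSingleton_zpow _ _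

lemma count_prodForm (𝔭 : HeightOneSpectrum R) {n : ℕ} {c : Fin n → Fin n → FractionalIdeal R⁰ K}
    (hc : ∀ i j, i ≤ j → c i j ≠ 0) (v : Fin n → ℤ) :
    count K 𝔭 (prodForm c v) = ∑ i, ∑ j with i ≤ j, v i * v j * count K 𝔭 (c i j) := by
  have h (i) : ∀ j ∈ Finset.univ.filter (i ≤ ·), c i j ^ (v i * v j) ≠ 0 := fun j hj ↦
    zpow_ne_zero _ (hc i j (Finset.mem_filter.1 hj).2)
  rw [prodForm, count_prod K 𝔭 _ _ fun i _ ↦ Finset.prod_ne_zero_iff.2 (h i)]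
  refine Finset.sum_congr rfl fun i _ ↦ ?_
  rw [count_prod K 𝔭 _ _ (h i)]
  exact Finset.sum_congr rfl fun j _ ↦ count_zpow K 𝔭 _ _

end Fractional

/-! ### The denominator ideal -/

section Denominator

open IsDedekindDomain FractionalIdeal

variable {K : Type*} [Field K] [NumberField K]

lemma isIntegral_iff_valuation_le_one (z : K) :
    IsIntegral ℤ z ↔ ∀ 𝔭 : HeightOneSpectrum (𝓞 K), 𝔭.valuation K z ≤ 1 := by
  constructor
  · intro h 𝔭
    exact 𝔭.valuation_le_one (⟨z, h⟩ : 𝓞 K)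
  · intro h
    obtain ⟨a, rfl⟩ := HeightOneSpectrum.mem_integers_of_valuation_le_one K z h
    exact a.isIntegral_coe

/-- For integral `a`, the element `a² x` is integral at `𝔭` exactly when `|a|² max(1, |x|) ≤ 1`. -/
lemma mem_denIdeal_iff {x : K} {a : 𝓞 K} (ha : a ≠ 0) :
    a ∈ denIdeal x ↔ ∀ 𝔭 : HeightOneSpectrum (𝓞 K),
      WithZero.log (locHeight (𝔭.valuation K) x) ≤
        2 * count K 𝔭 (spanSingleton (𝓞 K)⁰ (a : K)) := by
  have ha' : (a : K) ≠ 0 := by simpa using ha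
  change IsIntegral ℤ ((a : K) ^ 2 * x) ↔ _
  rw [isIntegral_iff_valuation_le_one]
  refine forall_congr' fun 𝔭 ↦ ?_
  have h0 : 𝔭.valuation K (a : K) ≠ 0 := (Valuation.ne_zero_iff _).2 ha'
  have h1 : 𝔭.valuation K (a : K) ^ 2 ≤ 1 := pow_le_one' (𝔭.valuation_le_one a) 2
  have h2 : 𝔭.valuation K ((a : K) ^ 2 * x) ≤ 1 ↔
      𝔭.valuation K (a : K) ^ 2 * locHeight (𝔭.valuation K) x ≤ 1 := by
    rw [locHeight, ← max_mul_mul_left, mul_one, max_le_iff, map_mul, map_pow]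
    exact ⟨fun h ↦ ⟨h1, h⟩, fun h ↦ h.2⟩
  rw [h2, ← WithZero.log_le_log (mul_ne_zero (pow_ne_zero 2 h0) (locHeight_ne_zero x)) one_ne_zero,
    WithZero.log_mul (pow_ne_zero 2 h0) (locHeight_ne_zero x), WithZero.log_pow, WithZero.log_one,
    count_spanSingleton 𝔭 ha', nsmul_eq_mul]
  constructor <;> intro h <;> push_cast at * <;> linarith

/-- If the denominator of `x` is a square at all primes, then the exponents of `denIdeal x` are
half the logarithmic local heights. -/
theorem count_denIdeal {x : K}
    (hx : ∀ 𝔭 : HeightOneSpectrum (𝓞 K), Even (WithZero.log (locHeight (𝔭.valuation K) x))) :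
    (denIdeal x : FractionalIdeal (𝓞 K)⁰ K) ≠ 0 ∧ ∀ 𝔭 : HeightOneSpectrum (𝓞 K),
      2 * count K 𝔭 (denIdeal x : FractionalIdeal (𝓞 K)⁰ K) =
        WithZero.log (locHeight (𝔭.valuation K) x) := by
  choose m hm using hx
  have hm0 (𝔮) : 0 ≤ m 𝔮 := by
    have h1 := (WithZero.log_le_log one_ne_zero (locHeight_ne_zero x)).2
      (le_max_left 1 (𝔮.valuation K x))
    rw [WithZero.log_one, ← locHeight, hm] at h1
    omega
  have hfin : ∀ᶠ 𝔮 : HeightOneSpectrum (𝓞 K) in Filter.cofinite, m 𝔮 = 0 := by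
    by_cases hx0 : x = 0
    · refine Filter.Eventually.of_forall fun 𝔮 ↦ ?_
      have := hm 𝔮
      rw [locHeight, hx0, map_zero, max_eq_left zero_le, WithZero.log_one] at this
      omega
    · filter_upwards [finite_factors (spanSingleton (𝓞 K)⁰ x)] with 𝔮 h
      rw [count_spanSingleton 𝔮 hx0, neg_eq_zero] at h
      have h0 : 𝔮.valuation K x = 1 := by
        rw [← WithZero.exp_log (((𝔮.valuation K).ne_zero_iff).2 hx0), h, WithZero.exp_zero]
      have := hm 𝔮
      rw [locHeight, h0, max_self, WithZero.log_one] at this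
      omega
  -- the ideal with the expected factorization
  let D : FractionalIdeal (𝓞 K)⁰ K :=
    ∏ᶠ 𝔮 : HeightOneSpectrum (𝓞 K), (𝔮.asIdeal : FractionalIdeal (𝓞 K)⁰ K) ^ m 𝔮
  have hD (𝔮) : count K 𝔮 D = m 𝔮 := count_finprod K 𝔮 m hfin
  have hD0 : D ≠ 0 := by
    refine finprod_induction (p := (· ≠ 0)) one_ne_zero (fun _ _ ↦ mul_ne_zero) fun 𝔮 ↦ ?_
    exact zpow_ne_zero _ (coeIdeal_ne_zero.2 𝔮.ne_bot)
  have hD1 : D ≤ 1 := le_one_of_count_nonneg hD0 fun 𝔮 ↦ by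
    rw [hD]
    exact hm0 𝔮
  have hmem (a : 𝓞 K) : a ∈ denIdeal x ↔ (a : K) ∈ D := by
    by_cases ha : a = 0
    · rw [ha, show ((0 : 𝓞 K) : K) = 0 from map_zero _]
      exact ⟨fun _ ↦ (D : Submodule (𝓞 K) K).zero_mem, fun _ ↦ zero_mem _⟩
    have ha' : spanSingleton (𝓞 K)⁰ (a : K) ≠ 0 := spanSingleton_ne_zero_iff.2 (by simpa using ha)
    rw [mem_denIdeal_iff ha, ← spanSingleton_le_iff_mem]
    constructor
    · intro h
      refine le_of_count_le ha' hD0 fun 𝔮 ↦ ?_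
      have := h 𝔮
      rw [hm] at this
      rw [hD]
      omega
    · intro h 𝔮
      have := count_mono K 𝔮 ha' h
      rw [hD] at this
      rw [hm]
      omega
  have key : (denIdeal x : FractionalIdeal (𝓞 K)⁰ K) = D := by
    ext z
    rw [mem_coeIdeal]
    constructor
    · rintro ⟨a, ha, rfl⟩
      exact (hmem a).1 ha
    · intro hz
      obtain ⟨a, rfl⟩ := (mem_one_iff _).1 (hD1 hz)
      exact ⟨a, (hmem a).2 hz, rfl⟩
  rw [key]
  refine ⟨hD0, fun 𝔭 ↦ ?_⟩
  rw [hD, hm, two_mul]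

/-- At a point whose `x`-coordinate is not integral, `v(y)² = v(x)³`, so `v(x)` is a square. -/
lemma IntegralAt.even_log_locHeight {F : Type*} [Field F]
    {v : Valuation F (WithZero (Multiplicative ℤ))}
    {E : WeierstrassCurve F} (h : IntegralAt v E) {x y : F} (hxy : E.toAffine.Equation x y) :
    Even (WithZero.log (locHeight v x)) := by
  rcases le_or_gt (v x) 1 with hx | hx
  · rw [locHeight, max_eq_left hx, WithZero.log_one]
    exact Even.zero
  obtain ⟨hx0, ht⟩ := inv_mem_of_one_lt hx
  have e := (WeierstrassCurve.Affine.equation_iff ..).1 hxy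
  have hxv : v x ≠ 0 := (Valuation.ne_zero_iff _).2 hx0
  have h1 : y * (y + (E.a₁ * x + E.a₃)) =
      x ^ 3 * (1 + x⁻¹ * (E.a₂ + E.a₄ * x⁻¹ + E.a₆ * x⁻¹ ^ 2)) := by
    field_simp
    linear_combination e
  have h2 : v (1 + x⁻¹ * (E.a₂ + E.a₄ * x⁻¹ + E.a₆ * x⁻¹ ^ 2)) = 1 := by
    refine map_eq_one_of_sub v.map_one ?_
    rw [add_sub_cancel_left]
    have hti : x⁻¹ ∈ v.integer := ht.le
    exact map_mul_lt_one ht (add_mem (add_mem h.a₂ (mul_mem h.a₄ hti))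
      (mul_mem h.a₆ (pow_mem hti 2)))
  have h3 : v y * v (y + (E.a₁ * x + E.a₃)) = v x ^ 3 := by
    rw [← map_mul, h1, map_mul, h2, mul_one, map_pow]
  have h4 : v (E.a₁ * x + E.a₃) ≤ v x := by
    refine v.map_add_le ?_ ((show v E.a₃ ≤ 1 from h.a₃).trans hx.le)
    rw [map_mul]
    exact mul_le_of_le_one_left' h.a₁
  have h5 : v x < v y := by
    by_contra h5
    rw [not_lt] at h5
    have h6 : v x ^ 3 ≤ v x ^ 2 := by
      rw [← h3, pow_two]
      exact mul_le_mul' h5 (v.map_add_le h5 h4)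
    rw [pow_succ] at h6
    have h7 := mul_lt_mul_of_pos_left hx (zero_lt_iff.2 (pow_ne_zero 2 hxv))
    rw [mul_one] at h7
    exact absurd h6 (not_le.2 h7)
  have hyv : v y ≠ 0 := (zero_le.trans_lt h5).ne'
  rw [v.map_add_eq_of_lt_left (h4.trans_lt h5)] at h3
  have h6 := congrArg WithZero.log h3
  rw [WithZero.log_mul hyv hyv, WithZero.log_pow, nsmul_eq_mul] at h6
  push_cast at h6
  rw [locHeight, max_eq_right hx.le, Int.even_iff]
  omega

end Denominator

/-! ### The ideals of the net -/

section Twist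

variable {A K : Type*} [AddCommGroup A] [Field K]

/-- Multiplication by a quadratic form preserves Stange's recurrence: it multiplies the three terms
by the same factor. -/
theorem IsElliptic.quadForm_mul {W G : A → K} (hW : IsElliptic W) (hG : IsQuadForm G)
    (hG0 : ∀ a, G a ≠ 0) : IsElliptic fun a ↦ G a * W a := by
  refine ⟨by simp only [hW.1, mul_zero], fun p q r s ↦ ?_⟩
  have key (p q r) : G s * (G (p + q + s) * G (p - q) * G (r + s) * G r) =
      G p * G q * G r * (G (p + s) * G (q + s) * G (r + s)) := by
    apply mul_left_cancel₀ (mul_ne_zero (mul_ne_zero (hG0 p) (hG0 q)) (hG0 (p + q)))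
    linear_combination (G (p - q) * G (r + s) * G r * G (p + q)) * hG.1 p q s +
      (G (p + q) * G (p + s) * G (q + s) * G (r + s) * G r) * hG.2 p q
  apply mul_left_cancel₀ (hG0 s)
  linear_combination (W (p + q + s) * W (p - q) * W (r + s) * W r) * key p q r +
    (W (q + r + s) * W (q - r) * W (p + s) * W p) * key q r p +
    (W (r + p + s) * W (r - p) * W (q + s) * W q) * key r p q +
    G p * G q * G r * (G (p + s) * G (q + s) * G (r + s)) * hW.2 p q r s

end Twist

section Main

open IsDedekindDomain FractionalIdeal

variable {K : Type*} [Field K] [NumberField K]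

lemma integralAt_baseChange (W : WeierstrassCurve (𝓞 K)) (𝔭 : HeightOneSpectrum (𝓞 K)) :
    IntegralAt (𝔭.valuation K) (W.baseChange K) :=
  ⟨𝔭.valuation_le_one _, 𝔭.valuation_le_one _, 𝔭.valuation_le_one _, 𝔭.valuation_le_one _,
    𝔭.valuation_le_one _⟩

variable (W : WeierstrassCurve (𝓞 K))

/-- The denominator ideal of a point is nonzero, and its exponents are half the logarithmic
heights. -/
lemma count_den {P : (W.baseChange K).toAffine.Point} (hP : P ≠ 0) :
    den (W.baseChange K) P ≠ 0 ∧ ∀ 𝔭 : HeightOneSpectrum (𝓞 K),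
      2 * count K 𝔭 (den (W.baseChange K) P) =
        WithZero.log (locHeight (𝔭.valuation K) (xc P)) := by
  obtain ⟨x, y, h, rfl⟩ := exists_eq_some hP
  exact count_denIdeal fun 𝔮 ↦ (integralAt_baseChange W 𝔮).even_log_locHeight h.1

lemma goodAt_of_nonsingularMod {𝔭 : HeightOneSpectrum (𝓞 K)}
    {P : (W.baseChange K).toAffine.Point} (hP : P ≠ 0)
    (h : NonsingularMod (W.baseChange K) 𝔭 P) :
    GoodAt (𝔭.valuation K) (W.baseChange K) (xc P) (yc P) := by
  obtain ⟨x, y, hxy, rfl⟩ := exists_eq_some hP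
  exact h

variable [DecidableEq K] {W} {n : ℕ} {P : Fin n → (W.baseChange K).toAffine.Point}

lemma formIdeal_ne_zero (hP : LinearIndependent ℤ P) (i j : Fin n) :
    formIdeal (W.baseChange K) P i j ≠ 0 := by
  have h (i) : den (W.baseChange K) (P i) ≠ 0 := (count_den W (hP.ne_zero i)).1
  rw [formIdeal]
  split_ifs with hij
  · exact h i
  · refine mul_ne_zero (mul_ne_zero (count_den W ?_).1 (inv_ne_zero (h i))) (inv_ne_zero (h j))
    exact add_ne_zero_of_linearIndependent _ hP hij

lemma idealForm_ne_zero (hP : LinearIndependent ℤ P) (v : Fin n → ℤ) :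
    idealForm (W.baseChange K) P v ≠ 0 :=
  prodForm_ne_zero (fun i j _ ↦ formIdeal_ne_zero hP i j) v

lemma logHeight_eq_count {Ψ : (Fin n → ℤ) → K} (h : IsNetPoly (W.baseChange K) P Ψ)
    (hP : LinearIndependent ℤ P) (𝔭 : HeightOneSpectrum (𝓞 K)) {v : Fin n → ℤ} (hv : v ≠ 0) :
    logHeight (𝔭.valuation K) (W.baseChange K) P Ψ v =
      2 * (count K 𝔭 (den (W.baseChange K) (comb (W.baseChange K) P v)) -
        count K 𝔭 (spanSingleton (𝓞 K)⁰ (Ψ v))) := by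
  have h1 : combHom (W.baseChange K) P v ≠ 0 :=
    (map_ne_zero_iff _ (combHom_injective _ hP)).2 hv
  have h2 := h.ne_zero hP hv
  rw [logHeight_of_ne hv, netHeight, WithZero.log_mul (locHeight_ne_zero _)
    (pow_ne_zero 2 ((𝔭.valuation K).ne_zero_iff.2 h2)), ← (count_den W h1).2 𝔭,
    count_spanSingleton 𝔭 h2, WithZero.log_pow, nsmul_eq_mul, combHom_apply]
  push_cast
  ring

/-- The exponents of the denominator of `v · P` and of the ideal of the net agree at a prime of
non-singular reduction of the points. -/
theorem count_den_comb (hP : LinearIndependent ℤ P) {𝔭 : HeightOneSpectrum (𝓞 K)}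
    (hg : ∀ i, NonsingularMod (W.baseChange K) 𝔭 (P i)) {v : Fin n → ℤ} (hv : v ≠ 0) :
    count K 𝔭 (den (W.baseChange K) (comb (W.baseChange K) P v)) =
      count K 𝔭 (netIdeal (W.baseChange K) P v) := by
  have h := isNetPoly_netPoly (W.baseChange K) hP
  have hpar := logHeight_parallelogram (integralAt_baseChange W 𝔭) h hP
    fun i ↦ goodAt_of_nonsingularMod W (hP.ne_zero i) (hg i)
  have e0 (i : Fin n) : (Pi.single i 1 : Fin n → ℤ) ≠ 0 := by
    simp
  have hd (i) : den (W.baseChange K) (P i) ≠ 0 := (count_den W (hP.ne_zero i)).1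
  have key := eq_sum_of_parallelogram (c := fun i j ↦
    2 * count K 𝔭 (formIdeal (W.baseChange K) P i j)) hpar (fun i ↦ ?_) (fun i j hij ↦ ?_) v
  · rw [logHeight_eq_count h hP 𝔭 hv] at key
    have e1 := count_prodForm 𝔭 (fun i j _ ↦ formIdeal_ne_zero hP i j) v
    have e2 : ∑ i, ∑ j with i ≤ j, v i * v j *
        (2 * count K 𝔭 (formIdeal (W.baseChange K) P i j)) =
        2 * count K 𝔭 (idealForm (W.baseChange K) P v) := by
      rw [idealForm, e1, Finset.mul_sum]
      refine Finset.sum_congr rfl fun i _ ↦ ?_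
      rw [Finset.mul_sum]
      refine Finset.sum_congr rfl fun j _ ↦ ?_
      ring
    rw [e2] at key
    rw [netIdeal, count_mul K 𝔭 (idealForm_ne_zero hP v)
      (spanSingleton_ne_zero_iff.2 (h.ne_zero hP hv))]
    linarith
  · rw [logHeight_eq_count h hP 𝔭 (e0 i), h.single_one (hP.ne_zero i), spanSingleton_one,
      count_one, sub_zero, ← combHom_apply, combHom_single, formIdeal, if_pos rfl]
  · have hij0 : (Pi.single i 1 + Pi.single j 1 : Fin n → ℤ) ≠ 0 := single_add_single_ne_zero hij.ne
    have h1 : den (W.baseChange K) (P i + P j) ≠ 0 :=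
      (count_den W (add_ne_zero_of_linearIndependent _ hP hij.ne)).1
    rw [logHeight_eq_count h hP 𝔭 hij0, h.add_single i j hij.ne, spanSingleton_one,
      count_one, sub_zero, ← combHom_apply, map_add, combHom_single, combHom_single, formIdeal,
      formIdeal, formIdeal, if_pos rfl, if_pos rfl, if_neg hij.ne,
      count_mul K 𝔭 (mul_ne_zero h1 (inv_ne_zero (hd i))) (inv_ne_zero (hd j)),
      count_mul K 𝔭 h1 (inv_ne_zero (hd i)), count_inv, count_inv]
    ring

lemma den_comb_zero_eq (hP : LinearIndependent ℤ P) :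
    den (W.baseChange K) (comb (W.baseChange K) P 0) = netIdeal (W.baseChange K) P 0 := by
  rw [netIdeal, (isNetPoly_netPoly (W.baseChange K) hP).isElliptic.1, spanSingleton_zero, mul_zero,
    ← combHom_apply, map_zero]
  rfl

lemma den_comb_ne_zero (hP : LinearIndependent ℤ P) {v : Fin n → ℤ} (hv : v ≠ 0) :
    den (W.baseChange K) (comb (W.baseChange K) P v) ≠ 0 :=
  (count_den W ((map_ne_zero_iff _ (combHom_injective _ hP)).2 hv)).1

lemma netIdeal_ne_zero (hP : LinearIndependent ℤ P) {v : Fin n → ℤ} (hv : v ≠ 0) :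
    netIdeal (W.baseChange K) P v ≠ 0 :=
  mul_ne_zero (idealForm_ne_zero hP v) (spanSingleton_ne_zero_iff.2
    ((isNetPoly_netPoly (W.baseChange K) hP).ne_zero hP hv))

end Main

end EllNet

theorem mainTheorem6 {K : Type*} [Field K] [NumberField K] [DecidableEq K]
    (W : WeierstrassCurve (𝓞 K)) [(W.baseChange K).IsElliptic] {n : ℕ}
    (P : Fin n → (W.baseChange K).toAffine.Point) (hP : LinearIndependent ℤ P) :
    -- `F` is a quadratic form with values in the group of nonzero fractional ideals
    ((∀ v, EllNet.idealForm (W.baseChange K) P v ≠ 0) ∧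
      EllNet.IsQuadForm (EllNet.idealForm (W.baseChange K) P)) ∧
    -- equality at a prime at which all the points have non-singular reduction
    (∀ 𝔭 : IsDedekindDomain.HeightOneSpectrum (𝓞 K),
      (∀ i, EllNet.NonsingularMod (W.baseChange K) 𝔭 (P i)) →
        ∀ v : Fin n → ℤ,
          EllNet.expAt 𝔭 (EllNet.den (W.baseChange K) (EllNet.comb (W.baseChange K) P v)) =
            EllNet.expAt 𝔭 (EllNet.netIdeal (W.baseChange K) P v)) ∧
    -- equality of ideals if all the points are non-singular modulo every prime
    ((∀ (𝔭 : IsDedekindDomain.HeightOneSpectrum (𝓞 K)) (i : Fin n),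
        EllNet.NonsingularMod (W.baseChange K) 𝔭 (P i)) →
      ∀ v : Fin n → ℤ,
        EllNet.den (W.baseChange K) (EllNet.comb (W.baseChange K) P v) =
          EllNet.netIdeal (W.baseChange K) P v) ∧
    -- class number one: generators `α i j` of the ideals `A_{ij}` exist, and for every choice of
    -- them the elements `∏ (α i j) ^ (v i * v j) * Ψ_v(P)` generate the ideals `Ψ̂_v(P)` and form
    -- an elliptic net that is scale equivalent to `Ψ`
    (NumberField.classNumber K = 1 →
      (∃ α : Fin n → Fin n → K, ∀ i j, FractionalIdeal.spanSingleton (𝓞 K)⁰ (α i j) =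
        EllNet.formIdeal (W.baseChange K) P i j) ∧
      ∀ α : Fin n → Fin n → K,
        (∀ i j, i ≤ j → FractionalIdeal.spanSingleton (𝓞 K)⁰ (α i j) =
          EllNet.formIdeal (W.baseChange K) P i j) →
        (∀ v : Fin n → ℤ,
          FractionalIdeal.spanSingleton (𝓞 K)⁰
              (EllNet.prodForm α v * EllNet.netPoly (W.baseChange K) P v) =
            EllNet.netIdeal (W.baseChange K) P v) ∧
        EllNet.IsElliptic
          (fun v : Fin n → ℤ => EllNet.prodForm α v * EllNet.netPoly (W.baseChange K) P v) ∧
        EllNet.ScaleEquivalent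
          (fun v : Fin n → ℤ => EllNet.prodForm α v * EllNet.netPoly (W.baseChange K) P v)
          (EllNet.netPoly (W.baseChange K) P)) := by
  have hΨ := EllNet.isNetPoly_netPoly (W.baseChange K) hP
  have hF : ∀ i j : Fin n, i ≤ j → EllNet.formIdeal (W.baseChange K) P i j ≠ 0 :=
    fun i j _ ↦ EllNet.formIdeal_ne_zero hP i j
  refine ⟨⟨EllNet.idealForm_ne_zero hP, EllNet.isQuadForm_prodForm hF⟩, fun 𝔭 hg v ↦ ?_,
    fun hg v ↦ ?_, fun hK ↦ ⟨?_, fun α hα ↦ ?_⟩⟩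
  · by_cases hv : v = 0
    · rw [hv, EllNet.den_comb_zero_eq hP]
    · rw [EllNet.expAt, EllNet.expAt, if_neg (EllNet.den_comb_ne_zero hP hv),
        if_neg (EllNet.netIdeal_ne_zero hP hv), EllNet.count_den_comb hP hg hv]
  · by_cases hv : v = 0
    · rw [hv, EllNet.den_comb_zero_eq hP]
    · exact EllNet.eq_of_count_eq (EllNet.den_comb_ne_zero hP hv)
        (EllNet.netIdeal_ne_zero hP hv) fun 𝔭 ↦ EllNet.count_den_comb hP (hg 𝔭) hv
  · have := NumberField.classNumber_eq_one_iff.1 hK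
    have h (I : FractionalIdeal (𝓞 K)⁰ K) :
        ∃ x, FractionalIdeal.spanSingleton (𝓞 K)⁰ x = I := by
      obtain ⟨x, hx⟩ := (FractionalIdeal.isPrincipal_iff I).1 inferInstance
      exact ⟨x, hx.symm⟩
    choose α hα using h
    exact ⟨fun i j ↦ α _, fun i j ↦ hα _⟩
  · have hα0 : ∀ i j : Fin n, i ≤ j → α i j ≠ 0 := fun i j hij h0 ↦ hF i j hij (by
      rw [← hα i j hij, h0, FractionalIdeal.spanSingleton_zero])
    have hq := EllNet.isQuadForm_prodForm hα0
    have hq0 := EllNet.prodForm_ne_zero hα0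
    have hell := hΨ.isElliptic.quadForm_mul hq hq0
    refine ⟨fun v ↦ ?_, hell, hell, hΨ.isElliptic, fun v ↦ Units.mk0 _ (hq0 v), ⟨?_, ?_⟩,
      fun v ↦ mul_comm _ _⟩
    · rw [EllNet.netIdeal, ← FractionalIdeal.spanSingleton_mul_spanSingleton,
        EllNet.spanSingleton_prodForm]
      congr 1
      refine Finset.prod_congr rfl fun i _ ↦ Finset.prod_congr rfl fun j hj ↦ ?_
      exact congrArg (· ^ (v i * v j)) (hα i j (Finset.mem_filter.1 hj).2)
    · exact fun x y z ↦ Units.ext (hq.1 x y z)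
    · exact fun x y ↦ Units.ext (hq.2 x y)
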